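/- A Banach lattice is called disjointly homogeneous (DH) if any two of its normalized sequences of pairwise disjoint elements contain equivalent subsequences; for $1\le p\le\infty$ it is called $p$-disjointly homogeneous ($p$-DH) if every normalized sequence of pairwise disjoint elements contains a subsequence equivalent to the unit vector basis of $\ell_p$ ($c_0$ if $p=\infty$). (Sequences $(x_n)$, $(y_n)$ are equivalent if $C^{-1}\|\sum a_nx_n\|\le\|\sum a_ny_n\|\le C\|\sum a_nx_n\|$ for some constant $C$ and all finitely supported real $(a_n)$.) A rearrangement invariant (r.i.) space on $[0,1]$ is a nonzero Banach function lattice $X$ on $[0,1]$ with Lebesgue measure $\mu$ such that equimeasurable functions belong to $X$ simultaneously and have equal norms, and which is separable or maximal (i.e. $X=X''$ isometrically, where $X'$ denotes the Köthe dual). Let $X_0\subset X_1$ be r.i. spaces on $[0,1]$ with strict embedding, that is, $\|x_n\|_{X_1}\to0$ whenever $\sup_n\|x_n\|_{X_0}<\infty$ and $\mu(\operatorname{supp}x_n)\to0$. Let $E$ be a real Banach space with a normalized $1$-unconditional basis $(e_n)_{n\ge1}$, considered as a Banach lattice ordered by this basis ($\sum a_ne_n\ge0$ iff all $a_n\ge0$).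 Let $(m_n)_{n\ge1}$ be an increasing sequence of reals with $m_1\ge2$ and $$m_n^{-1}\sum_{i=1}^{n-1}m_i+m_n\sum_{i=n+1}^{\infty}m_i^{-1}<2^{-n-1},\qquad n=1,2,\dots$$ Let $W=W_E^K(X_0,X_1)$ be the Lions–Peetre space of all $x\in X_0+X_1$ for which $\sum_n k_n(x)e_n$ converges in $E$, with $\|x\|_W=\big\|\sum_n k_n(x)e_n\big\|_E$, where $k_n(x)=\inf\{m_n^{-1}\|y\|_{X_0}+m_n\|z\|_{X_1}:\ x=y+z,\ y\in X_0,\ z\in X_1\}$. Let $1\le p\le\infty$. Then the following conditions are equivalent: (a) $E$ is a DH (resp. $p$-DH) lattice; (b) every two normalized block bases of $(e_n)$ contain subsequences that are equivalent in $E$ (resp. every normalized block basis of $(e_n)$ contains a subsequence equivalent in $E$ to the unit vector basis of $\ell_p$, or of $c_0$ if $p=\infty$); (c) $W$ is a DH (resp. $p$-DH) r.i. space. -/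

import Mathlib

open scoped ENNReal NNReal Topology
open MeasureTheory Filter

/-! ### Sequences in normed vector lattices

A normed space of functions is described by its extended norm `N : V → [0, ∞]` on an ambient
real vector lattice `V`: the space is `{x | N x < ∞}`, and `N x = ∞` exactly for `x` outside the
space. For an ordinary normed lattice `E` one takes `V = E` and `N = ‖·‖ₑ`. -/

/-- The sequence `x` (in the space with norm `N`) and the sequence `y` (in the space with
norm `N'`) are equivalent: the norms of corresponding linear combinations are comparable up to a
fixed finite constant. -/
def EquivSeq {V V' : Type*} [AddCommGroup V] [Module ℝ V] [AddCommGroup V'] [Module ℝ V']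
    (N : V → ℝ≥0∞) (x : ℕ → V) (N' : V' → ℝ≥0∞) (y : ℕ → V') : Prop :=
  ∃ C : ℝ≥0, ∀ (s : Finset ℕ) (a : ℕ → ℝ),
    N (∑ i ∈ s, a i • x i) ≤ C * N' (∑ i ∈ s, a i • y i) ∧
    N' (∑ i ∈ s, a i • y i) ≤ C * N (∑ i ∈ s, a i • x i)

/-- `x` and `y` (both in the space with norm `N`) contain equivalent subsequences. -/
def HaveEquivSubseq {V : Type*} [AddCommGroup V] [Module ℝ V]
    (N : V → ℝ≥0∞) (x y : ℕ → V) : Prop :=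
  ∃ φ ψ : ℕ → ℕ, StrictMono φ ∧ StrictMono ψ ∧ EquivSeq N (x ∘ φ) N (y ∘ ψ)

/-- `x` has a subsequence equivalent to the unit vector basis of `ℓ_p`. For `p = ∞` the unit
vectors of `ℓ_∞` are the unit vector basis of `c₀`, since `c₀` carries the norm of `ℓ_∞`. -/
def HasLpSubseq {V : Type*} [AddCommGroup V] [Module ℝ V]
    (N : V → ℝ≥0∞) (p : ℝ≥0∞) [Fact (1 ≤ p)] (x : ℕ → V) : Prop :=
  ∃ φ : ℕ → ℕ, StrictMono φ ∧
    EquivSeq N (x ∘ φ) (fun u : lp (fun _ : ℕ => ℝ) p => ‖u‖ₑ)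
      (fun i => lp.single p i (1 : ℝ))

/-- `x` is a normalized sequence of pairwise disjoint elements. -/
def IsNormalizedDisjoint {V : Type*} [AddCommGroup V] [Lattice V]
    (N : V → ℝ≥0∞) (x : ℕ → V) : Prop :=
  (∀ n, N (x n) = 1) ∧ ∀ i j, i ≠ j → |x i| ⊓ |x j| = 0

/-- Disjointly homogeneous: any two normalized disjoint sequences contain equivalent
subsequences. -/
def IsDH {V : Type*} [AddCommGroup V] [Module ℝ V] [Lattice V] (N : V → ℝ≥0∞) : Prop :=
  ∀ x y : ℕ → V, IsNormalizedDisjoint N x → IsNormalizedDisjoint N y → HaveEquivSubseq N x y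

/-- `p`-disjointly homogeneous: every normalized disjoint sequence contains a subsequence
equivalent to the unit vector basis of `ℓ_p` (`c₀` if `p = ∞`). -/
def IsPDH {V : Type*} [AddCommGroup V] [Module ℝ V] [Lattice V] (N : V → ℝ≥0∞)
    (p : ℝ≥0∞) [Fact (1 ≤ p)] : Prop :=
  ∀ x : ℕ → V, IsNormalizedDisjoint N x → HasLpSubseq N p x

/-! ### Bases -/

/-- The sequence `e` is 1-unconditional: changing signs of coefficients does not change norms. -/
def IsOneUnconditional {E : Type*} [NormedAddCommGroup E] [NormedSpace ℝ E] (e : ℕ → E) : Prop :=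
  ∀ (s : Finset ℕ) (a ε : ℕ → ℝ), (∀ n, |ε n| = 1) →
    ‖∑ n ∈ s, (ε n * a n) • e n‖ = ‖∑ n ∈ s, a n • e n‖

/-- `u` is a normalized block basis of `e`: the `u j` are norm-one linear combinations of `e` over
successive intervals of indices. -/
def IsNormalizedBlockBasis {E : Type*} [NormedAddCommGroup E] [NormedSpace ℝ E]
    (e u : ℕ → E) : Prop :=
  (∀ j, ‖u j‖ = 1) ∧ ∃ (q : ℕ → ℕ) (a : ℕ → ℝ), StrictMono q ∧
    ∀ j, u j = ∑ n ∈ Finset.Ico (q j) (q (j + 1)), a n • e n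

/-! ### Rearrangement invariant spaces on `[0, 1]` -/

/-- Classes of a.e. equal real measurable functions on `[0, 1]` with Lebesgue measure. -/
abbrev L0 : Type := ℝ →ₘ[volume.restrict (Set.Icc (0 : ℝ) 1)] ℝ

/-- `ρ` is the (extended) norm of a Banach function lattice on `[0, 1]`: a complete norm on
`{x | ρ x < ∞}` with the ideal property. -/
structure IsBanachFunctionNorm (ρ : L0 → ℝ≥0∞) : Prop where
  eq_zero_iff : ∀ x, ρ x = 0 ↔ x = 0
  smul : ∀ (c : ℝ) (x : L0), ρ (c • x) = ‖c‖ₑ * ρ x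
  add_le : ∀ x y, ρ (x + y) ≤ ρ x + ρ y
  ideal : ∀ x y : L0, |x| ≤ |y| → ρ x ≤ ρ y
  complete : ∀ u : ℕ → L0, (∀ n, ρ (u n) < ∞) →
    (∀ ε : ℝ≥0∞, 0 < ε → ∃ M, ∀ i ≥ M, ∀ j ≥ M, ρ (u i - u j) < ε) →
    ∃ x, ρ x < ∞ ∧ Tendsto (fun n => ρ (u n - x)) atTop (𝓝 0)

/-- `x` and `y` are equimeasurable. -/
def Equimeasurable (x y : L0) : Prop :=
  ∀ τ : ℝ, 0 < τ →
    volume.restrict (Set.Icc (0 : ℝ) 1) {t | τ < |x t|} =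
      volume.restrict (Set.Icc (0 : ℝ) 1) {t | τ < |y t|}

/-- The (extended) norm of the Köthe dual space. -/
noncomputable def kotheDual (ρ : L0 → ℝ≥0∞) (f : L0) : ℝ≥0∞ :=
  ⨆ (g : L0) (_ : ρ g ≤ 1), ∫⁻ t, ‖f t * g t‖ₑ ∂(volume.restrict (Set.Icc (0 : ℝ) 1))

/-- The space with norm `ρ` coincides isometrically with its second Köthe dual. -/
def IsMaximal (ρ : L0 → ℝ≥0∞) : Prop :=
  ∀ x, kotheDual (kotheDual ρ) x = ρ x

/-- The space with norm `ρ` is separable. -/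
def IsSeparableNorm (ρ : L0 → ℝ≥0∞) : Prop :=
  ∃ D : Set L0, D.Countable ∧ (∀ d ∈ D, ρ d < ∞) ∧
    ∀ x, ρ x < ∞ → ∀ ε : ℝ≥0∞, 0 < ε → ∃ d ∈ D, ρ (x - d) < ε

/-- `ρ` is the norm of a (nonzero) rearrangement invariant space on `[0, 1]`; as usual, such spaces
are required to be separable or maximal. -/
structure IsRISpace (ρ : L0 → ℝ≥0∞) : Prop where
  isBanachFunctionNorm : IsBanachFunctionNorm ρ
  nontrivial : ∃ x, x ≠ 0 ∧ ρ x < ∞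
  equimeasurable : ∀ x y, Equimeasurable x y → ρ x = ρ y
  separable_or_maximal : IsSeparableNorm ρ ∨ IsMaximal ρ

/-- The space with norm `ρ₀` is contained in the one with norm `ρ₁`, and the embedding is strict:
sequences bounded in the first one whose supports have measures tending to `0` converge to `0` in
the second one. -/
def StrictlyEmbedded (ρ₀ ρ₁ : L0 → ℝ≥0∞) : Prop :=
  (∀ x, ρ₀ x < ∞ → ρ₁ x < ∞) ∧
  ∀ x : ℕ → L0, (∃ C : ℝ≥0, ∀ n, ρ₀ (x n) ≤ C) →
    Tendsto (fun n => volume.restrict (Set.Icc (0 : ℝ) 1) {t | x n t ≠ 0}) atTop (𝓝 0) →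
    Tendsto (fun n => ρ₁ (x n)) atTop (𝓝 0)

/-! ### Lions-Peetre spaces -/

/-- Peetre's K-functional `k(α, β, x)` of the couple with norms `N₀`, `N₁`; it is infinite exactly
when `x` is outside the sum of the two spaces (for `α, β > 0`). -/
noncomputable def peetreK {V : Type*} [Add V] (N₀ N₁ : V → ℝ≥0∞) (α β : ℝ) (x : V) : ℝ≥0∞ :=
  ⨅ (y : V) (z : V) (_ : x = y + z), ENNReal.ofReal α * N₀ y + ENNReal.ofReal β * N₁ z

/-- The (extended) norm of the Lions-Peetre space `W_E^K(X₀, X₁, (α n), (β n))`: it is `‖s‖` if `x`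
lies in `X₀ + X₁` and the series `∑ k(α n, β n, x) e n` converges in `E` to `s`; it is `∞` (an
infimum over the empty set) if there is no such `s`. -/
noncomputable def lionsPeetre {V E : Type*} [Add V] [NormedAddCommGroup E] [NormedSpace ℝ E]
    (N₀ N₁ : V → ℝ≥0∞) (e : ℕ → E) (α β : ℕ → ℝ) (x : V) : ℝ≥0∞ :=
  ⨅ (s : E) (_ : (∀ n, peetreK N₀ N₁ (α n) (β n) x < ∞) ∧
      Tendsto (fun M => ∑ n ∈ Finset.range M, (peetreK N₀ N₁ (α n) (β n) x).toReal • e n)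
        atTop (𝓝 s)), ‖s‖ₑ

/-- The weight condition, with indices starting from `0`: `m` is increasing, `m 0 ≥ 2`, and
`m_n⁻¹ ∑_{i<n} m_i + m_n ∑_{i>n} m_i⁻¹ < 2^{-(n+2)}` for all `n ≥ 0`. -/
structure IsAdmissibleWeight (m : ℕ → ℝ) : Prop where
  strictMono : StrictMono m
  two_le : 2 ≤ m 0
  summable : Summable fun i => (m i)⁻¹
  lt : ∀ n, (m n)⁻¹ * ∑ i ∈ Finset.range n, m i + m n * ∑' i, (m (n + 1 + i))⁻¹
    < (1 / 2 : ℝ) ^ (n + 2)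

/-! ### Equivalent sequences -/

/-! Condition (b) is the hub: disjoint sequences of `E` and of `W` are both compared with block
bases of `e`.

In `E`, a block basis is disjoint. Conversely, each coordinate is nonzero on at most one member of a
disjoint sequence, so the sequence is coordinatewise null and a gliding hump turns a subsequence
into a small perturbation of a block basis.

In `W`, an element `x` has a profile `s(x) = ∑ k_n(x) e_n` in `E` with `‖x‖_W = ‖s(x)‖`. Each `k_n`
is subadditive, homogeneous and monotone in `|x|`. Hence for disjoint `x_i` the profile of `∑ a_i
x_i` lies coordinatewise between the maximum and the sum of the `|a_i| s(x_i)`. The two bounds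
nearly agree when the `s(x_i)` are nearly supported on disjoint intervals, so the gliding hump
applies to coordinatewise null profiles (`IsOneUnconditional.exists_equiv_block`). As `k_n(x) ≤ m_n
‖x‖_{X₁}`, it suffices that normalized disjoint sequences of `W` tend to `0` in `X₁`; strictness of
the embedding gives this (`tendsto_of_isNormalizedDisjoint_lionsPeetre`).

Conversely, block bases are copied into `W` by means of disjoint `w_n` with `‖w_n‖_{X₀} ≤ m_n`,
`‖w_n‖_{X₁} ≤ 1/m_n` and `k_n(w_n) ≥ 1/8` for large `n` (`exists_disjoint_peetreK`). Since `k_n(w_i)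
≤ min (m_i/m_n) (m_n/m_i)`, the growth of `m` makes the matrix `k_n(w_i)` almost diagonal, and `∑
d_n w_n` has norm comparable with `∑ d_n e_n`. Each `w_n` is a multiple of the indicator of a set on
whose measure the ratio of the fundamental functions of `X₀` and `X₁` is about `m_n²`; strictness
makes this ratio unbounded near `0`, and summability of `1/m_n²` leaves room in `[0, 1]`.

Finally `W` is an r.i. space: the K-functional is rearrangement invariant, completeness passes
through limits in `X₁`, and a dominated convergence theorem in `W`, again due to strictness, gives
separability. -/

theorem EquivSeq.symm {V V' : Type*} [AddCommGroup V] [Module ℝ V] [AddCommGroup V'] [Module ℝ V']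
    {N : V → ℝ≥0∞} {x : ℕ → V} {N' : V' → ℝ≥0∞} {y : ℕ → V'} (h : EquivSeq N x N' y) :
    EquivSeq N' y N x := by
  obtain ⟨C, hC⟩ := h
  exact ⟨C, fun s a => (hC s a).symm⟩

theorem EquivSeq.trans {V V' V'' : Type*} [AddCommGroup V] [Module ℝ V] [AddCommGroup V']
    [Module ℝ V'] [AddCommGroup V''] [Module ℝ V'']
    {N : V → ℝ≥0∞} {x : ℕ → V} {N' : V' → ℝ≥0∞} {y : ℕ → V'} {N'' : V'' → ℝ≥0∞} {z : ℕ → V''}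
    (h : EquivSeq N x N' y) (h' : EquivSeq N' y N'' z) : EquivSeq N x N'' z := by
  obtain ⟨C, hC⟩ := h
  obtain ⟨D, hD⟩ := h'
  refine ⟨C * D, fun s a => ⟨?_, ?_⟩⟩
  · calc _ ≤ _ := (hC s a).1
      _ ≤ C * (D * N'' (∑ i ∈ s, a i • z i)) := by gcongr; exact (hD s a).1
      _ = _ := by push_cast; ring
  · calc _ ≤ _ := (hD s a).2
      _ ≤ D * (C * N (∑ i ∈ s, a i • x i)) := by gcongr; exact (hC s a).2
      _ = _ := by push_cast; ring

theorem EquivSeq.comp {V V' : Type*} [AddCommGroup V] [Module ℝ V] [AddCommGroup V'] [Module ℝ V']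
    {N : V → ℝ≥0∞} {x : ℕ → V} {N' : V' → ℝ≥0∞} {y : ℕ → V'} (h : EquivSeq N x N' y)
    {φ : ℕ → ℕ} (hφ : StrictMono φ) : EquivSeq N (x ∘ φ) N' (y ∘ φ) := by
  obtain ⟨C, hC⟩ := h
  refine ⟨C, fun s a => ?_⟩
  have key := hC (s.map ⟨φ, hφ.injective⟩) (fun k => a (Function.invFun φ k))
  simpa [Finset.sum_map, Function.leftInverse_invFun hφ.injective _] using key

/-! ### 1-unconditional bases -/

section Unconditional

variable {E : Type*} [NormedAddCommGroup E] [NormedSpace ℝ E]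

/-- A multiplier `c ∈ [-1, 1]` is the convex combination of `1` and `-1` with weights `(1 + c)/2`
and `(1 - c)/2`, so the new sum averages the old one and its reflection in the `k`-th coordinate. -/
theorem IsOneUnconditional.norm_sum_update_le {e : ℕ → E} (h : IsOneUnconditional e)
    (s : Finset ℕ) (a : ℕ → ℝ) (k : ℕ) {c : ℝ} (hc : |c| ≤ 1) :
    ‖∑ n ∈ s, Function.update a k (c * a k) n • e n‖ ≤ ‖∑ n ∈ s, a n • e n‖ := by
  have hsign : ‖∑ n ∈ s, (Function.update (fun _ => (1 : ℝ)) k (-1) n * a n) • e n‖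
      = ‖∑ n ∈ s, a n • e n‖ := by
    apply h
    intro n
    by_cases hn : n = k
    · subst hn; simp
    · simp [hn]
  have hsplit : ∑ n ∈ s, Function.update a k (c * a k) n • e n
      = ((1 + c) / 2) • ∑ n ∈ s, a n • e n
        + ((1 - c) / 2) • ∑ n ∈ s, (Function.update (fun _ => (1 : ℝ)) k (-1) n * a n) • e n := by
    rw [Finset.smul_sum, Finset.smul_sum, ← Finset.sum_add_distrib]
    refine Finset.sum_congr rfl fun n _ => ?_
    rw [smul_smul, smul_smul, ← add_smul]
    congr 1
    by_cases hn : n = k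
    · subst hn; simp; ring
    · simp [hn]; ring
  rw [abs_le] at hc
  rw [hsplit]
  refine (norm_add_le _ _).trans ?_
  rw [norm_smul, norm_smul, hsign, Real.norm_of_nonneg (by linarith),
    Real.norm_of_nonneg (by linarith)]
  apply le_of_eq; ring

theorem IsOneUnconditional.norm_sum_smul_le {e : ℕ → E} (h : IsOneUnconditional e)
    (s : Finset ℕ) {a b : ℕ → ℝ} (hab : ∀ n ∈ s, |a n| ≤ |b n|) :
    ‖∑ n ∈ s, a n • e n‖ ≤ ‖∑ n ∈ s, b n • e n‖ := by
  have key : ∀ t : Finset ℕ, (∀ n ∈ t, |a n| ≤ |b n|) →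
      ‖∑ n ∈ s, (if n ∈ t then a n else b n) • e n‖ ≤ ‖∑ n ∈ s, b n • e n‖ := by
    intro t
    induction t using Finset.induction_on with
    | empty => intro _; simp
    | insert k t hk ih =>
      intro hle
      -- Coefficients are lowered one at a time. If `b k = 0` then also `a k = 0`, and the
      -- convention `a k / 0 = 0` still gives an admissible multiplier.
      refine le_trans (le_of_eq_of_le ?_ (h.norm_sum_update_le s
        (fun n => if n ∈ t then a n else b n) k (c := a k / b k) ?_))
        (ih fun n hn => hle n (Finset.mem_insert_of_mem hn))
      · congr 1
        refine Finset.sum_congr rfl fun n _ => ?_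
        congr 1
        by_cases hn : n = k
        · subst hn
          have h1 := hle n (Finset.mem_insert_self _ _)
          by_cases hb : b n = 0
          · simp [hb] at h1
            simp [hk, hb, h1]
          · simp [hk, hb]
        · simp [hn]
      · rw [abs_div]
        exact div_le_one_of_le₀ (hle k (Finset.mem_insert_self _ _)) (abs_nonneg _)
  refine le_of_eq_of_le ?_ (key s hab)
  congr 1
  refine Finset.sum_congr rfl fun n hn => ?_
  simp [hn]

variable (e : UnconditionalSchauderBasis ℕ ℝ E)

theorem UnconditionalSchauderBasis.hasSum (x : E) : HasSum (fun n => e.coord n x • e n) x :=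
  e.expansion x

theorem UnconditionalSchauderBasis.ext_coord {x y : E}
    (h : ∀ n, e.coord n x = e.coord n y) : x = y := by
  have h1 := UnconditionalSchauderBasis.hasSum e x
  have h2 := UnconditionalSchauderBasis.hasSum e y
  simp only [h] at h1
  exact h1.unique h2

theorem UnconditionalSchauderBasis.coord_apply (n k : ℕ) :
    e.coord n (e k) = if n = k then 1 else 0 := by
  rw [e.ortho]; simp [Pi.single_apply]

theorem UnconditionalSchauderBasis.coord_sum (s : Finset ℕ) (a : ℕ → ℝ) (n : ℕ) :
    e.coord n (∑ i ∈ s, a i • e i) = if n ∈ s then a n else 0 := by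
  simp [UnconditionalSchauderBasis.coord_apply]

theorem UnconditionalSchauderBasis.coord_of_hasSum {a : ℕ → ℝ} {x : E}
    (h : HasSum (fun n => a n • e n) x) (n : ℕ) : e.coord n x = a n := by
  have h1 : HasSum (fun k => e.coord n (a k • e k)) (e.coord n x) := (e.coord n).hasSum h
  have h2 : HasSum (fun k => e.coord n (a k • e k)) (a n) := by
    convert hasSum_ite_eq n (a n) using 1
    ext k
    by_cases hk : k = n
    · simp [UnconditionalSchauderBasis.coord_apply, hk]
    · simp [UnconditionalSchauderBasis.coord_apply, hk, Ne.symm hk]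
  exact h1.unique h2

theorem UnconditionalSchauderBasis.coord_of_tendsto {a : ℕ → ℝ} {x : E}
    (h : Tendsto (fun M => ∑ n ∈ Finset.range M, a n • e n) atTop (𝓝 x)) (n : ℕ) :
    e.coord n x = a n := by
  have h1 : Tendsto (fun M => e.coord n (∑ k ∈ Finset.range M, a k • e k)) atTop
      (𝓝 (e.coord n x)) := ((e.coord n).continuous.tendsto x).comp h
  refine tendsto_nhds_unique h1 (tendsto_const_nhds.congr' ?_)
  filter_upwards [eventually_gt_atTop n] with M hM
  rw [UnconditionalSchauderBasis.coord_sum]; simp [hM]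

variable {e}

theorem IsOneUnconditional.norm_le (h : IsOneUnconditional e) {x y : E}
    (hxy : ∀ n, |e.coord n x| ≤ |e.coord n y|) : ‖x‖ ≤ ‖y‖ := by
  have h1 := (UnconditionalSchauderBasis.hasSum e x).norm
  have h2 := (UnconditionalSchauderBasis.hasSum e y).norm
  exact le_of_tendsto_of_tendsto' h1 h2 fun s => h.norm_sum_smul_le s fun n _ => hxy n

/-- The Cauchy criterion for unconditional convergence only sees norms of finite sums, which
dominated coefficients do not increase. -/
theorem IsOneUnconditional.exists_coord_eq [CompleteSpace E] (h : IsOneUnconditional e)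
    {x : E} {a : ℕ → ℝ} (ha : ∀ n, |a n| ≤ |e.coord n x|) : ∃ y, ∀ n, e.coord n y = a n := by
  have hs : Summable fun n => a n • e n := by
    have hx := (UnconditionalSchauderBasis.hasSum e x).summable
    rw [summable_iff_vanishing_norm] at hx ⊢
    intro ε hε
    obtain ⟨s, hs⟩ := hx ε hε
    exact ⟨s, fun t ht => (h.norm_sum_smul_le t fun n _ => ha n).trans_lt (hs t ht)⟩
  exact ⟨∑' n, a n • e n, UnconditionalSchauderBasis.coord_of_hasSum e hs.hasSum⟩

theorem IsOneUnconditional.norm_sum_le_norm (h : IsOneUnconditional e) (s : Finset ℕ)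
    {a : ℕ → ℝ} {x : E} (ha : ∀ n ∈ s, |a n| ≤ |e.coord n x|) :
    ‖∑ n ∈ s, a n • e n‖ ≤ ‖x‖ := by
  refine h.norm_le fun n => ?_
  rw [UnconditionalSchauderBasis.coord_sum]
  split_ifs with hn
  · exact ha n hn
  · simp

theorem IsOneUnconditional.abs_coord_le (h : IsOneUnconditional e) (he : ∀ n, ‖e n‖ = 1)
    (n : ℕ) (x : E) : |e.coord n x| ≤ ‖x‖ := by
  have := h.norm_sum_le_norm {n} (a := fun k => e.coord k x) (x := x) (fun _ _ => le_rfl)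
  simpa [norm_smul, he] using this

end Unconditional

/-! ### The lattice structure given by an unconditional basis -/

section LatticeOrder

variable {E : Type*} [NormedAddCommGroup E] [NormedSpace ℝ E] [CompleteSpace E] [Lattice E]
  {e : UnconditionalSchauderBasis ℕ ℝ E}

/-- The lattice operations are known only through the order. The formula `max a b = (a + b + |a -
b|)/2` yields an element with the right coordinates, and such an element must be the supremum. -/
theorem IsOneUnconditional.coord_sup (h : IsOneUnconditional e)
    (hord : ∀ x y : E, x ≤ y ↔ ∀ n, e.coord n x ≤ e.coord n y) (x y : E) (n : ℕ) :
    e.coord n (x ⊔ y) = max (e.coord n x) (e.coord n y) := by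
  obtain ⟨z, hz⟩ := h.exists_coord_eq (x := x - y) (a := fun n => |e.coord n (x - y)|) (by simp)
  have hw : ∀ n, e.coord n ((1 / 2 : ℝ) • (x + y + z)) = max (e.coord n x) (e.coord n y) := by
    intro n
    rw [map_smul, map_add, map_add, hz, map_sub, smul_eq_mul]
    rcases le_total (e.coord n x) (e.coord n y) with hle | hle
    · rw [max_eq_right hle, abs_of_nonpos (by linarith)]; ring
    · rw [max_eq_left hle, abs_of_nonneg (by linarith)]; ring
  have : x ⊔ y = (1 / 2 : ℝ) • (x + y + z) := by
    apply le_antisymm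
    · apply sup_le <;> rw [hord] <;> intro n <;> rw [hw] <;> simp
    · rw [hord]; intro n; rw [hw]
      exact max_le ((hord _ _).1 le_sup_left n) ((hord _ _).1 le_sup_right n)
  rw [this, hw]

theorem IsOneUnconditional.coord_inf (h : IsOneUnconditional e)
    (hord : ∀ x y : E, x ≤ y ↔ ∀ n, e.coord n x ≤ e.coord n y) (x y : E) (n : ℕ) :
    e.coord n (x ⊓ y) = min (e.coord n x) (e.coord n y) := by
  have : x ⊓ y = -(-x ⊔ -y) := by
    have hc := fun n => h.coord_sup hord (-x) (-y) n
    simp only [map_neg, max_neg_neg] at hc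
    apply le_antisymm
    · rw [hord]; intro n; rw [map_neg, hc, neg_neg]
      exact le_min ((hord _ _).1 inf_le_left n) ((hord _ _).1 inf_le_right n)
    · apply le_inf <;> rw [hord] <;> intro n <;> rw [map_neg, hc, neg_neg] <;> simp
  rw [this, map_neg, h.coord_sup hord, map_neg, map_neg, max_neg_neg, neg_neg]

theorem IsOneUnconditional.coord_abs (h : IsOneUnconditional e)
    (hord : ∀ x y : E, x ≤ y ↔ ∀ n, e.coord n x ≤ e.coord n y) (x : E) (n : ℕ) :
    e.coord n |x| = |e.coord n x| := by
  rw [abs, h.coord_sup hord, map_neg, abs]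

theorem IsOneUnconditional.abs_inf_abs_eq_zero_iff (h : IsOneUnconditional e)
    (hord : ∀ x y : E, x ≤ y ↔ ∀ n, e.coord n x ≤ e.coord n y) (x y : E) :
    |x| ⊓ |y| = 0 ↔ ∀ n, e.coord n x = 0 ∨ e.coord n y = 0 := by
  have key : |x| ⊓ |y| = 0 ↔ ∀ n, min |e.coord n x| |e.coord n y| = 0 := by
    constructor
    · intro h0 n
      rw [← h.coord_abs hord, ← h.coord_abs hord, ← h.coord_inf hord, h0, map_zero]
    · intro h0
      apply UnconditionalSchauderBasis.ext_coord e
      intro n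
      rw [h.coord_inf hord, h.coord_abs hord, h.coord_abs hord, h0, map_zero]
  rw [key]
  refine forall_congr' fun n => ?_
  constructor
  · intro h0
    rcases min_choice |e.coord n x| |e.coord n y| with h1 | h1 <;> rw [h1, abs_eq_zero] at h0 <;>
      simp [h0]
  · rintro (h0 | h0) <;> simp [h0]

theorem StrictMono.eq_of_mem_Ico {q : ℕ → ℕ} (hq : StrictMono q) {n i j : ℕ}
    (hi : n ∈ Finset.Ico (q i) (q (i + 1))) (hj : n ∈ Finset.Ico (q j) (q (j + 1))) : i = j := by
  rw [Finset.mem_Ico] at hi hj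
  rcases lt_trichotomy i j with h | h | h
  · have := hq.monotone (Nat.succ_le_of_lt h); simp only [Nat.succ_eq_add_one] at this; omega
  · exact h
  · have := hq.monotone (Nat.succ_le_of_lt h); simp only [Nat.succ_eq_add_one] at this; omega

theorem IsNormalizedBlockBasis.isNormalizedDisjoint (h : IsOneUnconditional e)
    (hord : ∀ x y : E, x ≤ y ↔ ∀ n, e.coord n x ≤ e.coord n y) {u : ℕ → E}
    (hu : IsNormalizedBlockBasis e u) : IsNormalizedDisjoint (fun x : E => ‖x‖ₑ) u := by
  obtain ⟨h1, q, a, hq, hqa⟩ := hu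
  refine ⟨fun n => by simp [← ofReal_norm, h1], fun i j hij => ?_⟩
  rw [h.abs_inf_abs_eq_zero_iff hord]
  intro n
  rw [hqa, hqa, UnconditionalSchauderBasis.coord_sum, UnconditionalSchauderBasis.coord_sum]
  by_contra! hcon
  have hi : n ∈ Finset.Ico (q i) (q (i + 1)) := by by_contra hn; simp [hn] at hcon
  have hj : n ∈ Finset.Ico (q j) (q (j + 1)) := by
    by_contra hn; exact hcon.2 (by rw [if_neg hn])
  exact hij (hq.eq_of_mem_Ico hi hj)

end LatticeOrder

/-! ### Block sequences and the gliding hump -/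

section Blocks

variable {E : Type*} [NormedAddCommGroup E] [NormedSpace ℝ E]
  {e : UnconditionalSchauderBasis ℕ ℝ E}

/-- Each coordinate meets at most one block, so comparing two block sums reduces to comparing single
coefficients. -/
theorem UnconditionalSchauderBasis.coord_sum_blocks {q : ℕ → ℕ} (hq : StrictMono q)
    {u : ℕ → E} {α : ℕ → ℝ} (hu : ∀ j, u j = ∑ n ∈ Finset.Ico (q j) (q (j + 1)), α n • e n)
    (F : Finset ℕ) (a : ℕ → ℝ) (n : ℕ) :
    (∃ j ∈ F, n ∈ Finset.Ico (q j) (q (j + 1)) ∧ e.coord n (∑ i ∈ F, a i • u i) = a j * α n) ∨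
      ((∀ j ∈ F, n ∉ Finset.Ico (q j) (q (j + 1))) ∧ e.coord n (∑ i ∈ F, a i • u i) = 0) := by
  have hc : e.coord n (∑ i ∈ F, a i • u i)
      = ∑ i ∈ F, a i * (if n ∈ Finset.Ico (q i) (q (i + 1)) then α n else 0) := by
    rw [map_sum]
    refine Finset.sum_congr rfl fun i _ => ?_
    rw [map_smul, hu, UnconditionalSchauderBasis.coord_sum, smul_eq_mul]
  by_cases h : ∃ j ∈ F, n ∈ Finset.Ico (q j) (q (j + 1))
  · obtain ⟨j, hj, hn⟩ := h
    refine Or.inl ⟨j, hj, hn, ?_⟩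
    rw [hc, Finset.sum_eq_single_of_mem j hj, if_pos hn]
    intro i _ hij
    rw [if_neg fun hi => hij (hq.eq_of_mem_Ico hi hn), mul_zero]
  · push Not at h
    refine Or.inr ⟨h, ?_⟩
    rw [hc]
    exact Finset.sum_eq_zero fun i hi => by rw [if_neg (h i hi), mul_zero]

theorem IsOneUnconditional.norm_sum_blocks_le (h : IsOneUnconditional e) {q : ℕ → ℕ}
    (hq : StrictMono q) {u : ℕ → E} {α : ℕ → ℝ}
    (hu : ∀ j, u j = ∑ n ∈ Finset.Ico (q j) (q (j + 1)), α n • e n)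
    (F : Finset ℕ) {a b : ℕ → ℝ} (hab : ∀ j ∈ F, |a j| ≤ |b j|) :
    ‖∑ j ∈ F, a j • u j‖ ≤ ‖∑ j ∈ F, b j • u j‖ := by
  refine h.norm_le fun n => ?_
  rcases UnconditionalSchauderBasis.coord_sum_blocks hq hu F a n with ⟨j, hj, hn, h1⟩ | ⟨_, h1⟩
  · rcases UnconditionalSchauderBasis.coord_sum_blocks hq hu F b n with
      ⟨i, hi, hn', h2⟩ | ⟨hno, _⟩
    · obtain rfl := hq.eq_of_mem_Ico hn hn'
      rw [h1, h2, abs_mul, abs_mul]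
      exact mul_le_mul_of_nonneg_right (hab j hj) (abs_nonneg _)
    · exact absurd hn (hno j hj)
  · simp [h1]

/-- Block bases are described by one coefficient sequence, whereas constructions give separate
coefficients on each block; this glues them. The value off all blocks is irrelevant. -/
theorem StrictMono.exists_eq_on_Ico {β : Type*} {q : ℕ → ℕ} (hq : StrictMono q)
    (f : ℕ → ℕ → β) : ∃ α : ℕ → β, ∀ j, ∀ n ∈ Finset.Ico (q j) (q (j + 1)), α n = f j n := by
  classical
  refine ⟨fun n => if h : ∃ j, n ∈ Finset.Ico (q j) (q (j + 1)) then f h.choose n else f 0 n,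
    fun j n hn => ?_⟩
  have h : ∃ j, n ∈ Finset.Ico (q j) (q (j + 1)) := ⟨j, hn⟩
  simp only [dif_pos h]
  rw [hq.eq_of_mem_Ico h.choose_spec hn]

variable (e) in
-- Given the last index used and the end `Q` of the last block, a far enough term is almost `0` on
-- the coordinates below `Q`, and its expansion is almost exhausted before some `Q'`. Each of the
-- two errors is at most `2^{-(j+3)}`.
theorem exists_gliding_hump {s : ℕ → E} (hs : ∀ n, Tendsto (fun j => e.coord n (s j)) atTop (𝓝 0)) :
    ∃ φ q : ℕ → ℕ, StrictMono φ ∧ StrictMono q ∧ ∀ j,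
      ‖s (φ j) - ∑ n ∈ Finset.Ico (q j) (q (j + 1)), e.coord n (s (φ j)) • e n‖
        ≤ (1 / 2 : ℝ) ^ (j + 2) := by
  have step : ∀ j : ℕ, ∀ st : ℕ × ℕ, ∃ st' : ℕ × ℕ, st.1 < st'.1 ∧ st.2 < st'.2 ∧
      ‖s st'.1 - ∑ n ∈ Finset.Ico st.2 st'.2, e.coord n (s st'.1) • e n‖
        ≤ (1 / 2 : ℝ) ^ (j + 2) := by
    rintro j ⟨p, Q⟩
    have h1 : Tendsto (fun i => ‖∑ n ∈ Finset.range Q, e.coord n (s i) • e n‖) atTop (𝓝 0) := by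
      have : Tendsto (fun i => ∑ n ∈ Finset.range Q, e.coord n (s i) • e n) atTop
          (𝓝 (∑ n ∈ Finset.range Q, (0 : ℝ) • e n)) :=
        tendsto_finsetSum _ fun n _ => (hs n).smul_const _
      simpa using this.norm
    obtain ⟨p', hp', hpp⟩ := ((h1.eventually_le_const
      (show (0 : ℝ) < (1 / 2) ^ (j + 3) by positivity)).and (eventually_gt_atTop p)).exists
    have h2 : Tendsto (fun M => ‖s p' - ∑ n ∈ Finset.range M, e.coord n (s p') • e n‖) atTop
        (𝓝 0) := by
      have := (UnconditionalSchauderBasis.hasSum e (s p')).tendsto_sum_nat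
      simpa using (tendsto_const_nhds (x := s p')).sub this |>.norm
    obtain ⟨Q', hQ', hQQ⟩ := ((h2.eventually_le_const
      (show (0 : ℝ) < (1 / 2) ^ (j + 3) by positivity)).and (eventually_gt_atTop Q)).exists
    refine ⟨(p', Q'), hpp, hQQ, ?_⟩
    have hsum := Finset.sum_range_add_sum_Ico (fun n => e.coord n (s p') • e n) hQQ.le
    have : s p' - ∑ n ∈ Finset.Ico Q Q', e.coord n (s p') • e n
        = (s p' - ∑ n ∈ Finset.range Q', e.coord n (s p') • e n)
          + ∑ n ∈ Finset.range Q, e.coord n (s p') • e n := by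
      rw [← hsum]; abel
    simp only
    rw [this]
    refine (norm_add_le _ _).trans ((add_le_add hQ' hp').trans (le_of_eq ?_))
    rw [pow_succ _ (j + 2)]; ring
  choose g hg using step
  -- The state is (last index used, end of last block). Block `j` runs from the second entry at
  -- stage `j` to that at stage `j + 1`, while its index is the first entry at stage `j + 1`.
  let st : ℕ → ℕ × ℕ := fun j => Nat.rec (0, 0) (fun j st => g j st) j
  have hst : ∀ j, st (j + 1) = g j (st j) := fun j => rfl
  refine ⟨fun j => (st (j + 1)).1, fun j => (st j).2, ?_, ?_, ?_⟩
  · exact strictMono_nat_of_lt_succ fun j => by rw [hst (j + 1)]; exact (hg _ _).1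
  · exact strictMono_nat_of_lt_succ fun j => by rw [hst j]; exact (hg _ _).2.1
  · intro j
    have := (hg j (st j)).2.2
    rwa [← hst j] at this

/-- If a sequence `x` in a space with norm `N` is controlled by a coordinatewise null normalized
sequence `s` in a space with a 1-unconditional basis, then it contains a subsequence equivalent to a
block basis. -/
theorem IsOneUnconditional.exists_equiv_block (h : IsOneUnconditional e)
    {V : Type*} [AddCommGroup V] [Module ℝ V] {N : V → ℝ≥0∞} {x : ℕ → V} {s : ℕ → E}
    (hs : ∀ j, ‖s j‖ = 1) (hs0 : ∀ n, Tendsto (fun j => e.coord n (s j)) atTop (𝓝 0))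
    (hup : ∀ φ : ℕ → ℕ, StrictMono φ → ∀ (F : Finset ℕ) (a : ℕ → ℝ),
      N (∑ i ∈ F, a i • x (φ i)) ≤ ‖∑ i ∈ F, |a i| • s (φ i)‖ₑ)
    (hlow : ∀ φ : ℕ → ℕ, StrictMono φ → ∀ (F : Finset ℕ) (a : ℕ → ℝ) (g : E),
      (∀ n, e.coord n g = 0 ∨ ∃ i ∈ F, |e.coord n g| ≤ |a i| * |e.coord n (s (φ i))|) →
      ‖g‖ₑ ≤ N (∑ i ∈ F, a i • x (φ i))) :
    ∃ φ : ℕ → ℕ, StrictMono φ ∧ ∃ u : ℕ → E, IsNormalizedBlockBasis e u ∧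
      EquivSeq N (x ∘ φ) (fun y : E => ‖y‖ₑ) u := by
  obtain ⟨φ, q, hφ, hq, hhump⟩ := exists_gliding_hump e hs0
  set v : ℕ → E := fun j => ∑ n ∈ Finset.Ico (q j) (q (j + 1)), e.coord n (s (φ j)) • e n with hv
  have hv1 : ∀ j, ‖v j‖ ≤ 1 := fun j => by
    rw [← hs (φ j)]; exact h.norm_sum_le_norm _ fun _ _ => le_rfl
  have hv2 : ∀ j, 1 / 2 ≤ ‖v j‖ := fun j => by
    have h1 : ‖s (φ j)‖ ≤ ‖v j‖ + ‖s (φ j) - v j‖ := by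
      simpa using norm_add_le (v j) (s (φ j) - v j)
    have h2 : ((1 : ℝ) / 2) ^ (j + 2) ≤ 1 / 2 := by
      calc ((1 : ℝ) / 2) ^ (j + 2) ≤ (1 / 2) ^ 1 :=
            pow_le_pow_of_le_one (by norm_num) (by norm_num) (by omega)
        _ = 1 / 2 := by norm_num
    rw [hs] at h1
    linarith [hhump j]
  have hv0 : ∀ j, ‖v j‖ ≠ 0 := fun j => by linarith [hv2 j]
  obtain ⟨α, hα⟩ := hq.exists_eq_on_Ico fun j n => ‖v j‖⁻¹ * e.coord n (s (φ j))
  set u : ℕ → E := fun j => ‖v j‖⁻¹ • v j with hu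
  have huα : ∀ j, u j = ∑ n ∈ Finset.Ico (q j) (q (j + 1)), α n • e n := fun j => by
    simp only [hu, hv, Finset.smul_sum]
    exact Finset.sum_congr rfl fun n hn => by rw [hα j n hn, smul_smul]
  have huv : ∀ j, v j = ‖v j‖ • u j := fun j => by
    simp only [hu]; rw [smul_smul, mul_inv_cancel₀ (hv0 j), one_smul]
  have hu1 : ∀ j, ‖u j‖ = 1 := fun j => by
    simp only [hu]; rw [norm_smul, norm_inv, norm_norm, inv_mul_cancel₀ (hv0 j)]
  -- Upper estimate: replacing `s` by its truncations `v` costs `∑ |a i| 2^{-(i+2)}`. Each `|a i|`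
  -- is at most the norm of `∑ a i • u i`, so the loss is at most half of it, and the constant `2`
  -- suffices.
  refine ⟨φ, hφ, u, ⟨hu1, q, α, hq, huα⟩, 2, fun F a => ⟨?_, ?_⟩⟩
  · refine (hup φ hφ F a).trans ?_
    have hnorm : ‖∑ i ∈ F, |a i| • s (φ i)‖ ≤ 2 * ‖∑ i ∈ F, a i • u i‖ := by
      have h1 : ∑ i ∈ F, |a i| • s (φ i)
          = ∑ i ∈ F, (|a i| * ‖v i‖) • u i + ∑ i ∈ F, |a i| • (s (φ i) - v i) := by
        rw [← Finset.sum_add_distrib]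
        refine Finset.sum_congr rfl fun i _ => ?_
        rw [← smul_smul, ← huv, ← smul_add, add_sub_cancel]
      have h2 : ‖∑ i ∈ F, (|a i| * ‖v i‖) • u i‖ ≤ ‖∑ i ∈ F, a i • u i‖ :=
        h.norm_sum_blocks_le hq huα F fun j _ => by
          rw [abs_mul, abs_abs, abs_norm]
          exact mul_le_of_le_one_right (abs_nonneg _) (hv1 j)
      have h3 : ∀ i ∈ F, |a i| ≤ ‖∑ i ∈ F, a i • u i‖ := fun i hi => by
        have h4 := h.norm_sum_blocks_le hq huα F (a := fun j => if j = i then a i else 0) (b := a)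
          fun j _ => by
            split_ifs with hj
            · rw [hj]
            · simp
        simpa [hi, norm_smul, hu1] using h4
      have h5 : ‖∑ i ∈ F, |a i| • (s (φ i) - v i)‖ ≤ ‖∑ i ∈ F, a i • u i‖ := by
        calc _ ≤ ∑ i ∈ F, ‖|a i| • (s (φ i) - v i)‖ := norm_sum_le _ _
          _ ≤ ∑ i ∈ F, ‖∑ i ∈ F, a i • u i‖ * (1 / 2 : ℝ) ^ (i + 2) := by
              refine Finset.sum_le_sum fun i hi => ?_
              rw [norm_smul, norm_abs_eq_norm, Real.norm_eq_abs]
              exact mul_le_mul (h3 i hi) (hhump i) (norm_nonneg _) (norm_nonneg _)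
          _ = ‖∑ i ∈ F, a i • u i‖ * ((∑ i ∈ F, (1 / 2 : ℝ) ^ i) * (1 / 4)) := by
              rw [← Finset.mul_sum, Finset.sum_mul]
              congr 1
              exact Finset.sum_congr rfl fun i _ => by rw [pow_add]; norm_num
          _ ≤ ‖∑ i ∈ F, a i • u i‖ * (2 * (1 / 4)) := by
              gcongr
              exact (summable_geometric_two.sum_le_tsum F fun _ _ => by positivity).trans
                tsum_geometric_two.le
          _ ≤ _ := by nlinarith [norm_nonneg (∑ i ∈ F, a i • u i)]
      rw [h1]
      linarith [norm_add_le (∑ i ∈ F, (|a i| * ‖v i‖) • u i) (∑ i ∈ F, |a i| • (s (φ i) - v i))]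
    beta_reduce
    rw [← ofReal_norm, ← ofReal_norm]
    refine (ENNReal.ofReal_le_ofReal hnorm).trans (le_of_eq ?_)
    rw [ENNReal.ofReal_mul (by norm_num)]; simp
  -- Lower estimate: `∑ a i • v i` is dominated in each coordinate by a single `|a i| s (φ i)`, as
  -- `hlow` requires. Passing from `v` to `u` costs a factor `2` because `‖v j‖ ≥ 1/2`.
  · have h1 : ‖∑ i ∈ F, a i • v i‖ₑ ≤ N (∑ i ∈ F, a i • x (φ i)) := by
      refine hlow φ hφ F a _ fun n => ?_
      have h2 : ∑ i ∈ F, a i • v i = ∑ i ∈ F, (a i * ‖v i‖) • u i :=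
        Finset.sum_congr rfl fun i _ => by rw [← smul_smul, ← huv]
      rw [h2]
      rcases UnconditionalSchauderBasis.coord_sum_blocks hq huα F (fun i => a i * ‖v i‖) n with
        ⟨j, hj, hn, hc⟩ | ⟨_, hc⟩
      · refine Or.inr ⟨j, hj, ?_⟩
        rw [hc, hα j n hn, ← abs_mul]
        apply le_of_eq
        congr 1
        field_simp [hv0 j]
      · exact Or.inl hc
    have h2 : ‖∑ i ∈ F, a i • u i‖ ≤ 2 * ‖∑ i ∈ F, a i • v i‖ := by
      have h3 : (2 : ℝ) • ∑ i ∈ F, a i • v i = ∑ i ∈ F, (2 * (a i * ‖v i‖)) • u i := by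
        rw [Finset.smul_sum]
        exact Finset.sum_congr rfl fun i _ => by rw [← smul_smul, ← smul_smul, ← huv]
      have h4 : 2 * ‖∑ i ∈ F, a i • v i‖ = ‖∑ i ∈ F, (2 * (a i * ‖v i‖)) • u i‖ := by
        rw [← h3, norm_smul]; norm_num
      rw [h4]
      refine h.norm_sum_blocks_le hq huα F fun j _ => ?_
      rw [abs_mul, abs_mul, abs_norm, abs_two]
      nlinarith [abs_nonneg (a j), hv2 j]
    have h5 : ‖∑ i ∈ F, a i • u i‖ₑ ≤ 2 * ‖∑ i ∈ F, a i • v i‖ₑ := by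
      rw [← ofReal_norm, ← ofReal_norm]
      refine (ENNReal.ofReal_le_ofReal h2).trans (le_of_eq ?_)
      rw [ENNReal.ofReal_mul (by norm_num)]; simp
    refine h5.trans ?_
    push_cast
    gcongr
    exact h1

/-- The profiles are `|x j|`. Disjointness leaves each coordinate nonzero for at most one `j`, which
gives both coordinatewise nullness and the lower estimate. -/
theorem IsOneUnconditional.exists_equiv_block_of_disjoint [CompleteSpace E] [Lattice E]
    (h : IsOneUnconditional e)
    (hord : ∀ x y : E, x ≤ y ↔ ∀ n, e.coord n x ≤ e.coord n y)
    {x : ℕ → E} (hx : IsNormalizedDisjoint (fun x : E => ‖x‖ₑ) x) :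
    ∃ φ : ℕ → ℕ, StrictMono φ ∧ ∃ u : ℕ → E, IsNormalizedBlockBasis e u ∧
      EquivSeq (fun y : E => ‖y‖ₑ) (x ∘ φ) (fun y : E => ‖y‖ₑ) u := by
  obtain ⟨hx1, hx2⟩ := hx
  have hdis : ∀ i j, i ≠ j → ∀ n, e.coord n (x i) = 0 ∨ e.coord n (x j) = 0 := fun i j hij =>
    (h.abs_inf_abs_eq_zero_iff hord _ _).1 (hx2 i j hij)
  have hcoord : ∀ φ : ℕ → ℕ, StrictMono φ → ∀ (F : Finset ℕ) (a : ℕ → ℝ) (n : ℕ), ∀ i ∈ F,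
      e.coord n (x (φ i)) ≠ 0 → e.coord n (∑ i ∈ F, a i • x (φ i)) = a i * e.coord n (x (φ i)) := by
    intro φ hφ F a n i hi hne
    rw [map_sum, Finset.sum_eq_single_of_mem i hi, map_smul, smul_eq_mul]
    intro j _ hji
    rw [map_smul, (hdis (φ j) (φ i) (hφ.injective.ne hji) n).resolve_right hne, smul_zero]
  refine h.exists_equiv_block (s := fun j => |x j|) (fun j => ?_) (fun n => ?_) ?_ ?_
  · have h1 : ‖x j‖ = 1 := by
      have := hx1 j
      simp only at this
      rw [← toReal_enorm, this]; simp
    rw [← h1]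
    apply le_antisymm <;> refine h.norm_le fun n => ?_ <;> rw [h.coord_abs hord, abs_abs]
  · by_cases hz : ∃ j, e.coord n (x j) ≠ 0
    · obtain ⟨j, hj⟩ := hz
      refine tendsto_const_nhds.congr' ?_
      filter_upwards [eventually_gt_atTop j] with i hi
      rw [h.coord_abs hord, (hdis i j (by omega) n).resolve_right hj, abs_zero]
    · push Not at hz
      simp [h.coord_abs hord, hz]
  · intro φ hφ F a
    rw [enorm_le_iff_norm_le]
    refine h.norm_le fun n => ?_
    rw [map_sum, map_sum]
    simp only [map_smul, h.coord_abs hord, smul_eq_mul]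
    refine (Finset.abs_sum_le_sum_abs _ _).trans (le_trans (le_of_eq ?_) (le_abs_self _))
    exact Finset.sum_congr rfl fun i _ => abs_mul _ _
  · intro φ hφ F a g hg
    rw [enorm_le_iff_norm_le]
    refine h.norm_le fun n => ?_
    rcases hg n with h0 | ⟨i, hi, hle⟩
    · simp [h0]
    · rw [h.coord_abs hord, abs_abs] at hle
      by_cases hne : e.coord n (x (φ i)) = 0
      · rw [hne, abs_zero, mul_zero] at hle
        exact hle.trans (abs_nonneg _)
      · rwa [hcoord φ hφ F a n i hi hne, abs_mul]

end Blocks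

/-! ### Functions on `[0, 1]` -/

/-- Lebesgue measure on `[0, 1]`. -/
noncomputable abbrev unitVolume : Measure ℝ := volume.restrict (Set.Icc (0 : ℝ) 1)

instance unitVolume.isProbabilityMeasure : IsProbabilityMeasure unitVolume :=
  ⟨by simp [unitVolume]⟩

theorem unitVolume_Ico {a b : ℝ} (ha : 0 ≤ a) (hb : b ≤ 1) :
    unitVolume (Set.Ico a b) = ENNReal.ofReal (b - a) := by
  rw [unitVolume, Measure.restrict_apply measurableSet_Ico,
    Set.inter_eq_left.2 (show Set.Ico a b ⊆ Set.Icc 0 1 from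
      fun t ht => ⟨ha.trans ht.1, ht.2.le.trans hb⟩), Real.volume_Ico]

theorem ae_mem_Ico_unitVolume : ∀ᵐ t ∂unitVolume, t ∈ Set.Ico (0 : ℝ) 1 := by
  rw [unitVolume, ← restrict_Ico_eq_restrict_Icc]
  exact ae_restrict_mem measurableSet_Ico

namespace L0

/-- The restriction of a function to a measurable set. -/
noncomputable def cut (A : Set ℝ) (hA : MeasurableSet A) (x : L0) : L0 :=
  AEEqFun.mk (A.indicator x) (x.aestronglyMeasurable.indicator hA)

theorem coeFn_cut (A : Set ℝ) (hA : MeasurableSet A) (x : L0) :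
    cut A hA x =ᵐ[unitVolume] A.indicator x := AEEqFun.coeFn_mk _ _

/-- The indicator function of a measurable set. -/
noncomputable def ind (A : Set ℝ) (hA : MeasurableSet A) : L0 :=
  AEEqFun.mk (A.indicator fun _ => (1 : ℝ)) (aestronglyMeasurable_const.indicator hA)

theorem coeFn_ind (A : Set ℝ) (hA : MeasurableSet A) :
    ind A hA =ᵐ[unitVolume] A.indicator fun _ => (1 : ℝ) := AEEqFun.coeFn_mk _ _

theorem abs_le_abs_iff (x y : L0) : |x| ≤ |y| ↔ ∀ᵐ t ∂unitVolume, |x t| ≤ |y t| := by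
  rw [← AEEqFun.coeFn_le]
  constructor
  · intro h
    filter_upwards [h, AEEqFun.coeFn_abs x, AEEqFun.coeFn_abs y] with t h1 h2 h3
    rwa [h2, h3] at h1
  · intro h
    filter_upwards [h, AEEqFun.coeFn_abs x, AEEqFun.coeFn_abs y] with t h1 h2 h3
    rwa [h2, h3]

theorem coeFn_sum (s : Finset ℕ) (x : ℕ → L0) :
    ∀ᵐ t ∂unitVolume, (∑ i ∈ s, x i : L0) t = ∑ i ∈ s, x i t := by
  induction s using Finset.induction_on with
  | empty =>
    filter_upwards [AEEqFun.coeFn_zero (μ := unitVolume) (β := ℝ)] with t ht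
    simp [ht]
  | insert k s hk ih =>
    filter_upwards [ih, AEEqFun.coeFn_add (x k) (∑ i ∈ s, x i)] with t h1 h2
    rw [Finset.sum_insert hk, Finset.sum_insert hk, h2, Pi.add_apply, h1]

theorem abs_inf_abs_eq_zero_iff (x y : L0) :
    |x| ⊓ |y| = 0 ↔ ∀ᵐ t ∂unitVolume, x t = 0 ∨ y t = 0 := by
  have hmin : ∀ a b : ℝ, |a| ⊓ |b| = 0 ↔ a = 0 ∨ b = 0 := by
    intro a b
    constructor
    · intro h
      rcases min_choice |a| |b| with h1 | h1 <;> rw [h1, abs_eq_zero] at h <;> simp [h]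
    · rintro (h | h) <;> simp [h]
  constructor
  · intro h
    have h0 := AEEqFun.coeFn_zero (μ := unitVolume) (β := ℝ)
    rw [← h] at h0
    filter_upwards [h0, AEEqFun.coeFn_abs x, AEEqFun.coeFn_abs y, AEEqFun.coeFn_inf |x| |y|]
      with t h1 h2 h3 h4
    rw [h4, h2, h3] at h1
    exact (hmin _ _).1 h1
  · intro h
    apply AEEqFun.ext
    filter_upwards [h, AEEqFun.coeFn_abs x, AEEqFun.coeFn_abs y, AEEqFun.coeFn_inf |x| |y|,
      AEEqFun.coeFn_zero (μ := unitVolume) (β := ℝ)] with t h1 h2 h3 h4 h5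
    rw [h4, h2, h3, h5]
    exact (hmin _ _).2 h1

/-- Riesz decomposition property. -/
theorem exists_add_eq_of_abs_le {x y z : L0} (h : ∀ᵐ t ∂unitVolume, |x t| ≤ |y t| + |z t|) :
    ∃ y' z' : L0, x = y' + z' ∧ (∀ᵐ t ∂unitVolume, |y' t| ≤ |y t|) ∧
      (∀ᵐ t ∂unitVolume, |z' t| ≤ |z t|) ∧ (∀ᵐ t ∂unitVolume, x t = 0 → y' t = 0) ∧
      (∀ᵐ t ∂unitVolume, x t = 0 → z' t = 0) := by
  -- `y'` is `x` clipped to `[-|y|, |y|]`. The part cut off is at most `|x| - |y| ≤ |z|` in modulus,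
  -- and both parts vanish where `x` does.
  set y' : L0 := (x ⊓ |y|) ⊔ -|y| with hy'
  have hcoe : ∀ᵐ t ∂unitVolume, y' t = max (min (x t) |y t|) (-|y t|) := by
    filter_upwards [AEEqFun.coeFn_sup (x ⊓ |y|) (-|y|), AEEqFun.coeFn_inf x |y|,
      AEEqFun.coeFn_abs y, AEEqFun.coeFn_neg |y|] with t h1 h2 h3 h4
    rw [hy', h1, h2, h4, Pi.neg_apply, h3]
  refine ⟨y', x - y', by abel, ?_, ?_, ?_, ?_⟩
  · filter_upwards [hcoe] with t ht
    rw [ht, abs_le]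
    exact ⟨le_max_right _ _, max_le (min_le_right _ _) (by linarith [abs_nonneg (y t)])⟩
  · filter_upwards [hcoe, h, AEEqFun.coeFn_sub x y'] with t ht h1 h2
    rw [h2, Pi.sub_apply, ht]
    rw [abs_le] at h1
    have hy := abs_nonneg (y t)
    have hz := abs_nonneg (z t)
    rw [abs_le]
    rcases le_total (x t) |y t| with h3 | h3
    · rw [min_eq_left h3]
      rcases le_total (x t) (-|y t|) with h4 | h4
      · rw [max_eq_right h4]; constructor <;> linarith
      · rw [max_eq_left h4]; constructor <;> linarith
    · rw [min_eq_right h3, max_eq_left (by linarith)]; constructor <;> linarith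
  · filter_upwards [hcoe] with t ht h0
    have hy := abs_nonneg (y t)
    rw [ht, h0, min_eq_left hy, max_eq_left (by linarith)]
  · filter_upwards [hcoe, AEEqFun.coeFn_sub x y'] with t ht h2 h0
    have hy := abs_nonneg (y t)
    rw [h2, Pi.sub_apply, ht, h0, min_eq_left hy, max_eq_left (by linarith), sub_zero]

end L0

/-! ### Banach function norms -/

namespace IsBanachFunctionNorm

variable {ρ : L0 → ℝ≥0∞} (h : IsBanachFunctionNorm ρ)
include h

theorem mono {x y : L0} (hxy : ∀ᵐ t ∂unitVolume, |x t| ≤ |y t|) : ρ x ≤ ρ y :=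
  h.ideal x y ((L0.abs_le_abs_iff x y).2 hxy)

theorem zero : ρ 0 = 0 := (h.eq_zero_iff 0).2 rfl

theorem neg (x : L0) : ρ (-x) = ρ x := by
  have := h.smul (-1) x
  simpa using this

theorem sub_comm (x y : L0) : ρ (x - y) = ρ (y - x) := by
  rw [← h.neg, neg_sub]

theorem sum_le (s : Finset ℕ) (x : ℕ → L0) : ρ (∑ i ∈ s, x i) ≤ ∑ i ∈ s, ρ (x i) := by
  induction s using Finset.induction_on with
  | empty => simp [h.zero]
  | insert k s hk ih =>
    rw [Finset.sum_insert hk, Finset.sum_insert hk]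
    exact (h.add_le _ _).trans (add_le_add le_rfl ih)

end IsBanachFunctionNorm

/-! ### Rearrangement invariant spaces -/

theorem L0.equimeasurable_ind {A B : Set ℝ} {hA : MeasurableSet A} {hB : MeasurableSet B}
    (hAB : unitVolume A = unitVolume B) : Equimeasurable (L0.ind A hA) (L0.ind B hB) := by
  have key : ∀ (D : Set ℝ) (hD : MeasurableSet D) (τ : ℝ), 0 < τ →
      unitVolume {t | τ < |L0.ind D hD t|} = if τ < 1 then unitVolume D else 0 := by
    intro D hD τ hτ
    have h1 : unitVolume {t | τ < |L0.ind D hD t|}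
        = unitVolume {t | τ < |D.indicator (fun _ => (1 : ℝ)) t|} := by
      apply measure_congr
      filter_upwards [L0.coeFn_ind D hD] with t ht
      change (τ < |L0.ind D hD t|) = (τ < |D.indicator (fun _ => (1 : ℝ)) t|)
      rw [ht]
    rw [h1]
    split_ifs with h2
    · congr 1
      ext t
      by_cases ht : t ∈ D <;> simp [ht, h2, hτ.le]
    · convert measure_empty (μ := unitVolume)
      ext t
      by_cases ht : t ∈ D <;> simp [ht, hτ.le]
      linarith
  intro τ hτ
  rw [key A hA τ hτ, key B hB τ hτ, hAB]

theorem L0.one_eq_ind : (1 : L0) = L0.ind (Set.Ico 0 1) measurableSet_Ico := by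
  apply AEEqFun.ext
  filter_upwards [L0.coeFn_ind (Set.Ico 0 1) measurableSet_Ico, ae_mem_Ico_unitVolume,
    AEEqFun.coeFn_one (μ := unitVolume) (β := ℝ)] with t h1 h2 h3
  rw [h1, h3, Set.indicator_of_mem h2, Pi.one_apply]

namespace IsRISpace

variable {ρ : L0 → ℝ≥0∞} (h : IsRISpace ρ)
include h

/-- By rearrangement invariance both sets may be replaced by initial intervals of the same measures,
which are nested. -/
theorem ind_le_ind {A B : Set ℝ} {hA : MeasurableSet A} {hB : MeasurableSet B}
    (hAB : unitVolume A ≤ unitVolume B) : ρ (L0.ind A hA) ≤ ρ (L0.ind B hB) := by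
  have key : ∀ (D : Set ℝ) (hD : MeasurableSet D),
      ρ (L0.ind D hD) = ρ (L0.ind (Set.Ico 0 (unitVolume D).toReal) measurableSet_Ico) := by
    intro D hD
    refine h.equimeasurable _ _ (L0.equimeasurable_ind ?_)
    rw [unitVolume_Ico le_rfl (by
      have : unitVolume D ≤ 1 := prob_le_one
      exact ENNReal.toReal_le_of_le_ofReal zero_le_one (by simpa using this)), sub_zero,
      ENNReal.ofReal_toReal (measure_ne_top _ _)]
  rw [key A hA, key B hB]
  apply h.isBanachFunctionNorm.mono
  filter_upwards [L0.coeFn_ind (Set.Ico 0 (unitVolume A).toReal) measurableSet_Ico,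
    L0.coeFn_ind (Set.Ico 0 (unitVolume B).toReal) measurableSet_Ico] with t h1 h2
  rw [h1, h2]
  have hle : (unitVolume A).toReal ≤ (unitVolume B).toReal :=
    ENNReal.toReal_mono (measure_ne_top _ _) hAB
  by_cases ht : t ∈ Set.Ico 0 (unitVolume A).toReal
  · have : t ∈ Set.Ico 0 (unitVolume B).toReal := ⟨ht.1, ht.2.trans_le hle⟩
    rw [Set.indicator_of_mem ht, Set.indicator_of_mem this]
  · rw [Set.indicator_of_notMem ht, abs_zero]
    exact abs_nonneg _

theorem ind_Ico_le_two_mul {t : ℝ} (ht : 0 ≤ t) (ht' : 2 * t ≤ 1) :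
    ρ (L0.ind (Set.Ico 0 (2 * t)) measurableSet_Ico)
      ≤ 2 * ρ (L0.ind (Set.Ico 0 t) measurableSet_Ico) := by
  have h1 : ρ (L0.ind (Set.Ico t (2 * t)) measurableSet_Ico)
      ≤ ρ (L0.ind (Set.Ico 0 t) measurableSet_Ico) := by
    apply h.ind_le_ind
    rw [unitVolume_Ico ht ht', unitVolume_Ico le_rfl (by linarith)]
    apply le_of_eq; congr 1; ring
  calc _ ≤ ρ (L0.ind (Set.Ico 0 t) measurableSet_Ico
        + L0.ind (Set.Ico t (2 * t)) measurableSet_Ico) := by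
        apply h.isBanachFunctionNorm.mono
        filter_upwards [L0.coeFn_ind (Set.Ico 0 t) measurableSet_Ico,
          L0.coeFn_ind (Set.Ico t (2 * t)) measurableSet_Ico,
          L0.coeFn_ind (Set.Ico 0 (2 * t)) measurableSet_Ico,
          AEEqFun.coeFn_add (L0.ind (Set.Ico 0 t) measurableSet_Ico)
            (L0.ind (Set.Ico t (2 * t)) measurableSet_Ico)] with s h1 h2 h3 h4
        rw [h4, Pi.add_apply, h1, h2, h3]
        have hnn : ∀ D : Set ℝ, 0 ≤ D.indicator (fun _ => (1 : ℝ)) s := fun D =>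
          Set.indicator_nonneg (fun _ _ => zero_le_one) _
        rw [abs_of_nonneg (hnn _), abs_of_nonneg (add_nonneg (hnn _) (hnn _))]
        by_cases hs : s ∈ Set.Ico 0 (2 * t)
        · rcases lt_or_ge s t with hst | hst
          · have : s ∈ Set.Ico 0 t := ⟨hs.1, hst⟩
            simp only [hs, this, Set.indicator_of_mem]
            linarith [hnn (Set.Ico t (2 * t))]
          · have : s ∈ Set.Ico t (2 * t) := ⟨hst, hs.2⟩
            simp only [hs, this, Set.indicator_of_mem]
            linarith [hnn (Set.Ico 0 t)]
        · rw [Set.indicator_of_notMem hs]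
          exact add_nonneg (hnn _) (hnn _)
    _ ≤ _ := (h.isBanachFunctionNorm.add_le _ _).trans (by rw [two_mul (ρ _)]; exact add_le_add le_rfl h1)

/-- Repeated halving: this is `φ(1) ≤ φ(t)/t` for the fundamental function at `t = 2^{-k}`. -/
theorem ind_Ico_one_le (k : ℕ) : ρ (L0.ind (Set.Ico 0 1) measurableSet_Ico)
    ≤ 2 ^ k * ρ (L0.ind (Set.Ico 0 ((1 / 2 : ℝ) ^ k)) measurableSet_Ico) := by
  induction k with
  | zero => simp
  | succ k ih =>
    refine ih.trans ?_
    rw [pow_succ, mul_assoc]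
    gcongr
    have h1 : (2 : ℝ) * (1 / 2) ^ (k + 1) = (1 / 2) ^ k := by rw [pow_succ]; ring
    have := h.ind_Ico_le_two_mul (t := (1 / 2 : ℝ) ^ (k + 1)) (by positivity)
      (by rw [h1]; exact pow_le_one₀ (by norm_num) (by norm_num))
    simpa only [h1] using this

/-- A nonzero element exceeds some `1/c` in modulus on a set of positive measure, whose indicator
then has finite norm. That set is at least as large as some dyadic interval `[0, 2^{-n})`, and `2^n`
such intervals make up `[0, 1)`. -/
theorem one_lt_top : ρ 1 < ∞ := by
  obtain ⟨x, hx0, hx⟩ := h.nontrivial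
  have hpos : ∃ k : ℕ, 0 < unitVolume {t | 1 / ((k : ℝ) + 1) < |x t|} := by
    by_contra! hcon
    apply hx0
    apply AEEqFun.ext
    have h1 : ∀ᵐ t ∂unitVolume, ∀ k : ℕ, ¬ (1 / ((k : ℝ) + 1) < |x t|) := by
      rw [ae_all_iff]
      intro k
      rw [ae_iff]
      simpa using hcon k
    filter_upwards [h1, AEEqFun.coeFn_zero (μ := unitVolume) (β := ℝ)] with t h2 h3
    rw [h3, Pi.zero_apply]
    by_contra h4
    obtain ⟨n, hn⟩ := exists_nat_one_div_lt (abs_pos.2 h4)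
    exact h2 n hn
  obtain ⟨k, hk⟩ := hpos
  set c : ℝ := (k : ℝ) + 1 with hc
  have hc0 : 0 < c := by positivity
  have hA : MeasurableSet {t | 1 / c < |x t|} :=
    measurableSet_lt measurable_const x.measurable.abs
  have h1 : ρ (L0.ind _ hA) ≤ ρ (c • x) := by
    apply h.isBanachFunctionNorm.mono
    filter_upwards [L0.coeFn_ind _ hA, AEEqFun.coeFn_smul c x] with t h1 h2
    rw [h1, h2, Pi.smul_apply, smul_eq_mul, abs_mul, abs_of_pos hc0]
    by_cases ht : t ∈ {t | 1 / c < |x t|}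
    · rw [Set.indicator_of_mem ht, abs_one]
      have : 1 / c < |x t| := ht
      rw [div_lt_iff₀ hc0] at this
      linarith
    · rw [Set.indicator_of_notMem ht, abs_zero]; positivity
  have h2 : ρ (L0.ind _ hA) < ∞ := by
    refine h1.trans_lt ?_
    rw [h.isBanachFunctionNorm.smul]
    exact ENNReal.mul_lt_top enorm_lt_top hx
  have h3 : Tendsto (fun n : ℕ => ENNReal.ofReal ((1 / 2 : ℝ) ^ n)) atTop (𝓝 0) := by
    rw [← ENNReal.ofReal_zero]
    exact ENNReal.tendsto_ofReal (tendsto_pow_atTop_nhds_zero_of_lt_one (by norm_num) (by norm_num))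
  obtain ⟨n, hn⟩ := (h3.eventually_le_const hk).exists
  rw [L0.one_eq_ind]
  refine (h.ind_Ico_one_le n).trans_lt (ENNReal.mul_lt_top (by simp) (lt_of_le_of_lt ?_ h2))
  apply h.ind_le_ind
  rwa [unitVolume_Ico le_rfl (pow_le_one₀ (by norm_num) (by norm_num)), sub_zero]

theorem ind_lt_top {A : Set ℝ} (hA : MeasurableSet A) : ρ (L0.ind A hA) < ∞ := by
  refine lt_of_le_of_lt ?_ h.one_lt_top
  rw [L0.one_eq_ind]
  apply h.ind_le_ind
  rw [unitVolume_Ico le_rfl le_rfl]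
  exact prob_le_one.trans (by simp)

theorem ind_pos {A : Set ℝ} (hA : MeasurableSet A) (h0 : unitVolume A ≠ 0) :
    0 < ρ (L0.ind A hA) := by
  rw [pos_iff_ne_zero, Ne, h.isBanachFunctionNorm.eq_zero_iff]
  intro h1
  apply h0
  have h2 := L0.coeFn_ind A hA
  rw [h1] at h2
  rw [← nonpos_iff_eq_zero, ← compl_compl A]
  have : ∀ᵐ t ∂unitVolume, t ∈ Aᶜ := by
    filter_upwards [h2, AEEqFun.coeFn_zero (μ := unitVolume) (β := ℝ)] with t h3 h4
    intro ht
    rw [h4, Set.indicator_of_mem ht] at h3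
    simp at h3
  exact (show unitVolume Aᶜᶜ = 0 from this).le

end IsRISpace

/-! ### Strict embeddings -/

/-- The uniform form of strictness: a counterexample for every `k` would be a bounded sequence with
shrinking supports violating the sequential definition. -/
theorem StrictlyEmbedded.exists_measure_le {ρ₀ ρ₁ : L0 → ℝ≥0∞} (h : StrictlyEmbedded ρ₀ ρ₁)
    (C : ℝ≥0) {ε : ℝ≥0∞} (hε : 0 < ε) :
    ∃ k : ℕ, ∀ x : L0, ρ₀ x ≤ C →
      unitVolume {t | x t ≠ 0} ≤ ENNReal.ofReal ((1 / 2 : ℝ) ^ k) → ρ₁ x ≤ ε := by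
  by_contra! hcon
  choose x hx1 hx2 hx3 using hcon
  have h1 : Tendsto (fun n : ℕ => ENNReal.ofReal ((1 / 2 : ℝ) ^ n)) atTop (𝓝 0) := by
    rw [← ENNReal.ofReal_zero]
    exact ENNReal.tendsto_ofReal (tendsto_pow_atTop_nhds_zero_of_lt_one (by norm_num) (by norm_num))
  have h2 := h.2 x ⟨C, hx1⟩ (tendsto_of_tendsto_of_tendsto_of_le_of_le tendsto_const_nhds h1
    (fun _ => zero_le) hx2)
  obtain ⟨n, hn⟩ := (h2.eventually_lt_const hε).exists
  exact absurd hn (not_lt.2 (hx3 n).le)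

/-- A function of `X₀`-norm at most `1` is cut into `2^k` pieces on dyadic intervals short enough
that strictness bounds each piece by `1` in `X₁`. -/
theorem StrictlyEmbedded.exists_le_mul {ρ₀ ρ₁ : L0 → ℝ≥0∞} (h : StrictlyEmbedded ρ₀ ρ₁)
    (h₀ : IsBanachFunctionNorm ρ₀) (h₁ : IsBanachFunctionNorm ρ₁) :
    ∃ C : ℝ≥0, 1 ≤ C ∧ ∀ x, ρ₁ x ≤ C * ρ₀ x := by
  obtain ⟨k, hk⟩ := h.exists_measure_le 1 (ε := 1) zero_lt_one
  have hunit : ∀ x, ρ₀ x ≤ 1 → ρ₁ x ≤ 2 ^ k := by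
    intro x hx
    let J : ℕ → Set ℝ := fun i => Set.Ico ((i : ℝ) * (1 / 2) ^ k) ((i + 1 : ℕ) * (1 / 2) ^ k)
    have hJ : ∀ i, MeasurableSet (J i) := fun i => measurableSet_Ico
    have hvol : ∀ i, unitVolume (J i) ≤ ENNReal.ofReal ((1 / 2 : ℝ) ^ k) := by
      intro i
      refine (Measure.restrict_apply_le _ _).trans (le_of_eq ?_)
      rw [Real.volume_Ico]
      congr 1
      push_cast; ring
    have hcut : ∀ i, ρ₁ (L0.cut (J i) (hJ i) x) ≤ 1 := by
      intro i
      apply hk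
      · refine (h₀.mono ?_).trans hx
        filter_upwards [L0.coeFn_cut (J i) (hJ i) x] with t ht
        rw [ht]
        by_cases h1 : t ∈ J i <;> simp [h1]
      · refine (measure_mono_ae ?_).trans (hvol i)
        filter_upwards [L0.coeFn_cut (J i) (hJ i) x] with t ht
        intro h1
        by_contra h2
        exact h1 (ht.trans (Set.indicator_of_notMem (show t ∉ J i from h2) _))
    have hle : ρ₁ x ≤ ρ₁ (∑ i ∈ Finset.range (2 ^ k), L0.cut (J i) (hJ i) x) := by
      apply h₁.mono
      have hall : ∀ᵐ t ∂unitVolume, ∀ i, L0.cut (J i) (hJ i) x t = (J i).indicator x t :=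
        ae_all_iff.2 fun i => L0.coeFn_cut (J i) (hJ i) x
      filter_upwards [L0.coeFn_sum (Finset.range (2 ^ k)) fun i => L0.cut (J i) (hJ i) x, hall,
        ae_mem_Ico_unitVolume] with t h1 h2 h3
      rw [h1]
      simp only [h2]
      have hpk : (0 : ℝ) < 2 ^ k := by positivity
      have hcancel : ((1 : ℝ) / 2) ^ k = (2 ^ k)⁻¹ := by simp
      -- The index of the only dyadic interval containing `t`.
      set n := ⌊t * 2 ^ k⌋₊ with hn
      have hn1 : (n : ℝ) ≤ t * 2 ^ k := Nat.floor_le (mul_nonneg h3.1 hpk.le)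
      have hn2 : t * 2 ^ k < n + 1 := Nat.lt_floor_add_one _
      have hmem : ∀ i, t ∈ J i ↔ i = n := by
        intro i
        simp only [J, Set.mem_Ico, hcancel]
        rw [← div_eq_mul_inv, ← div_eq_mul_inv, div_le_iff₀ hpk, lt_div_iff₀ hpk, hn, eq_comm,
          Nat.floor_eq_iff (mul_nonneg h3.1 hpk.le)]
        push_cast
        rfl
      have hnr : n ∈ Finset.range (2 ^ k) := by
        rw [Finset.mem_range, hn, Nat.floor_lt (mul_nonneg h3.1 hpk.le)]
        push_cast
        nlinarith [h3.2]
      rw [Finset.sum_eq_single_of_mem n hnr, Set.indicator_of_mem ((hmem n).2 rfl)]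
      intro i _ hi
      exact Set.indicator_of_notMem (fun h4 => hi ((hmem i).1 h4)) _
    refine hle.trans ((h₁.sum_le _ _).trans ?_)
    calc _ ≤ ∑ i ∈ Finset.range (2 ^ k), (1 : ℝ≥0∞) := Finset.sum_le_sum fun i _ => hcut i
      _ = 2 ^ k := by simp
  refine ⟨2 ^ k, one_le_pow₀ (by norm_num), fun x => ?_⟩
  push_cast
  by_cases hx0 : ρ₀ x = 0
  · rw [(h₀.eq_zero_iff x).1 hx0, h₁.zero]; exact zero_le
  by_cases hxt : ρ₀ x = ∞
  · rw [hxt, ENNReal.mul_top (by simp)]; exact le_top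
  set c := (ρ₀ x).toReal with hc
  have hc0 : 0 < c := ENNReal.toReal_pos hx0 hxt
  have hcx : ρ₀ x = ENNReal.ofReal c := (ENNReal.ofReal_toReal hxt).symm
  have hcinv : ‖c⁻¹‖ₑ = (ENNReal.ofReal c)⁻¹ := by
    rw [← ofReal_norm, Real.norm_of_nonneg (by positivity), ENNReal.ofReal_inv_of_pos hc0]
  have hne : ENNReal.ofReal c ≠ 0 := by simpa using hc0
  have h1 := hunit (c⁻¹ • x) (by
    rw [h₀.smul, hcinv, hcx, ENNReal.inv_mul_cancel hne ENNReal.ofReal_ne_top])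
  rw [h₁.smul, hcinv] at h1
  rw [hcx]
  calc ρ₁ x = ENNReal.ofReal c * ((ENNReal.ofReal c)⁻¹ * ρ₁ x) := by
        rw [← mul_assoc, ENNReal.mul_inv_cancel hne ENNReal.ofReal_ne_top, one_mul]
    _ ≤ ENNReal.ofReal c * 2 ^ k := by gcongr
    _ = _ := mul_comm _ _

/-! ### Measure preserving maps of `[0, 1]` -/

theorem unitVolume_restrict_Iic_sub_le (A : Set ℝ) {s t : ℝ} (hst : s ≤ t) :
    (unitVolume.restrict A).real (Set.Iic t) - (unitVolume.restrict A).real (Set.Iic s)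
      ≤ t - s := by
  have h1 : (unitVolume.restrict A).real (Set.Iic t)
      ≤ (unitVolume.restrict A).real (Set.Iic s) + (unitVolume.restrict A).real (Set.Ioc s t) := by
    rw [← Set.Iic_union_Ioc_eq_Iic hst]
    exact measureReal_union_le _ _
  have h2 : (unitVolume.restrict A).real (Set.Ioc s t) ≤ t - s := by
    refine ENNReal.toReal_le_of_le_ofReal (by linarith) ?_
    rw [← Real.volume_Ioc]
    exact (Measure.restrict_apply_le _ _).trans (Measure.restrict_apply_le _ _)
  linarith

theorem monotone_unitVolume_restrict_Iic (A : Set ℝ) :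
    Monotone fun t => (unitVolume.restrict A).real (Set.Iic t) := fun _ _ hst =>
  measureReal_mono (Set.Iic_subset_Iic.2 hst)

theorem continuous_unitVolume_restrict_Iic (A : Set ℝ) :
    Continuous fun t => (unitVolume.restrict A).real (Set.Iic t) := by
  apply LipschitzWith.continuous (K := 1)
  refine LipschitzWith.of_le_add fun s t => ?_
  rcases le_total s t with h | h
  · exact (monotone_unitVolume_restrict_Iic A h).trans (by simp [dist_nonneg])
  · have := unitVolume_restrict_Iic_sub_le A h
    rw [Real.dist_eq, abs_of_nonneg (by linarith)]
    linarith

theorem ae_mem_Icc_unitVolume_restrict (A : Set ℝ) :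
    ∀ᵐ t ∂(unitVolume.restrict A), t ∈ Set.Icc (0 : ℝ) 1 := by
  refine ae_restrict_of_ae ?_
  exact ae_restrict_mem measurableSet_Icc

theorem unitVolume_restrict_Iic_zero (A : Set ℝ) :
    (unitVolume.restrict A) (Set.Iic 0) = 0 := by
  have h1 : ∀ᵐ t ∂(unitVolume.restrict A), t ∉ Set.Iic (0 : ℝ) := by
    have h2 : ∀ᵐ t ∂(unitVolume.restrict A), t ≠ 0 := by
      have : (unitVolume.restrict A) {0} = 0 := measure_singleton _
      rw [ae_iff]
      simp only [not_not]
      exact this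
    filter_upwards [ae_mem_Icc_unitVolume_restrict A, h2] with t ht h3 h4
    exact h3 (le_antisymm h4 ht.1)
  rw [ae_iff] at h1
  simp only [not_not] at h1
  exact h1

theorem unitVolume_restrict_Iic_of_one_le (A : Set ℝ) {s : ℝ} (hs : 1 ≤ s) :
    (unitVolume.restrict A) (Set.Iic s) = unitVolume A := by
  rw [← Measure.restrict_apply_univ A]
  apply measure_congr
  filter_upwards [ae_mem_Icc_unitVolume_restrict A] with t ht
  exact propext ⟨fun _ => trivial, fun _ => ht.2.trans hs⟩

/-- The distribution function of a measure without atoms transports it to a uniform one. By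
continuity the value `c` is attained, and up to a null set the sublevel set is the half-line ending
at the last point of `[0, 1]` where this happens. -/
theorem unitVolume_restrict_real_Iic_le {B : Set ℝ} {c : ℝ} (hc : 0 ≤ c)
    (hc' : c ≤ unitVolume.real B) :
    (unitVolume.restrict B) {t | (unitVolume.restrict B).real (Set.Iic t) ≤ c}
      = ENNReal.ofReal c := by
  set F : ℝ → ℝ := fun t => (unitVolume.restrict B).real (Set.Iic t) with hF
  have hFc : Continuous F := continuous_unitVolume_restrict_Iic B
  have hFm : Monotone F := monotone_unitVolume_restrict_Iic B
  have hF0 : F 0 = 0 := by simp only [hF, measureReal_def, unitVolume_restrict_Iic_zero]; simp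
  have hF1 : F 1 = unitVolume.real B := by
    simp only [hF, measureReal_def, unitVolume_restrict_Iic_of_one_le B le_rfl]
  set S : Set ℝ := {t | t ∈ Set.Icc (0 : ℝ) 1 ∧ F t = c} with hS
  have hne : S.Nonempty := by
    have := intermediate_value_Icc (zero_le_one' ℝ) hFc.continuousOn
    rw [hF0, hF1] at this
    obtain ⟨t, ht, htc⟩ := this ⟨hc, hc'⟩
    exact ⟨t, ht, htc⟩
  have hclosed : IsClosed S := isClosed_Icc.inter (isClosed_eq hFc continuous_const)
  have hbdd : BddAbove S := ⟨1, fun t ht => ht.1.2⟩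
  have hmem := hclosed.csSup_mem hne hbdd
  set t₀ := sSup S with ht₀
  have hae : ({t | F t ≤ c} : Set ℝ) =ᵐ[unitVolume.restrict B] Set.Iic t₀ := by
    filter_upwards [ae_mem_Icc_unitVolume_restrict B] with t ht
    refine propext ⟨fun h1 => ?_, fun h1 => ?_⟩
    · by_contra h2
      have h3 : t₀ < t := not_le.1 h2
      have h4 : F t = c := le_antisymm h1 (hmem.2 ▸ hFm h3.le)
      exact absurd (le_csSup hbdd (show t ∈ S from ⟨ht, h4⟩)) (not_le.2 h3)
    · exact (hFm h1).trans hmem.2.le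
  rw [measure_congr hae, ← hmem.2, hF]
  exact (ENNReal.ofReal_toReal (measure_ne_top _ _)).symm

/-- The monotone coupling `σ = G⁻¹ ∘ F` of the two distribution functions, with `G⁻¹` the
least-value inverse: `σ t ≤ s` amounts to `F t ≤ G s`, whose measure is known. -/
theorem exists_map_unitVolume_restrict {A B : Set ℝ} (hAB : unitVolume A = unitVolume B) :
    ∃ σ : ℝ → ℝ, Measurable σ ∧ (unitVolume.restrict B).map σ = unitVolume.restrict A := by
  set F : ℝ → ℝ := fun t => (unitVolume.restrict B).real (Set.Iic t) with hF
  set G : ℝ → ℝ := fun t => (unitVolume.restrict A).real (Set.Iic t) with hG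
  have hGc : Continuous G := continuous_unitVolume_restrict_Iic A
  have hGm : Monotone G := monotone_unitVolume_restrict_Iic A
  have hFm : Monotone F := monotone_unitVolume_restrict_Iic B
  have hG1 : G 1 = unitVolume.real B := by
    simp only [hG, measureReal_def, unitVolume_restrict_Iic_of_one_le A le_rfl, hAB]
  have hFle : ∀ t, F t ≤ unitVolume.real B := fun t => by
    have : unitVolume.real B = (unitVolume.restrict B).real Set.univ := by simp [measureReal_def]
    rw [this]
    exact measureReal_mono (Set.subset_univ _)
  set S : ℝ → Set ℝ := fun t => {s | s ∈ Set.Icc (0 : ℝ) 1 ∧ F t ≤ G s} with hS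
  have hne : ∀ t, (S t).Nonempty := fun t => ⟨1, ⟨zero_le_one, le_rfl⟩, by rw [hG1]; exact hFle t⟩
  have hbdd : ∀ t, BddBelow (S t) := fun t => ⟨0, fun s hs => hs.1.1⟩
  have hclosed : ∀ t, IsClosed (S t) := fun t =>
    isClosed_Icc.inter (isClosed_le continuous_const hGc)
  have hmem : ∀ t, sInf (S t) ∈ S t := fun t => (hclosed t).csInf_mem (hne t) (hbdd t)
  have hσ : Measurable fun t => sInf (S t) := by
    apply Monotone.measurable
    intro t t' htt
    exact csInf_le (hbdd t) ⟨(hmem t').1, (hFm htt).trans (hmem t').2⟩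
  refine ⟨fun t => sInf (S t), hσ, ?_⟩
  have : IsFiniteMeasure ((unitVolume.restrict B).map fun t => sInf (S t)) := by infer_instance
  apply Measure.ext_of_Iic
  intro s
  rw [Measure.map_apply hσ measurableSet_Iic]
  -- The infimum is taken inside `[0, 1]`, so the equivalence of `σ t ≤ s` with `F t ≤ G s` is used
  -- for `0 ≤ s < 1` only; for other `s` the preimage is empty or everything.
  rcases lt_or_ge s 0 with hs | hs
  · have h1 : (fun t => sInf (S t)) ⁻¹' Set.Iic s = ∅ := by
      ext t
      simp only [Set.mem_preimage, Set.mem_Iic, Set.mem_empty_iff_false, iff_false, not_le]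
      exact hs.trans_le (hmem t).1.1
    rw [h1, measure_empty]
    refine (measure_mono_null (Set.Iic_subset_Iic.2 hs.le) ?_).symm
    exact unitVolume_restrict_Iic_zero A
  rcases le_or_gt 1 s with hs1 | hs1
  · have h1 : (fun t => sInf (S t)) ⁻¹' Set.Iic s = Set.univ := by
      ext t
      simp only [Set.mem_preimage, Set.mem_Iic, Set.mem_univ, iff_true]
      exact (hmem t).1.2.trans hs1
    rw [h1, unitVolume_restrict_Iic_of_one_le A hs1, Measure.restrict_apply_univ, hAB]
  · have h1 : (fun t => sInf (S t)) ⁻¹' Set.Iic s = {t | F t ≤ G s} := by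
      ext t
      simp only [Set.mem_preimage, Set.mem_Iic, Set.mem_ofPred_eq]
      exact ⟨fun h2 => (hmem t).2.trans (hGm h2), fun h2 => csInf_le (hbdd t) ⟨⟨hs, hs1.le⟩, h2⟩⟩
    rw [h1, hF, unitVolume_restrict_real_Iic_le measureReal_nonneg (hG1 ▸ hGm hs1.le)]
    exact ENNReal.ofReal_toReal (measure_ne_top _ _)

/-- The level sets of `Y` and `X` partition the interval into pieces of matching measures; the maps
between matching pieces are glued along `Y`. -/
theorem exists_measurePreserving_of_countable {X Y : ℝ → ℕ} (hX : Measurable X) (hY : Measurable Y)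
    (hXY : ∀ k, unitVolume (X ⁻¹' {k}) = unitVolume (Y ⁻¹' {k})) :
    ∃ σ : ℝ → ℝ, MeasurePreserving σ unitVolume unitVolume ∧
      ∀ᵐ t ∂unitVolume, X (σ t) = Y t := by
  choose σ hσ hmap using fun k => exists_map_unitVolume_restrict (hXY k)
  have hmeas : Measurable fun t => σ (Y t) t := by
    have : Measurable fun p : ℕ × ℝ => σ p.1 p.2 :=
      measurable_from_prod_countable_right fun k => hσ k
    exact this.comp (hY.prodMk measurable_id)
  have hYk : ∀ k, MeasurableSet (Y ⁻¹' {k}) := fun k => hY (measurableSet_singleton k)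
  have hXk : ∀ k, MeasurableSet (X ⁻¹' {k}) := fun k => hX (measurableSet_singleton k)
  have hsum : ∀ Z : ℝ → ℕ, Measurable Z →
      Measure.sum (fun k => unitVolume.restrict (Z ⁻¹' {k})) = unitVolume := by
    intro Z hZ
    rw [← Measure.restrict_iUnion (fun i j hij => Disjoint.preimage Z (by simpa using hij))
      (fun k => hZ (measurableSet_singleton k)), ← Set.preimage_iUnion,
      Set.iUnion_of_singleton, Set.preimage_univ, Measure.restrict_univ]
  have hcongr : ∀ k, (unitVolume.restrict (Y ⁻¹' {k})).map (fun t => σ (Y t) t)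
      = unitVolume.restrict (X ⁻¹' {k}) := by
    intro k
    rw [← hmap k]
    apply Measure.map_congr
    filter_upwards [ae_restrict_mem (hYk k)] with t ht
    have : Y t = k := ht
    rw [this]
  refine ⟨fun t => σ (Y t) t, ⟨hmeas, ?_⟩, ?_⟩
  · nth_rw 1 [← hsum Y hY]
    rw [Measure.map_sum hmeas.aemeasurable]
    simp only [hcongr]
    exact hsum X hX
  · rw [← hsum Y hY, Measure.ae_sum_iff]
    intro k
    have h1 : ∀ᵐ t ∂(unitVolume.restrict (Y ⁻¹' {k})), (fun t => σ (Y t) t) t ∈ X ⁻¹' {k} := by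
      apply ae_of_ae_map hmeas.aemeasurable
      rw [hcongr]
      exact ae_restrict_mem (hXk k)
    filter_upwards [h1, ae_restrict_mem (hYk k)] with t ht ht'
    exact (show X (σ (Y t) t) = k from ht).trans (show Y t = k from ht').symm

/-- Rounding `|x|` and `|y|` to steps of height `ε` gives countably many level sets with matching
measures. An error `ε` is harmless for the K-functional, so no exact rearrangement is sought. -/
theorem Equimeasurable.exists_measurePreserving {x y : L0} (hxy : Equimeasurable x y) {ε : ℝ}
    (hε : 0 < ε) : ∃ σ : ℝ → ℝ, MeasurePreserving σ unitVolume unitVolume ∧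
      ∀ᵐ t ∂unitVolume, |y t| ≤ |x (σ t)| + ε := by
  -- Ceiling minus one, rather than floor, makes the classes come from strict superlevel sets at
  -- positive heights, as in `Equimeasurable`. Truncated subtraction puts all values in `[0, ε]`
  -- into class `0`.
  set cls : L0 → ℝ → ℕ := fun z t => ⌈|z t| / ε⌉₊ - 1 with hcls
  have hmeas : ∀ z, Measurable (cls z) := fun z =>
    (measurable_of_countable fun n : ℕ => n - 1).comp
      (Nat.measurable_ceil.comp (z.measurable.abs.div_const ε))
  have hge : ∀ (z : L0) (k : ℕ) (t : ℝ), k + 1 ≤ cls z t ↔ ((k + 1 : ℕ) : ℝ) * ε < |z t| := by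
    intro z k t
    rw [← lt_div_iff₀ hε, ← Nat.lt_ceil]
    simp only [hcls]; omega
  have heq : ∀ k, unitVolume {t | k ≤ cls x t} = unitVolume {t | k ≤ cls y t} := by
    intro k
    cases k with
    | zero => simp
    | succ k =>
      simp only [hge]
      exact hxy _ (by positivity)
  have hsing : ∀ (z : L0) (k : ℕ), unitVolume (cls z ⁻¹' {k})
      = unitVolume {t | k ≤ cls z t} - unitVolume {t | k + 1 ≤ cls z t} := by
    intro z k
    rw [← measure_sdiff _ _ (measure_ne_top _ _)]
    · congr 1
      ext t
      simp only [Set.mem_preimage, Set.mem_singleton_iff, Set.mem_sdiff, Set.mem_ofPred_eq]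
      omega
    · intro t ht
      simp only [Set.mem_ofPred_eq] at ht ⊢
      omega
    · exact (measurableSet_le measurable_const (hmeas z)).nullMeasurableSet
  obtain ⟨σ, hσ, hae⟩ := exists_measurePreserving_of_countable (hmeas x) (hmeas y)
    fun k => by rw [hsing, hsing, heq, heq]
  refine ⟨σ, hσ, ?_⟩
  filter_upwards [hae] with t ht
  have h1 : |y t| ≤ (cls y t + 1) * ε := by
    rw [← div_le_iff₀ hε]
    refine (Nat.le_ceil _).trans ?_
    simp only [hcls]
    exact_mod_cast (by omega : ⌈|y t| / ε⌉₊ ≤ ⌈|y t| / ε⌉₊ - 1 + 1)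
  have h2 : (cls x (σ t) : ℝ) * ε ≤ |x (σ t)| := by
    rcases Nat.eq_zero_or_eq_succ_pred (cls x (σ t)) with h0 | h0
    · rw [h0]; simp
    · rw [h0]
      exact ((hge x _ (σ t)).1 h0.symm.le).le
  rw [← ht] at h1
  linarith

namespace L0

/-- Composition with a measure preserving map. -/
noncomputable def compMP (x : L0) (σ : ℝ → ℝ) (hσ : MeasurePreserving σ unitVolume unitVolume) :
    L0 := AEEqFun.compMeasurePreserving x σ hσ

theorem coeFn_compMP (x : L0) (σ : ℝ → ℝ) (hσ : MeasurePreserving σ unitVolume unitVolume) :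
    x.compMP σ hσ =ᵐ[unitVolume] x ∘ σ := AEEqFun.coeFn_compMeasurePreserving _ _

theorem equimeasurable_compMP (x : L0) (σ : ℝ → ℝ)
    (hσ : MeasurePreserving σ unitVolume unitVolume) : Equimeasurable (x.compMP σ hσ) x := by
  intro τ _
  have h1 : unitVolume {t | τ < |x.compMP σ hσ t|} = unitVolume (σ ⁻¹' {t | τ < |x t|}) := by
    apply measure_congr
    filter_upwards [coeFn_compMP x σ hσ] with t ht
    change (τ < |x.compMP σ hσ t|) = (τ < |x (σ t)|)
    rw [ht, Function.comp_apply]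
  rw [h1]
  exact hσ.measure_preimage (measurableSet_lt measurable_const x.measurable.abs).nullMeasurableSet

end L0

/-! ### Peetre's K-functional -/

theorem peetreK_add_le {V : Type*} [Add V] {N₀ N₁ : V → ℝ≥0∞} {α β : ℝ} (y z : V) :
    peetreK N₀ N₁ α β (y + z) ≤ ENNReal.ofReal α * N₀ y + ENNReal.ofReal β * N₁ z :=
  iInf_le_of_le y (iInf_le_of_le z (iInf_le_of_le rfl le_rfl))

theorem exists_of_peetreK_lt {V : Type*} [Add V] {N₀ N₁ : V → ℝ≥0∞} {α β : ℝ} {x : V} {c : ℝ≥0∞}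
    (h : peetreK N₀ N₁ α β x < c) :
    ∃ y z, x = y + z ∧ ENNReal.ofReal α * N₀ y + ENNReal.ofReal β * N₁ z < c := by
  simp only [peetreK, iInf_lt_iff] at h
  obtain ⟨y, z, hx, hlt⟩ := h
  exact ⟨y, z, hx, hlt⟩

theorem le_peetreK {V : Type*} [Add V] {N₀ N₁ : V → ℝ≥0∞} {α β : ℝ} {x : V} {c : ℝ≥0∞}
    (h : ∀ y z, x = y + z → c ≤ ENNReal.ofReal α * N₀ y + ENNReal.ofReal β * N₁ z) :
    c ≤ peetreK N₀ N₁ α β x :=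
  le_iInf fun y => le_iInf fun z => le_iInf fun hx => h y z hx

section PeetreK

variable {ρ₀ ρ₁ : L0 → ℝ≥0∞} (h₀ : IsBanachFunctionNorm ρ₀) (h₁ : IsBanachFunctionNorm ρ₁)
  {α β : ℝ}

include h₁ in
theorem peetreK_le_left (x : L0) : peetreK ρ₀ ρ₁ α β x ≤ ENNReal.ofReal α * ρ₀ x := by
  have := peetreK_add_le (N₀ := ρ₀) (N₁ := ρ₁) (α := α) (β := β) x 0
  simpa [h₁.zero] using this

include h₀ in
theorem peetreK_le_right (x : L0) : peetreK ρ₀ ρ₁ α β x ≤ ENNReal.ofReal β * ρ₁ x := by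
  have := peetreK_add_le (N₀ := ρ₀) (N₁ := ρ₁) (α := α) (β := β) 0 x
  simpa [h₀.zero] using this

include h₁ in
-- In a decomposition `y + z`, the `X₀` part is paid for by `C / α` and the `X₁` part by `1`,
-- because `β ≥ 1`.
theorem le_mul_peetreK (hα : 0 < α) (hβ : 1 ≤ β) {C : ℝ≥0} (hC : ∀ x, ρ₁ x ≤ C * ρ₀ x) (x : L0) :
    ρ₁ x ≤ (C * ENNReal.ofReal α⁻¹ + 1) * peetreK ρ₀ ρ₁ α β x := by
  have hαi : ENNReal.ofReal α⁻¹ * ENNReal.ofReal α = 1 := by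
    rw [← ENNReal.ofReal_mul (by positivity), inv_mul_cancel₀ hα.ne', ENNReal.ofReal_one]
  have hβ' : 1 ≤ ENNReal.ofReal β := ENNReal.one_le_ofReal.2 hβ
  set D : ℝ≥0∞ := C * ENNReal.ofReal α⁻¹ + 1 with hD
  have hD1 : 1 ≤ D := le_add_self
  have hD0 : D ≠ 0 := (zero_lt_one.trans_le hD1).ne'
  have hDt : D ≠ ∞ := by simp [hD, ENNReal.mul_eq_top]
  rw [← ENNReal.div_le_iff' hD0 hDt]
  refine le_peetreK fun y z hx => ?_
  rw [ENNReal.div_le_iff' hD0 hDt, hx]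
  calc ρ₁ (y + z) ≤ C * ρ₀ y + ρ₁ z := (h₁.add_le _ _).trans (add_le_add (hC y) le_rfl)
    _ = C * ENNReal.ofReal α⁻¹ * (ENNReal.ofReal α * ρ₀ y) + 1 * (1 * ρ₁ z) := by
        rw [mul_assoc, ← mul_assoc (ENNReal.ofReal α⁻¹), hαi, one_mul, one_mul, one_mul]
    _ ≤ D * (ENNReal.ofReal α * ρ₀ y) + D * (ENNReal.ofReal β * ρ₁ z) := by
        gcongr
        exact le_self_add
    _ = _ := by ring

include h₀ h₁

theorem peetreK_zero : peetreK ρ₀ ρ₁ α β 0 = 0 := by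
  have := peetreK_le_left h₁ (ρ₀ := ρ₀) (α := α) (β := β) 0
  rw [h₀.zero, mul_zero] at this
  exact nonpos_iff_eq_zero.1 this

theorem peetreK_add (x y : L0) :
    peetreK ρ₀ ρ₁ α β (x + y) ≤ peetreK ρ₀ ρ₁ α β x + peetreK ρ₀ ρ₁ α β y := by
  refine le_of_forall_gt fun c hc => ?_
  obtain ⟨a, ha, b, hb, hab⟩ : ∃ a, peetreK ρ₀ ρ₁ α β x < a ∧ ∃ b, peetreK ρ₀ ρ₁ α β y < b ∧
      a + b < c := by
    obtain ⟨a, ha, b, hb, hab⟩ := ENNReal.exists_add_lt_of_add_lt hc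
    exact ⟨a, ha, b, hb, hab⟩
  obtain ⟨x₀, x₁, rfl, hx⟩ := exists_of_peetreK_lt ha
  obtain ⟨y₀, y₁, rfl, hy⟩ := exists_of_peetreK_lt hb
  rw [add_add_add_comm]
  refine (peetreK_add_le _ _).trans_lt (lt_of_le_of_lt ?_ ((ENNReal.add_lt_add hx hy).trans hab))
  calc _ ≤ ENNReal.ofReal α * (ρ₀ x₀ + ρ₀ y₀) + ENNReal.ofReal β * (ρ₁ x₁ + ρ₁ y₁) := by
        gcongr
        · exact h₀.add_le _ _
        · exact h₁.add_le _ _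
    _ = _ := by ring

theorem peetreK_smul_le (c : ℝ) (x : L0) :
    peetreK ρ₀ ρ₁ α β (c • x) ≤ ‖c‖ₑ * peetreK ρ₀ ρ₁ α β x := by
  rcases eq_or_ne c 0 with rfl | hc
  · simp [peetreK_zero h₀ h₁]
  have hc0 : ‖c‖ₑ ≠ 0 := by simpa using hc
  rw [← ENNReal.div_le_iff' hc0 enorm_ne_top]
  refine le_peetreK fun y z hx => ?_
  rw [ENNReal.div_le_iff' hc0 enorm_ne_top, hx, smul_add]
  refine (peetreK_add_le _ _).trans (le_of_eq ?_)
  rw [h₀.smul, h₁.smul]; ring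

theorem peetreK_mono {x y : L0} (hxy : ∀ᵐ t ∂unitVolume, |x t| ≤ |y t|) :
    peetreK ρ₀ ρ₁ α β x ≤ peetreK ρ₀ ρ₁ α β y := by
  refine le_peetreK fun y₀ y₁ hy => ?_
  obtain ⟨x₀, x₁, hx, hx₀, hx₁, -, -⟩ := L0.exists_add_eq_of_abs_le (x := x) (y := y₀) (z := y₁) (by
    filter_upwards [hxy, AEEqFun.coeFn_add y₀ y₁] with t h1 h2
    rw [hy, h2] at h1
    exact h1.trans (abs_add_le _ _))
  rw [hx]
  refine (peetreK_add_le _ _).trans ?_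
  gcongr
  · exact h₀.mono hx₀
  · exact h₁.mono hx₁

theorem peetreK_sub_comm (x y : L0) :
    peetreK ρ₀ ρ₁ α β (x - y) = peetreK ρ₀ ρ₁ α β (y - x) := by
  have key : ∀ x y : L0, peetreK ρ₀ ρ₁ α β (x - y) ≤ peetreK ρ₀ ρ₁ α β (y - x) := fun x y => by
    have := peetreK_smul_le h₀ h₁ (α := α) (β := β) (-1) (y - x)
    simpa using this
  exact le_antisymm (key _ _) (key _ _)

theorem peetreK_sum_smul_le (F : Finset ℕ) (a : ℕ → ℝ) (x : ℕ → L0) :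
    peetreK ρ₀ ρ₁ α β (∑ i ∈ F, a i • x i) ≤ ∑ i ∈ F, ‖a i‖ₑ * peetreK ρ₀ ρ₁ α β (x i) := by
  induction F using Finset.induction_on with
  | empty => simp [peetreK_zero h₀ h₁]
  | insert k F hk ih =>
    rw [Finset.sum_insert hk, Finset.sum_insert hk]
    exact (peetreK_add h₀ h₁ _ _).trans (add_le_add (peetreK_smul_le h₀ h₁ _ _) ih)

end PeetreK

/-- Composition with a measure preserving `σ` carries decompositions of `x` to decompositions of `x
∘ σ` of equal cost. From `|y| ≤ |x ∘ σ| + ε` the K-functional of `y` exceeds that of `x` by at most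
`ε` times the finite K-functional of `1`; then `ε → 0`. -/
theorem peetreK_eq_of_equimeasurable {ρ₀ ρ₁ : L0 → ℝ≥0∞} (h₀ : IsRISpace ρ₀) (h₁ : IsRISpace ρ₁)
    {α β : ℝ} {x y : L0} (hxy : Equimeasurable x y) :
    peetreK ρ₀ ρ₁ α β x = peetreK ρ₀ ρ₁ α β y := by
  have key : ∀ x y : L0, Equimeasurable x y → peetreK ρ₀ ρ₁ α β y ≤ peetreK ρ₀ ρ₁ α β x := by
    intro x y hxy
    have hle : ∀ ε : ℝ, 0 < ε → peetreK ρ₀ ρ₁ α β y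
        ≤ peetreK ρ₀ ρ₁ α β x + ENNReal.ofReal ε * peetreK ρ₀ ρ₁ α β 1 := by
      intro ε hε
      obtain ⟨σ, hσ, hae⟩ := hxy.exists_measurePreserving hε
      have hcomp : peetreK ρ₀ ρ₁ α β (x.compMP σ hσ) ≤ peetreK ρ₀ ρ₁ α β x := by
        refine le_peetreK fun u v huv => ?_
        have hsum : x.compMP σ hσ = u.compMP σ hσ + v.compMP σ hσ := by
          apply AEEqFun.ext
          filter_upwards [L0.coeFn_compMP x σ hσ, L0.coeFn_compMP u σ hσ, L0.coeFn_compMP v σ hσ,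
            AEEqFun.coeFn_add (u.compMP σ hσ) (v.compMP σ hσ),
            hσ.quasiMeasurePreserving.ae (AEEqFun.coeFn_add u v)] with t h1 h2 h3 h4 h5
          rw [h1, h4, Pi.add_apply, h2, h3, Function.comp_apply, huv, h5]
          rfl
        rw [hsum]
        refine (peetreK_add_le _ _).trans (le_of_eq ?_)
        rw [h₀.equimeasurable _ _ (L0.equimeasurable_compMP u σ hσ),
          h₁.equimeasurable _ _ (L0.equimeasurable_compMP v σ hσ)]
      have hB₀ := h₀.isBanachFunctionNorm
      have hB₁ := h₁.isBanachFunctionNorm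
      calc peetreK ρ₀ ρ₁ α β y ≤ peetreK ρ₀ ρ₁ α β (|x.compMP σ hσ| + ε • 1) := by
            apply peetreK_mono hB₀ hB₁
            filter_upwards [hae, L0.coeFn_compMP x σ hσ, AEEqFun.coeFn_abs (x.compMP σ hσ),
              AEEqFun.coeFn_add |x.compMP σ hσ| (ε • 1), AEEqFun.coeFn_smul ε (1 : L0),
              AEEqFun.coeFn_one (μ := unitVolume) (β := ℝ)] with t h1 h2 h3 h4 h5 h6
            rw [h4, Pi.add_apply, h3, h2, h5, Pi.smul_apply, h6, Pi.one_apply, smul_eq_mul, mul_one,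
              Function.comp_apply]
            exact h1.trans (le_abs_self _)
        _ ≤ peetreK ρ₀ ρ₁ α β |x.compMP σ hσ| + peetreK ρ₀ ρ₁ α β (ε • 1) :=
            peetreK_add hB₀ hB₁ _ _
        _ ≤ _ := by
            refine add_le_add (le_trans ?_ hcomp) ?_
            · apply peetreK_mono hB₀ hB₁
              filter_upwards [AEEqFun.coeFn_abs (x.compMP σ hσ)] with t h1
              rw [h1, abs_abs]
            · refine (peetreK_smul_le hB₀ hB₁ _ _).trans (le_of_eq ?_)
              rw [← ofReal_norm, Real.norm_of_nonneg hε.le]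
    have hfin : peetreK ρ₀ ρ₁ α β 1 ≠ ∞ :=
      ((peetreK_le_left h₁.isBanachFunctionNorm 1).trans_lt
        (ENNReal.mul_lt_top ENNReal.ofReal_lt_top h₀.one_lt_top)).ne
    have hlim : Tendsto (fun ε : ℝ => peetreK ρ₀ ρ₁ α β x
        + ENNReal.ofReal ε * peetreK ρ₀ ρ₁ α β 1) (𝓝[>] 0) (𝓝 (peetreK ρ₀ ρ₁ α β x)) := by
      have h1 : Tendsto (fun ε : ℝ => ENNReal.ofReal ε) (𝓝[>] 0) (𝓝 0) := by
        rw [← ENNReal.ofReal_zero]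
        exact (ENNReal.continuous_ofReal.tendsto 0).mono_left nhdsWithin_le_nhds
      have h2 := ENNReal.Tendsto.mul_const h1 (Or.inr hfin) (b := peetreK ρ₀ ρ₁ α β 1)
      rw [zero_mul] at h2
      simpa using tendsto_const_nhds.add h2
    exact ge_of_tendsto hlim (eventually_nhdsWithin_of_forall fun ε hε => hle ε hε)
  exact le_antisymm (key _ _ fun τ hτ => (hxy τ hτ).symm) (key _ _ hxy)

/-! ### Lions-Peetre spaces -/

section LionsPeetre

variable {V : Type*} [Add V] {N₀ N₁ : V → ℝ≥0∞} {α β : ℕ → ℝ}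
  {E : Type*} [NormedAddCommGroup E] [NormedSpace ℝ E] {e : UnconditionalSchauderBasis ℕ ℝ E}

theorem lionsPeetre_eq_of {x : V} {s : E} (hs0 : ∀ n, 0 ≤ e.coord n s)
    (hs : ∀ n, peetreK N₀ N₁ (α n) (β n) x = ENNReal.ofReal (e.coord n s)) :
    lionsPeetre N₀ N₁ e α β x = ‖s‖ₑ := by
  have hconv : Tendsto (fun M => ∑ n ∈ Finset.range M,
      (peetreK N₀ N₁ (α n) (β n) x).toReal • e n) atTop (𝓝 s) := by
    simp only [hs, ENNReal.toReal_ofReal (hs0 _)]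
    exact (UnconditionalSchauderBasis.hasSum e s).tendsto_sum_nat
  apply le_antisymm
  · exact iInf₂_le s ⟨fun n => by rw [hs]; exact ENNReal.ofReal_lt_top, hconv⟩
  · exact le_iInf₂ fun t ht => by rw [tendsto_nhds_unique hconv ht.2]

/-- The element `s` is the profile of `x`. It replaces the convergence condition in the norm, so
that estimates in `W` become coordinatewise comparisons in `E`. -/
theorem exists_of_lionsPeetre_lt_top {x : V} (hx : lionsPeetre N₀ N₁ e α β x < ∞) :
    ∃ s : E, (∀ n, 0 ≤ e.coord n s) ∧
      (∀ n, peetreK N₀ N₁ (α n) (β n) x = ENNReal.ofReal (e.coord n s)) ∧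
      lionsPeetre N₀ N₁ e α β x = ‖s‖ₑ := by
  simp only [lionsPeetre, iInf_lt_iff] at hx
  obtain ⟨s, ⟨hfin, hconv⟩, -⟩ := hx
  have hc := UnconditionalSchauderBasis.coord_of_tendsto e hconv
  have h0 : ∀ n, 0 ≤ e.coord n s := fun n => by rw [hc]; exact ENNReal.toReal_nonneg
  have hK : ∀ n, peetreK N₀ N₁ (α n) (β n) x = ENNReal.ofReal (e.coord n s) := fun n => by
    rw [hc, ENNReal.ofReal_toReal (hfin n).ne]
  exact ⟨s, h0, hK, lionsPeetre_eq_of h0 hK⟩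

theorem IsOneUnconditional.lionsPeetre_le [CompleteSpace E] (h : IsOneUnconditional e) {x : V}
    {s : E} (hs : ∀ n, peetreK N₀ N₁ (α n) (β n) x ≤ ENNReal.ofReal (e.coord n s)) :
    lionsPeetre N₀ N₁ e α β x ≤ ‖s‖ₑ := by
  have hfin : ∀ n, peetreK N₀ N₁ (α n) (β n) x ≠ ∞ := fun n =>
    ((hs n).trans_lt ENNReal.ofReal_lt_top).ne
  have hle : ∀ n, |(peetreK N₀ N₁ (α n) (β n) x).toReal| ≤ |e.coord n s| := fun n => by
    rw [abs_of_nonneg ENNReal.toReal_nonneg]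
    refine (ENNReal.toReal_mono ENNReal.ofReal_ne_top (hs n)).trans ?_
    rw [ENNReal.toReal_ofReal']
    exact max_le (le_abs_self _) (abs_nonneg _)
  obtain ⟨t, ht⟩ := h.exists_coord_eq hle
  rw [lionsPeetre_eq_of (s := t) (fun n => by rw [ht]; exact ENNReal.toReal_nonneg)
    (fun n => by rw [ht, ENNReal.ofReal_toReal (hfin n)]), enorm_le_iff_norm_le]
  exact h.norm_le fun n => by rw [ht]; exact hle n

theorem IsOneUnconditional.le_lionsPeetre (h : IsOneUnconditional e) {x : V} {g : E}
    (hg : ∀ n, ENNReal.ofReal |e.coord n g| ≤ peetreK N₀ N₁ (α n) (β n) x) :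
    ‖g‖ₑ ≤ lionsPeetre N₀ N₁ e α β x := by
  by_cases hx : lionsPeetre N₀ N₁ e α β x < ∞
  · obtain ⟨s, hs0, hs, heq⟩ := exists_of_lionsPeetre_lt_top hx
    rw [heq, enorm_le_iff_norm_le]
    refine h.norm_le fun n => ?_
    have := hg n
    rw [hs, ENNReal.ofReal_le_ofReal_iff (hs0 n)] at this
    rwa [abs_of_nonneg (hs0 n)]
  · rw [not_lt_top_iff.1 hx]; exact le_top

theorem IsOneUnconditional.peetreK_le_lionsPeetre (h : IsOneUnconditional e)
    (he : ∀ n, ‖e n‖ = 1) (n : ℕ) (x : V) :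
    peetreK N₀ N₁ (α n) (β n) x ≤ lionsPeetre N₀ N₁ e α β x := by
  by_cases hx : lionsPeetre N₀ N₁ e α β x < ∞
  · obtain ⟨s, hs0, hs, heq⟩ := exists_of_lionsPeetre_lt_top hx
    rw [heq, hs, ← ofReal_norm]
    exact ENNReal.ofReal_le_ofReal ((le_abs_self _).trans (h.abs_coord_le he n s))
  · rw [not_lt_top_iff.1 hx]; exact le_top

end LionsPeetre

/-! ### The Lions-Peetre space of a strictly embedded couple is rearrangement invariant -/

namespace IsAdmissibleWeight

variable {m : ℕ → ℝ} (hm : IsAdmissibleWeight m)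
include hm

theorem two_le_apply (n : ℕ) : 2 ≤ m n :=
  hm.two_le.trans (hm.strictMono.monotone (Nat.zero_le n))

theorem pos (n : ℕ) : 0 < m n := by linarith [hm.two_le_apply n]

end IsAdmissibleWeight

section

variable {ρ₀ ρ₁ : L0 → ℝ≥0∞} {E : Type*} [NormedAddCommGroup E] [NormedSpace ℝ E]
  {e : UnconditionalSchauderBasis ℕ ℝ E} {m : ℕ → ℝ}

theorem lionsPeetre_smul_le [CompleteSpace E] (h₀ : IsBanachFunctionNorm ρ₀) (h₁ : IsBanachFunctionNorm ρ₁)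
    (h : IsOneUnconditional e) {α β : ℕ → ℝ} (c : ℝ) (x : L0) :
    lionsPeetre ρ₀ ρ₁ e α β (c • x) ≤ ‖c‖ₑ * lionsPeetre ρ₀ ρ₁ e α β x := by
  by_cases hx : lionsPeetre ρ₀ ρ₁ e α β x < ∞
  · obtain ⟨s, hs0, hs, heq⟩ := exists_of_lionsPeetre_lt_top hx
    rw [heq]
    have : ‖c‖ₑ * ‖s‖ₑ = ‖|c| • s‖ₑ := by rw [enorm_smul, Real.enorm_abs]
    rw [this]
    refine h.lionsPeetre_le fun n => (peetreK_smul_le h₀ h₁ c x).trans (le_of_eq ?_)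
    rw [hs, map_smul, smul_eq_mul, ENNReal.ofReal_mul (abs_nonneg c), ← Real.enorm_eq_ofReal_abs]
  · rw [not_lt_top_iff.1 hx]
    rcases eq_or_ne c 0 with rfl | hc
    · rw [zero_smul]
      refine (h.lionsPeetre_le (s := 0) fun n => ?_).trans (by simp)
      rw [peetreK_zero h₀ h₁]; exact zero_le
    · rw [ENNReal.mul_top (by simpa using hc)]; exact le_top

theorem lionsPeetre_mono [CompleteSpace E] (h₀ : IsBanachFunctionNorm ρ₀) (h₁ : IsBanachFunctionNorm ρ₁)
    (h : IsOneUnconditional e) {α β : ℕ → ℝ} {x y : L0} (hxy : ∀ᵐ t ∂unitVolume, |x t| ≤ |y t|) :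
    lionsPeetre ρ₀ ρ₁ e α β x ≤ lionsPeetre ρ₀ ρ₁ e α β y := by
  by_cases hy : lionsPeetre ρ₀ ρ₁ e α β y < ∞
  · obtain ⟨s, hs0, hs, heq⟩ := exists_of_lionsPeetre_lt_top hy
    rw [heq]
    exact h.lionsPeetre_le fun n => (peetreK_mono h₀ h₁ hxy).trans (hs n).le
  · rw [not_lt_top_iff.1 hy]; exact le_top

theorem lionsPeetre_add_le [CompleteSpace E] (h₀ : IsBanachFunctionNorm ρ₀) (h₁ : IsBanachFunctionNorm ρ₁)
    (h : IsOneUnconditional e) {α β : ℕ → ℝ} (x y : L0) :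
    lionsPeetre ρ₀ ρ₁ e α β (x + y)
      ≤ lionsPeetre ρ₀ ρ₁ e α β x + lionsPeetre ρ₀ ρ₁ e α β y := by
  by_cases hx : lionsPeetre ρ₀ ρ₁ e α β x < ∞
  · by_cases hy : lionsPeetre ρ₀ ρ₁ e α β y < ∞
    · obtain ⟨s, hs0, hs, heq⟩ := exists_of_lionsPeetre_lt_top hx
      obtain ⟨t, ht0, ht, heq'⟩ := exists_of_lionsPeetre_lt_top hy
      rw [heq, heq']
      refine (h.lionsPeetre_le (s := s + t) fun n => ?_).trans (enorm_add_le _ _)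
      rw [map_add, ENNReal.ofReal_add (hs0 n) (ht0 n), ← hs, ← ht]
      exact peetreK_add h₀ h₁ x y
    · rw [not_lt_top_iff.1 hy, add_top]; exact le_top
  · rw [not_lt_top_iff.1 hx, top_add]; exact le_top

theorem exists_le_mul_lionsPeetre (h₀ : IsBanachFunctionNorm ρ₀) (h₁ : IsBanachFunctionNorm ρ₁)
    (h₀₁ : StrictlyEmbedded ρ₀ ρ₁) (h : IsOneUnconditional e) (he : ∀ n, ‖e n‖ = 1)
    (hm : IsAdmissibleWeight m) : ∃ C : ℝ≥0∞, C ≠ ∞ ∧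
      ∀ x, ρ₁ x ≤ C * lionsPeetre ρ₀ ρ₁ e (fun n => (m n)⁻¹) m x := by
  obtain ⟨C, -, hC⟩ := h₀₁.exists_le_mul h₀ h₁
  refine ⟨C * ENNReal.ofReal ((m 0)⁻¹)⁻¹ + 1, by simp [ENNReal.mul_eq_top], fun x => ?_⟩
  refine (le_mul_peetreK h₁ (α := (m 0)⁻¹) (β := m 0) (by have := hm.pos 0; positivity)
    (by linarith [hm.two_le_apply 0]) hC x).trans ?_
  gcongr
  exact h.peetreK_le_lionsPeetre (α := fun n => (m n)⁻¹) he 0 x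

/-- Since `|k_n(v i) - k_n(v j)| ≤ k_n(v i - v j)`, the profiles of `v j` are Cauchy in `E`. Their
limit dominates the profile of `y`, because `k_n(y) ≤ k_n(v j) + β_n ρ₁(v j - y)`. This identifies
limits in `X₁` with limits in `W`. -/
theorem lionsPeetre_le_of_tendsto [CompleteSpace E] (h₀ : IsBanachFunctionNorm ρ₀) (h₁ : IsBanachFunctionNorm ρ₁)
    (h : IsOneUnconditional e) {α β : ℕ → ℝ} {v : ℕ → L0} {y : L0}
    (hfin : ∀ j, lionsPeetre ρ₀ ρ₁ e α β (v j) < ∞)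
    (hcau : ∀ ε : ℝ≥0∞, 0 < ε → ∃ M, ∀ i ≥ M, ∀ j ≥ M, lionsPeetre ρ₀ ρ₁ e α β (v i - v j) < ε)
    (hlim : Tendsto (fun j => ρ₁ (v j - y)) atTop (𝓝 0)) {ε : ℝ≥0∞}
    (hle : ∀ᶠ j in atTop, lionsPeetre ρ₀ ρ₁ e α β (v j) ≤ ε) :
    lionsPeetre ρ₀ ρ₁ e α β y < ∞ ∧ lionsPeetre ρ₀ ρ₁ e α β y ≤ ε := by
  choose σ hσ0 hσ hσn using fun j => exists_of_lionsPeetre_lt_top (hfin j)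
  have hcs : CauchySeq σ := by
    rw [EMetric.cauchySeq_iff]
    intro δ hδ
    obtain ⟨M, hM⟩ := hcau δ hδ
    refine ⟨M, fun i hi j hj => lt_of_le_of_lt ?_ (hM i hi j hj)⟩
    rw [edist_eq_enorm_sub]
    refine h.le_lionsPeetre fun n => ?_
    have key : ∀ i j, ENNReal.ofReal (e.coord n (σ i) - e.coord n (σ j))
        ≤ peetreK ρ₀ ρ₁ (α n) (β n) (v i - v j) := by
      intro i j
      rw [ENNReal.ofReal_sub _ (hσ0 j n), tsub_le_iff_right, ← hσ, ← hσ]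
      have := peetreK_add h₀ h₁ (α := α n) (β := β n) (v i - v j) (v j)
      rwa [sub_add_cancel] at this
    rw [map_sub]
    rcases abs_choice (e.coord n (σ i) - e.coord n (σ j)) with habs | habs <;> rw [habs]
    · exact key i j
    · rw [neg_sub, peetreK_sub_comm h₀ h₁]; exact key j i
  obtain ⟨s, hs⟩ := cauchySeq_tendsto_of_complete hcs
  have hys : lionsPeetre ρ₀ ρ₁ e α β y ≤ ‖s‖ₑ := by
    refine h.lionsPeetre_le fun n => ?_
    have h1 : Tendsto (fun j => ENNReal.ofReal (e.coord n (σ j))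
        + ENNReal.ofReal (β n) * ρ₁ (v j - y)) atTop (𝓝 (ENNReal.ofReal (e.coord n s))) := by
      have h2 : Tendsto (fun j => ENNReal.ofReal (e.coord n (σ j))) atTop
          (𝓝 (ENNReal.ofReal (e.coord n s))) :=
        ENNReal.tendsto_ofReal (((e.coord n).continuous.tendsto s).comp hs)
      have h3 := ENNReal.Tendsto.const_mul hlim (Or.inr ENNReal.ofReal_ne_top)
        (a := ENNReal.ofReal (β n))
      rw [mul_zero] at h3
      simpa using h2.add h3
    refine ge_of_tendsto' h1 fun j => ?_
    have h4 := peetreK_add h₀ h₁ (α := α n) (β := β n) (v j) (y - v j)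
    rw [add_sub_cancel] at h4
    refine h4.trans (add_le_add (hσ j n).le ?_)
    rw [peetreK_sub_comm h₀ h₁]
    exact peetreK_le_right h₀ _
  refine ⟨hys.trans_lt enorm_lt_top, hys.trans ?_⟩
  refine le_of_tendsto hs.enorm ?_
  filter_upwards [hle] with j hj
  rwa [← hσn]

theorem isBanachFunctionNorm_lionsPeetre [CompleteSpace E] (h₀ : IsBanachFunctionNorm ρ₀)
    (h₁ : IsBanachFunctionNorm ρ₁) (h₀₁ : StrictlyEmbedded ρ₀ ρ₁) (h : IsOneUnconditional e)
    (he : ∀ n, ‖e n‖ = 1) (hm : IsAdmissibleWeight m) :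
    IsBanachFunctionNorm (lionsPeetre ρ₀ ρ₁ e (fun n => (m n)⁻¹) m) where
  eq_zero_iff x := by
    obtain ⟨C, -, hC⟩ := exists_le_mul_lionsPeetre h₀ h₁ h₀₁ h he hm
    constructor
    · intro hx
      have := hC x
      rw [hx, mul_zero, nonpos_iff_eq_zero] at this
      exact (h₁.eq_zero_iff x).1 this
    · rintro rfl
      have := lionsPeetre_smul_le h₀ h₁ h (α := fun n => (m n)⁻¹) (β := m) 0 0
      simpa using this
  smul c x := by
    apply le_antisymm (lionsPeetre_smul_le h₀ h₁ h c x)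
    rcases eq_or_ne c 0 with rfl | hc
    · simp
    · have h1 := lionsPeetre_smul_le h₀ h₁ h (α := fun n => (m n)⁻¹) (β := m) c⁻¹ (c • x)
      rw [smul_smul, inv_mul_cancel₀ hc, one_smul] at h1
      calc _ ≤ ‖c‖ₑ * (‖c⁻¹‖ₑ * lionsPeetre ρ₀ ρ₁ e (fun n => (m n)⁻¹) m (c • x)) := by gcongr
        _ = _ := by rw [← mul_assoc, ← enorm_mul, mul_inv_cancel₀ hc]; simp
  add_le := lionsPeetre_add_le h₀ h₁ h
  ideal x y hxy := lionsPeetre_mono h₀ h₁ h ((L0.abs_le_abs_iff x y).1 hxy)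
  complete u hu hcau := by
    obtain ⟨C, hCt, hC⟩ := exists_le_mul_lionsPeetre h₀ h₁ h₀₁ h he hm
    have hfin1 : ∀ n, ρ₁ (u n) < ∞ := fun n =>
      (hC _).trans_lt (ENNReal.mul_lt_top (lt_top_iff_ne_top.2 hCt) (hu n))
    -- The candidate limit is the one in `X₁`, where the sequence is Cauchy because `W` embeds
    -- continuously.
    obtain ⟨x, hx, hlim⟩ := h₁.complete u hfin1 (by
      intro ε hε
      obtain ⟨δ, hδ, hδε⟩ : ∃ δ : ℝ≥0∞, 0 < δ ∧ C * δ < ε := by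
        have h1 : Tendsto (fun δ : ℝ≥0∞ => C * δ) (𝓝 0) (𝓝 0) := by
          have := ENNReal.Tendsto.const_mul (a := C) (tendsto_id (x := 𝓝 (0 : ℝ≥0∞))) (Or.inr hCt)
          simpa using this
        have h2 : ∀ᶠ δ in 𝓝[>] (0 : ℝ≥0∞), C * δ < ε :=
          (h1.eventually_lt_const hε).filter_mono nhdsWithin_le_nhds
        obtain ⟨δ, h3, h4⟩ := (h2.and self_mem_nhdsWithin).exists
        exact ⟨δ, h4, h3⟩
      obtain ⟨M, hM⟩ := hcau δ hδ
      refine ⟨M, fun i hi j hj => (hC _).trans_lt (lt_of_le_of_lt ?_ hδε)⟩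
      gcongr
      exact (hM i hi j hj).le)
    have hsubfin : ∀ i j, lionsPeetre ρ₀ ρ₁ e (fun n => (m n)⁻¹) m (u i - u j) < ∞ := by
      intro i j
      rw [sub_eq_add_neg]
      refine (lionsPeetre_add_le h₀ h₁ h _ _).trans_lt (ENNReal.add_lt_top.2 ⟨hu i, ?_⟩)
      have := lionsPeetre_smul_le h₀ h₁ h (α := fun n => (m n)⁻¹) (β := m) (-1) (u j)
      rw [neg_one_smul] at this
      refine this.trans_lt ?_
      simpa using hu j
    have hdiff : ∀ i (ε : ℝ≥0∞),
        (∀ᶠ j in atTop, lionsPeetre ρ₀ ρ₁ e (fun n => (m n)⁻¹) m (u i - u j) ≤ ε) →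
        lionsPeetre ρ₀ ρ₁ e (fun n => (m n)⁻¹) m (u i - x) < ∞ ∧
          lionsPeetre ρ₀ ρ₁ e (fun n => (m n)⁻¹) m (u i - x) ≤ ε := by
      intro i ε hle
      refine lionsPeetre_le_of_tendsto h₀ h₁ h (v := fun j => u i - u j) (hsubfin i) ?_ ?_ hle
      · intro ε hε
        obtain ⟨M, hM⟩ := hcau ε hε
        refine ⟨M, fun j hj k hk => ?_⟩
        rw [sub_sub_sub_cancel_left]
        exact hM k hk j hj
      · refine hlim.congr fun j => ?_
        rw [sub_sub_sub_cancel_left, h₁.sub_comm]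
    refine ⟨x, ?_, ?_⟩
    · have h1 := (hdiff 0 ∞ (Eventually.of_forall fun _ => le_top)).1
      have h2 : x = u 0 + (-1 : ℝ) • (u 0 - x) := by simp
      rw [h2]
      refine (lionsPeetre_add_le h₀ h₁ h _ _).trans_lt (ENNReal.add_lt_top.2 ⟨hu 0, ?_⟩)
      refine (lionsPeetre_smul_le h₀ h₁ h _ _).trans_lt ?_
      simpa using h1
    · rw [ENNReal.tendsto_atTop_zero]
      intro ε hε
      obtain ⟨M, hM⟩ := hcau ε hε
      refine ⟨M, fun i hi => (hdiff i ε ?_).2⟩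
      filter_upwards [eventually_ge_atTop M] with j hj
      exact (hM i hi j hj).le

/-- The bounds `k_n(x) ≤ m_n⁻¹ ‖x‖_{X₀}` are summable, so `X₀ ⊂ W`; in particular bounded functions
lie in `W`. -/
theorem lionsPeetre_lt_top_of_lt_top [CompleteSpace E] (h₁ : IsBanachFunctionNorm ρ₁)
    (h : IsOneUnconditional e) (he : ∀ n, ‖e n‖ = 1) (hm : IsAdmissibleWeight m) {x : L0}
    (hx : ρ₀ x < ∞) : lionsPeetre ρ₀ ρ₁ e (fun n => (m n)⁻¹) m x < ∞ := by
  have hsum : Summable fun n => ((m n)⁻¹ * (ρ₀ x).toReal) • e n := by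
    refine Summable.of_norm ?_
    simp only [norm_smul, he, mul_one]
    exact (hm.summable.mul_right _).norm
  refine (h.lionsPeetre_le (s := ∑' n, ((m n)⁻¹ * (ρ₀ x).toReal) • e n)
    fun n => ?_).trans_lt enorm_lt_top
  rw [UnconditionalSchauderBasis.coord_of_hasSum e hsum.hasSum,
    ENNReal.ofReal_mul (inv_nonneg.2 (hm.pos n).le), ENNReal.ofReal_toReal hx.ne]
  exact peetreK_le_left h₁ x

/-- Dominated convergence in measure, in the norm of `X₁`, for dominating functions in the
Lions-Peetre space. -/
theorem tendsto_of_dominated_lionsPeetre (h₁ : IsRISpace ρ₁)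
    (h₀ : IsBanachFunctionNorm ρ₀) (h₀₁ : StrictlyEmbedded ρ₀ ρ₁) (he : ∀ n, ‖e n‖ = 1)
    (hm : IsAdmissibleWeight m) {y : L0}
    (hy : lionsPeetre ρ₀ ρ₁ e (fun n => (m n)⁻¹) m y < ∞) {x : ℕ → L0}
    (hxy : ∀ k, ∀ᵐ t ∂unitVolume, |x k t| ≤ |y t|)
    (hmeas : ∀ δ : ℝ, 0 < δ → Tendsto (fun k => unitVolume {t | δ < |x k t|}) atTop (𝓝 0)) :
    Tendsto (fun k => ρ₁ (x k)) atTop (𝓝 0) := by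
  have hB₁ := h₁.isBanachFunctionNorm
  obtain ⟨s, hs0, hs, -⟩ := exists_of_lionsPeetre_lt_top hy
  have hcoord : Tendsto (fun n => ENNReal.ofReal (e.coord n s)) atTop (𝓝 0) := by
    have h1 := (UnconditionalSchauderBasis.hasSum e s).summable.tendsto_atTop_zero.norm
    simp only [norm_smul, he, mul_one, norm_zero, Real.norm_of_nonneg (hs0 _)] at h1
    simpa using ENNReal.tendsto_ofReal h1
  rw [ENNReal.tendsto_atTop_zero]
  intro ε hε
  have hε3 : 0 < ε / 3 := ENNReal.div_pos hε.ne' (by norm_num)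
  -- The terms `k_n(y)` tend to `0` since the profile converges. One small term splits `y = u + v`
  -- with `v` small in `X₁`, as `m n ≥ 1`, and `u` in `X₀`, where strictness is available.
  obtain ⟨n, hn⟩ := (hcoord.eventually_lt_const hε3).exists
  rw [← hs] at hn
  obtain ⟨u, v, hyuv, huv⟩ := exists_of_peetreK_lt hn
  have hv : ρ₁ v ≤ ε / 3 := by
    have h1 : 1 ≤ ENNReal.ofReal (m n) := ENNReal.one_le_ofReal.2 (by linarith [hm.two_le_apply n])
    calc ρ₁ v ≤ ENNReal.ofReal (m n) * ρ₁ v := by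
          simpa using mul_le_mul_left h1 (ρ₁ v)
      _ ≤ _ := le_add_self.trans huv.le
  have hmn : ENNReal.ofReal (m n)⁻¹ ≠ 0 := by simpa using hm.pos n
  have hu : ρ₀ u ≠ ∞ := by
    intro hcon
    rw [hcon, ENNReal.mul_top hmn, top_add] at huv
    exact not_top_lt huv
  have hε3' : ε / 3 ≠ 0 := hε3.ne'
  obtain ⟨K, hK⟩ := h₀₁.exists_measure_le (ρ₀ u).toNNReal hε3
  obtain ⟨δ, hδ, hδle⟩ : ∃ δ : ℝ, 0 < δ ∧ ENNReal.ofReal δ * ρ₁ 1 ≤ ε / 3 := by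
    have h1 : Tendsto (fun δ : ℝ => ENNReal.ofReal δ * ρ₁ 1) (𝓝[>] 0) (𝓝 0) := by
      have h2 : Tendsto (fun δ : ℝ => ENNReal.ofReal δ) (𝓝[>] 0) (𝓝 0) := by
        rw [← ENNReal.ofReal_zero]
        exact (ENNReal.continuous_ofReal.tendsto 0).mono_left nhdsWithin_le_nhds
      have h3 := ENNReal.Tendsto.mul_const h2 (Or.inr h₁.one_lt_top.ne) (b := ρ₁ 1)
      rwa [zero_mul] at h3
    obtain ⟨δ, h3, h4⟩ := ((h1.eventually_le_const hε3).and self_mem_nhdsWithin).exists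
    exact ⟨δ, h4, h3⟩
  have hpow : (0 : ℝ≥0∞) < ENNReal.ofReal ((1 / 2 : ℝ) ^ K) := by
    rw [ENNReal.ofReal_pos]; positivity
  obtain ⟨M, hM⟩ := eventually_atTop.1 ((hmeas δ hδ).eventually_le_const hpow)
  refine ⟨M, fun k hk => ?_⟩
  have hA : MeasurableSet {t | δ < |x k t|} := measurableSet_lt measurable_const (x k).measurable.abs
  set w := L0.cut _ hA u with hw
  have hwle : ρ₁ w ≤ ε / 3 := by
    apply hK
    · rw [ENNReal.coe_toNNReal hu]
      apply h₀.mono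
      filter_upwards [L0.coeFn_cut _ hA u] with t ht
      rw [hw, ht]
      by_cases h1 : t ∈ {t | δ < |x k t|}
      · rw [Set.indicator_of_mem h1]
      · rw [Set.indicator_of_notMem h1, abs_zero]; exact abs_nonneg _
    · refine (measure_mono_ae ?_).trans (hM k hk)
      filter_upwards [L0.coeFn_cut _ hA u] with t ht
      intro h1
      by_contra h2
      exact h1 (ht.trans (Set.indicator_of_notMem (show t ∉ {t | δ < |x k t|} from h2) _))
  -- Where `|x k| ≤ δ` the constant dominates; elsewhere `|y| ≤ |u| + |v|` does, and there `u`
  -- coincides with `w`, whose support is small.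
  have hle : ρ₁ (x k) ≤ ρ₁ (δ • 1 + (|w| + |v|)) := by
    apply hB₁.mono
    filter_upwards [hxy k, L0.coeFn_cut _ hA u, AEEqFun.coeFn_add (δ • 1) (|w| + |v|),
      AEEqFun.coeFn_add |w| |v|, AEEqFun.coeFn_abs w, AEEqFun.coeFn_abs v,
      AEEqFun.coeFn_smul δ (1 : L0), AEEqFun.coeFn_one (μ := unitVolume) (β := ℝ),
      AEEqFun.coeFn_add u v] with t h1 h2 h3 h4 h5 h6 h7 h8 h9
    rw [h3, Pi.add_apply, h4, Pi.add_apply, h5, h6, h7, Pi.smul_apply, h8, Pi.one_apply,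
      smul_eq_mul, mul_one]
    refine le_trans ?_ (le_abs_self _)
    by_cases ht : t ∈ {t | δ < |x k t|}
    · rw [hw, h2, Set.indicator_of_mem ht]
      rw [hyuv, h9, Pi.add_apply] at h1
      linarith [abs_add_le (u t) (v t)]
    · have : |x k t| ≤ δ := not_lt.1 ht
      linarith [abs_nonneg (w t), abs_nonneg (v t)]
  have habs : ∀ z : L0, ρ₁ |z| ≤ ρ₁ z := fun z => by
    apply hB₁.mono
    filter_upwards [AEEqFun.coeFn_abs z] with t ht
    rw [ht, abs_abs]
  calc ρ₁ (x k) ≤ ρ₁ (δ • 1) + (ρ₁ |w| + ρ₁ |v|) :=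
        hle.trans ((hB₁.add_le _ _).trans (add_le_add le_rfl (hB₁.add_le _ _)))
    _ ≤ ε / 3 + (ε / 3 + ε / 3) := by
        refine add_le_add ?_ (add_le_add ((habs w).trans hwle) ((habs v).trans hv))
        rw [hB₁.smul, ← ofReal_norm, Real.norm_of_nonneg hδ.le]
        exact hδle
    _ = ε := by rw [← add_assoc, ENNReal.add_thirds]

/-- The first `N` coordinates of the profile of `x k` are at most `m_n ρ₁(x k)`, which tends to `0`
by the result in `X₁`; the others are dominated by the tail of the profile of `y`. -/
theorem tendsto_lionsPeetre_of_dominated [CompleteSpace E] (h₁ : IsRISpace ρ₁)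
    (h₀ : IsBanachFunctionNorm ρ₀) (h₀₁ : StrictlyEmbedded ρ₀ ρ₁) (h : IsOneUnconditional e)
    (he : ∀ n, ‖e n‖ = 1) (hm : IsAdmissibleWeight m) {y : L0}
    (hy : lionsPeetre ρ₀ ρ₁ e (fun n => (m n)⁻¹) m y < ∞) {x : ℕ → L0}
    (hxy : ∀ k, ∀ᵐ t ∂unitVolume, |x k t| ≤ |y t|)
    (hmeas : ∀ δ : ℝ, 0 < δ → Tendsto (fun k => unitVolume {t | δ < |x k t|}) atTop (𝓝 0)) :
    Tendsto (fun k => lionsPeetre ρ₀ ρ₁ e (fun n => (m n)⁻¹) m (x k)) atTop (𝓝 0) := by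
  have hB₁ := h₁.isBanachFunctionNorm
  have hlim := tendsto_of_dominated_lionsPeetre h₁ h₀ h₀₁ he hm hy hxy hmeas
  obtain ⟨s, hs0, hs, -⟩ := exists_of_lionsPeetre_lt_top hy
  obtain ⟨C, hCt, hC⟩ := exists_le_mul_lionsPeetre h₀ hB₁ h₀₁ h he hm
  have hfin : ∀ k, ρ₁ (x k) ≠ ∞ := fun k => (((hB₁.mono (hxy k)).trans (hC y)).trans_lt
    (ENNReal.mul_lt_top (lt_top_iff_ne_top.2 hCt) hy)).ne
  have hbound : ∀ N k, lionsPeetre ρ₀ ρ₁ e (fun n => (m n)⁻¹) m (x k)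
      ≤ ‖(∑ n ∈ Finset.range N, (m n * (ρ₁ (x k)).toReal) • e n)
        + (s - ∑ n ∈ Finset.range N, e.coord n s • e n)‖ₑ := by
    intro N k
    refine h.lionsPeetre_le fun n => ?_
    rw [map_add, map_sub, UnconditionalSchauderBasis.coord_sum,
      UnconditionalSchauderBasis.coord_sum]
    split_ifs with hn
    · rw [sub_self, add_zero, ENNReal.ofReal_mul (hm.pos n).le, ENNReal.ofReal_toReal (hfin k)]
      exact peetreK_le_right h₀ _
    · rw [zero_add, sub_zero, ← hs]
      exact peetreK_mono h₀ hB₁ (hxy k)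
  rw [ENNReal.tendsto_atTop_zero]
  intro ε hε
  have htail : Tendsto (fun N => ‖s - ∑ n ∈ Finset.range N, e.coord n s • e n‖ₑ) atTop (𝓝 0) := by
    have h1 := (tendsto_const_nhds (x := s)).sub
      (UnconditionalSchauderBasis.hasSum e s).tendsto_sum_nat |>.enorm
    simpa using h1
  obtain ⟨N, hN⟩ := (htail.eventually_lt_const hε).exists
  have hlim2 : Tendsto (fun k => ‖(∑ n ∈ Finset.range N, (m n * (ρ₁ (x k)).toReal) • e n)
        + (s - ∑ n ∈ Finset.range N, e.coord n s • e n)‖ₑ) atTop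
      (𝓝 ‖s - ∑ n ∈ Finset.range N, e.coord n s • e n‖ₑ) := by
    have h1 : Tendsto (fun k => (ρ₁ (x k)).toReal) atTop (𝓝 0) := by
      have := (ENNReal.tendsto_toReal ENNReal.zero_ne_top).comp hlim
      rwa [ENNReal.toReal_zero] at this
    have h2 : Tendsto (fun k => ∑ n ∈ Finset.range N, (m n * (ρ₁ (x k)).toReal) • e n) atTop
        (𝓝 (∑ n ∈ Finset.range N, (m n * 0) • e n)) :=
      tendsto_finsetSum _ fun n _ => (h1.const_mul (m n)).smul_const (e n)
    have h3 := (h2.add_const (s - ∑ n ∈ Finset.range N, e.coord n s • e n)).enorm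
    simpa using h3
  obtain ⟨M, hM⟩ := eventually_atTop.1 (hlim2.eventually_le_const hN)
  exact ⟨M, fun k hk => (hbound N k).trans (hM k hk)⟩

end

/-- Truncation of a function at the levels `±c`. -/
noncomputable def L0.clamp (c : ℝ) (x : L0) : L0 :=
  AEEqFun.comp (fun r : ℝ => max (-c) (min r c)) (by fun_prop) x

theorem L0.coeFn_clamp (c : ℝ) (x : L0) :
    ∀ᵐ t ∂unitVolume, L0.clamp c x t = max (-c) (min (x t) c) :=
  AEEqFun.coeFn_comp _ _ _

theorem abs_max_neg_min_le {c : ℝ} (hc : 0 ≤ c) (r : ℝ) : |max (-c) (min r c)| ≤ c := by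
  rw [abs_le]
  exact ⟨le_max_left _ _, max_le (by linarith) (min_le_right _ _)⟩

theorem abs_sub_max_neg_min_le {c : ℝ} (hc : 0 ≤ c) (r : ℝ) :
    |r - max (-c) (min r c)| ≤ |r| ∧ (|r| ≤ c → r - max (-c) (min r c) = 0) := by
  constructor
  · rcases le_total r c with h1 | h1
    · rw [min_eq_left h1]
      rcases le_total (-c) r with h2 | h2
      · rw [max_eq_right h2]; simp
      · rw [max_eq_left h2, abs_of_nonpos (by linarith), abs_of_nonpos (by linarith)]; linarith
    · rw [min_eq_right h1, max_eq_right (by linarith), abs_of_nonneg (by linarith),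
        abs_of_nonneg (by linarith)]
      linarith
  · intro h1
    rw [abs_le] at h1
    rw [min_eq_left h1.2, max_eq_right h1.1, sub_self]

theorem L0.tendsto_measure_lt_abs (x : L0) :
    Tendsto (fun k : ℕ => unitVolume {t | (k : ℝ) < |x t|}) atTop (𝓝 0) := by
  have h1 := tendsto_measure_iInter_atTop (μ := unitVolume) (s := fun k : ℕ => {t | (k : ℝ) < |x t|})
    (fun k => (measurableSet_lt measurable_const x.measurable.abs).nullMeasurableSet)
    (fun i j hij t ht => show (i : ℝ) < |x t| from (Nat.cast_le.2 hij).trans_lt ht) ⟨0, measure_ne_top _ _⟩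
  have h2 : ⋂ k : ℕ, {t | (k : ℝ) < |x t|} = ∅ := by
    ext t
    simp only [Set.mem_iInter, Set.mem_ofPred_eq, Set.mem_empty_iff_false, iff_false, not_forall,
      not_lt]
    exact exists_nat_ge _
  rwa [h2, measure_empty] at h1

/-- A countable set of functions on `[0, 1]` which is dense in measure among bounded functions. -/
theorem L0.exists_countable_dense : ∃ D : ℕ → L0, ∀ (c : ℝ) (g : L0),
    (∀ᵐ t ∂unitVolume, |g t| ≤ c) → ∃ φ : ℕ → ℕ, ∀ δ : ℝ, 0 < δ →
      Tendsto (fun k => unitVolume {t | δ < |(g - D (φ k)) t|}) atTop (𝓝 0) := by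
  have : Fact ((1 : ℝ≥0∞) ≤ 1) := ⟨le_rfl⟩
  have : Fact ((1 : ℝ≥0∞) ≠ ∞) := ⟨ENNReal.one_ne_top⟩
  -- Bounded functions lie in the separable space `L¹`, and convergence in `L¹` implies convergence
  -- in measure.
  let d : ℕ → Lp ℝ 1 unitVolume := TopologicalSpace.denseSeq (Lp ℝ 1 unitVolume)
  refine ⟨fun n => (d n : L0), fun c g hg => ?_⟩
  have hmem : MemLp g 1 unitVolume := MemLp.of_bound g.aestronglyMeasurable c (by simpa using hg)
  have hex : ∀ k : ℕ, ∃ n, ‖hmem.toLp g - d n‖ < 1 / ((k : ℝ) + 1) := fun k => by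
    obtain ⟨n, hn⟩ := (TopologicalSpace.denseRange_denseSeq (Lp ℝ 1 unitVolume)).exists_dist_lt
      (hmem.toLp g) (show (0 : ℝ) < 1 / ((k : ℝ) + 1) by positivity)
    exact ⟨n, by rwa [← dist_eq_norm]⟩
  choose φ hφ using hex
  refine ⟨φ, fun δ hδ => ?_⟩
  have hlim : Tendsto (fun k => d (φ k)) atTop (𝓝 (hmem.toLp g)) := by
    rw [tendsto_iff_dist_tendsto_zero]
    refine squeeze_zero (fun _ => dist_nonneg) (fun k => ?_) tendsto_one_div_add_atTop_nhds_zero_nat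
    rw [dist_comm, dist_eq_norm]; exact (hφ k).le
  have hmeas := tendstoInMeasure_of_tendsto_Lp hlim
  rw [tendstoInMeasure_iff_norm] at hmeas
  refine tendsto_of_tendsto_of_tendsto_of_le_of_le tendsto_const_nhds (hmeas δ hδ)
    (fun _ => zero_le) fun k => measure_mono_ae ?_
  filter_upwards [AEEqFun.coeFn_sub g (d (φ k) : L0), hmem.coeFn_toLp] with t h1 h2 h3
  change δ ≤ ‖(d (φ k) : L0) t - (hmem.toLp g : L0) t‖
  rw [h2, Real.norm_eq_abs, abs_sub_comm]
  have h4 : δ < |(g - (d (φ k) : L0)) t| := h3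
  rw [h1, Pi.sub_apply] at h4
  exact h4.le

/-! ### Separability and rearrangement invariance of the Lions-Peetre space -/

section

variable {ρ₀ ρ₁ : L0 → ℝ≥0∞} {E : Type*} [NormedAddCommGroup E] [NormedSpace ℝ E]
  [CompleteSpace E] {e : UnconditionalSchauderBasis ℕ ℝ E} {m : ℕ → ℝ}

/-- Dominated convergence is used twice: `x` minus its truncations is dominated by `x`, and a
truncation minus clamped members of a countable set is dominated by a constant. Clamping the
countable set provides that constant. -/
theorem isSeparableNorm_lionsPeetre (h₀ : IsRISpace ρ₀) (h₁ : IsRISpace ρ₁)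
    (h₀₁ : StrictlyEmbedded ρ₀ ρ₁) (h : IsOneUnconditional e) (he : ∀ n, ‖e n‖ = 1)
    (hm : IsAdmissibleWeight m) :
    IsSeparableNorm (lionsPeetre ρ₀ ρ₁ e (fun n => (m n)⁻¹) m) := by
  have hW := isBanachFunctionNorm_lionsPeetre h₀.isBanachFunctionNorm h₁.isBanachFunctionNorm h₀₁
    h he hm
  have hdom := fun {y : L0} hy {x : ℕ → L0} hxy hmeas =>
    tendsto_lionsPeetre_of_dominated (x := x) (y := y) h₁ h₀.isBanachFunctionNorm h₀₁ h he hm hy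
      hxy hmeas
  have hconst : ∀ c : ℝ, lionsPeetre ρ₀ ρ₁ e (fun n => (m n)⁻¹) m (c • (1 : L0)) < ∞ := fun c => by
    rw [hW.smul]
    exact ENNReal.mul_lt_top enorm_lt_top
      (lionsPeetre_lt_top_of_lt_top h₁.isBanachFunctionNorm h he hm h₀.one_lt_top)
  have hcoe : ∀ c : ℝ, ∀ᵐ t ∂unitVolume, (c • (1 : L0)) t = c := fun c => by
    filter_upwards [AEEqFun.coeFn_smul c (1 : L0), AEEqFun.coeFn_one (μ := unitVolume) (β := ℝ)]
      with t h1 h2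
    rw [h1, Pi.smul_apply, h2, Pi.one_apply, smul_eq_mul, mul_one]
  obtain ⟨D, hD⟩ := L0.exists_countable_dense
  refine ⟨Set.range fun p : ℕ × ℕ => L0.clamp p.1 (D p.2), Set.countable_range _, ?_, ?_⟩
  · rintro _ ⟨⟨N, n⟩, rfl⟩
    refine (hW.mono ?_).trans_lt (hconst N)
    filter_upwards [L0.coeFn_clamp N (D n), hcoe N] with t h1 h2
    rw [h1, h2]
    exact (abs_max_neg_min_le (Nat.cast_nonneg N) _).trans (le_abs_self _)
  · intro x hx ε hε
    have hε2 : 0 < ε / 2 := ENNReal.half_pos hε.ne'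
    have htrunc : Tendsto (fun N : ℕ => lionsPeetre ρ₀ ρ₁ e (fun n => (m n)⁻¹) m
        (x - L0.clamp N x)) atTop (𝓝 0) := by
      refine hdom hx (fun N => ?_) fun δ hδ => ?_
      · filter_upwards [L0.coeFn_clamp N x, AEEqFun.coeFn_sub x (L0.clamp N x)] with t h1 h2
        rw [h2, Pi.sub_apply, h1]
        exact (abs_sub_max_neg_min_le (Nat.cast_nonneg N) _).1
      · refine tendsto_of_tendsto_of_tendsto_of_le_of_le tendsto_const_nhds
          x.tendsto_measure_lt_abs (fun _ => zero_le) fun N => measure_mono_ae ?_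
        filter_upwards [L0.coeFn_clamp N x, AEEqFun.coeFn_sub x (L0.clamp N x)] with t h1 h2 h3
        by_contra h4
        have h5 : |x t| ≤ N := not_lt.1 h4
        have h6 : δ < |(x - L0.clamp N x) t| := h3
        rw [h2, Pi.sub_apply, h1, (abs_sub_max_neg_min_le (Nat.cast_nonneg N) _).2 h5,
          abs_zero] at h6
        exact absurd h6 (not_lt.2 hδ.le)
    obtain ⟨N, hN⟩ := (htrunc.eventually_lt_const hε2).exists
    set g := L0.clamp N x with hg
    have hgN : ∀ᵐ t ∂unitVolume, |g t| ≤ N := by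
      filter_upwards [L0.coeFn_clamp N x] with t h1
      rw [hg, h1]
      exact abs_max_neg_min_le (Nat.cast_nonneg N) _
    obtain ⟨φ, hφ⟩ := hD N g hgN
    have hsub : ∀ k, ∀ᵐ t ∂unitVolume, |(g - L0.clamp N (D (φ k))) t| ≤ 2 * N ∧
        |(g - L0.clamp N (D (φ k))) t| ≤ |(g - D (φ k)) t| := fun k => by
      filter_upwards [hgN, L0.coeFn_clamp N (D (φ k)), AEEqFun.coeFn_sub g (D (φ k)),
        AEEqFun.coeFn_sub g (L0.clamp N (D (φ k)))] with t h1 h2 h3 h4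
      rw [h3, h4, Pi.sub_apply, Pi.sub_apply, h2]
      set r := D (φ k) t
      refine ⟨?_, ?_⟩
      · have := abs_max_neg_min_le (Nat.cast_nonneg N : (0 : ℝ) ≤ N) r
        linarith [abs_sub (g t) (max (-(N : ℝ)) (min r N))]
      -- `g t` is its own clamp, and clamping is 1-Lipschitz.
      · have h5 : g t = max (-(N : ℝ)) (min (g t) N) := by
          rw [abs_le] at h1
          rw [min_eq_left h1.2, max_eq_right h1.1]
        nth_rw 1 [h5]
        refine (abs_max_sub_max_le_max _ _ _ _).trans ?_
        rw [sub_self, abs_zero]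
        refine max_le (abs_nonneg _) ((abs_min_sub_min_le_max _ _ _ _).trans ?_)
        rw [sub_self, abs_zero]
        exact max_le le_rfl (abs_nonneg _)
    have hlim : Tendsto (fun k => lionsPeetre ρ₀ ρ₁ e (fun n => (m n)⁻¹) m
        (g - L0.clamp N (D (φ k)))) atTop (𝓝 0) := by
      refine hdom (hconst (2 * N)) (fun k => ?_) fun δ hδ => ?_
      · filter_upwards [hsub k, hcoe (2 * N)] with t h1 h2
        rw [h2]
        exact h1.1.trans (le_abs_self _)
      · refine tendsto_of_tendsto_of_tendsto_of_le_of_le tendsto_const_nhds (hφ δ hδ)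
          (fun _ => zero_le) fun k => measure_mono_ae ?_
        filter_upwards [hsub k] with t h1 h2
        exact (show δ < |(g - L0.clamp N (D (φ k))) t| from h2).trans_le h1.2
    obtain ⟨k, hk⟩ := (hlim.eventually_lt_const hε2).exists
    refine ⟨L0.clamp N (D (φ k)), ⟨(N, φ k), rfl⟩, ?_⟩
    rw [← sub_add_sub_cancel x g]
    refine (hW.add_le _ _).trans_lt ((ENNReal.add_lt_add hN hk).trans_eq (ENNReal.add_halves ε))

theorem isRISpace_lionsPeetre (h₀ : IsRISpace ρ₀) (h₁ : IsRISpace ρ₁)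
    (h₀₁ : StrictlyEmbedded ρ₀ ρ₁) (h : IsOneUnconditional e) (he : ∀ n, ‖e n‖ = 1)
    (hm : IsAdmissibleWeight m) : IsRISpace (lionsPeetre ρ₀ ρ₁ e (fun n => (m n)⁻¹) m) where
  isBanachFunctionNorm := isBanachFunctionNorm_lionsPeetre h₀.isBanachFunctionNorm
    h₁.isBanachFunctionNorm h₀₁ h he hm
  nontrivial := by
    obtain ⟨x, hx0, hx⟩ := h₀.nontrivial
    exact ⟨x, hx0, lionsPeetre_lt_top_of_lt_top h₁.isBanachFunctionNorm h he hm hx⟩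
  equimeasurable x y hxy := by
    simp only [lionsPeetre, peetreK_eq_of_equimeasurable h₀ h₁ hxy]
  separable_or_maximal := Or.inl (isSeparableNorm_lionsPeetre h₀ h₁ h₀₁ h he hm)

end

/-! ### Disjoint sequences in the Lions-Peetre space -/

theorem L0.ae_disjoint_of_forall {x : ℕ → L0} (hx : ∀ i j, i ≠ j → |x i| ⊓ |x j| = 0) :
    ∀ᵐ t ∂unitVolume, ∀ i j, i ≠ j → x i t = 0 ∨ x j t = 0 := by
  rw [ae_all_iff]; intro i
  rw [ae_all_iff]; intro j
  by_cases hij : i = j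
  · exact Eventually.of_forall fun t h => absurd hij h
  · filter_upwards [(L0.abs_inf_abs_eq_zero_iff _ _).1 (hx i j hij)] with t ht _
    exact ht

theorem L0.abs_smul_le_abs_sum {x : ℕ → L0}
    (hx : ∀ᵐ t ∂unitVolume, ∀ i j, i ≠ j → x i t = 0 ∨ x j t = 0)
    {F : Finset ℕ} (a : ℕ → ℝ) {i : ℕ} (hi : i ∈ F) :
    ∀ᵐ t ∂unitVolume, |(a i • x i) t| ≤ |(∑ k ∈ F, a k • x k) t| := by
  have hsmul : ∀ᵐ t ∂unitVolume, ∀ k, (a k • x k) t = a k * x k t :=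
    ae_all_iff.2 fun k => by
      filter_upwards [AEEqFun.coeFn_smul (a k) (x k)] with t ht
      rw [ht, Pi.smul_apply, smul_eq_mul]
  filter_upwards [hx, L0.coeFn_sum F fun k => a k • x k, hsmul] with t h1 h2 h3
  rw [h2]
  simp only [h3]
  by_cases h0 : x i t = 0
  · rw [h0, mul_zero, abs_zero]; exact abs_nonneg _
  · rw [Finset.sum_eq_single_of_mem i hi]
    intro k _ hk
    rw [(h1 k i hk).resolve_right h0, mul_zero]

/-- Disjoint supports have summable measures on a probability space. -/
theorem L0.tendsto_measure_support {x : ℕ → L0} (hx : ∀ i j, i ≠ j → |x i| ⊓ |x j| = 0) :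
    Tendsto (fun n => unitVolume {t | x n t ≠ 0}) atTop (𝓝 0) := by
  have hmeas : ∀ n, MeasurableSet {t | x n t ≠ 0} := fun n =>
    (x n).measurable (measurableSet_singleton (0 : ℝ)).compl
  have hdis : Pairwise (Function.onFun (AEDisjoint unitVolume) fun n => {t | x n t ≠ 0}) := by
    intro i j hij
    have h1 := (L0.abs_inf_abs_eq_zero_iff _ _).1 (hx i j hij)
    rw [ae_iff] at h1
    refine measure_mono_null ?_ h1
    rintro t ⟨h2, h3⟩
    exact fun h4 => h4.elim h2 h3
  have hsum : ∑' n, unitVolume {t | x n t ≠ 0} ≠ ∞ := by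
    rw [← measure_iUnion₀ hdis fun n => (hmeas n).nullMeasurableSet]
    exact measure_ne_top _ _
  exact ENNReal.tendsto_atTop_zero_of_tsum_ne_top hsum

theorem peetreK_smul {ρ₀ ρ₁ : L0 → ℝ≥0∞} (h₀ : IsBanachFunctionNorm ρ₀)
    (h₁ : IsBanachFunctionNorm ρ₁) {α β : ℝ} (c : ℝ) (x : L0) :
    peetreK ρ₀ ρ₁ α β (c • x) = ‖c‖ₑ * peetreK ρ₀ ρ₁ α β x := by
  apply le_antisymm (peetreK_smul_le h₀ h₁ c x)
  rcases eq_or_ne c 0 with rfl | hc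
  · simp
  · have h1 := peetreK_smul_le h₀ h₁ (α := α) (β := β) c⁻¹ (c • x)
    rw [smul_smul, inv_mul_cancel₀ hc, one_smul] at h1
    calc _ ≤ ‖c‖ₑ * (‖c⁻¹‖ₑ * peetreK ρ₀ ρ₁ α β (c • x)) := by gcongr
      _ = _ := by rw [← mul_assoc, ← enorm_mul, mul_inv_cancel₀ hc]; simp

theorem IsAdmissibleWeight.tendsto_inv {m : ℕ → ℝ} (hm : IsAdmissibleWeight m) :
    Tendsto (fun n => (m n)⁻¹) atTop (𝓝 0) := hm.summable.tendsto_atTop_zero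

section

variable {ρ₀ ρ₁ : L0 → ℝ≥0∞} {E : Type*} [NormedAddCommGroup E] [NormedSpace ℝ E]
  {e : UnconditionalSchauderBasis ℕ ℝ E} {m : ℕ → ℝ}

/-- For fixed `n`, the bound `k_n(x j) ≤ 1` splits `x j` into a part of `X₁`-norm at most `2/m_n`
and a part bounded in `X₀`. The latter lives on the support of `x j`, whose measure tends to `0`, so
strictness kills it in `X₁`. -/
theorem tendsto_of_isNormalizedDisjoint_lionsPeetre (h₀ : IsBanachFunctionNorm ρ₀)
    (h₁ : IsBanachFunctionNorm ρ₁) (h₀₁ : StrictlyEmbedded ρ₀ ρ₁) (h : IsOneUnconditional e)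
    (he : ∀ n, ‖e n‖ = 1) (hm : IsAdmissibleWeight m) {x : ℕ → L0}
    (hx : IsNormalizedDisjoint (lionsPeetre ρ₀ ρ₁ e (fun n => (m n)⁻¹) m) x) :
    Tendsto (fun j => ρ₁ (x j)) atTop (𝓝 0) := by
  rw [ENNReal.tendsto_atTop_zero]
  intro ε hε
  have hε2 : 0 < ε / 2 := ENNReal.half_pos hε.ne'
  have hlim : Tendsto (fun n => ENNReal.ofReal ((m n)⁻¹) * 2) atTop (𝓝 0) := by
    have h1 := ENNReal.Tendsto.mul_const (ENNReal.tendsto_ofReal hm.tendsto_inv)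
      (Or.inr (ENNReal.ofNat_ne_top (n := 2))) (b := 2)
    simpa using h1
  obtain ⟨n, hn⟩ := (hlim.eventually_le_const hε2).exists
  have hmn := hm.pos n
  have hdec : ∀ j, ∃ y z : L0, x j = y + z ∧ ρ₀ y ≤ ENNReal.ofReal (m n) * 2 ∧
      ρ₁ z ≤ ENNReal.ofReal ((m n)⁻¹) * 2 ∧ ∀ᵐ t ∂unitVolume, x j t = 0 → y t = 0 := by
    intro j
    -- The infimum need not be attained, so the bound `1` is relaxed to `2`.
    have h1 : peetreK ρ₀ ρ₁ ((m n)⁻¹) (m n) (x j) < 2 := by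
      refine (h.peetreK_le_lionsPeetre (α := fun n => (m n)⁻¹) he n (x j)).trans_lt ?_
      rw [hx.1 j]; norm_num
    obtain ⟨y, z, hyz, hlt⟩ := exists_of_peetreK_lt h1
    obtain ⟨y', z', hyz', hy', hz', hy0, -⟩ := L0.exists_add_eq_of_abs_le (x := x j) (y := y)
      (z := z) (by
        filter_upwards [AEEqFun.coeFn_add y z] with t h2
        rw [hyz, h2]
        exact abs_add_le _ _)
    have hcancel : ENNReal.ofReal (m n) * ENNReal.ofReal ((m n)⁻¹) = 1 := by
      rw [← ENNReal.ofReal_mul hmn.le, mul_inv_cancel₀ hmn.ne', ENNReal.ofReal_one]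
    refine ⟨y', z', hyz', (h₀.mono hy').trans ?_, (h₁.mono hz').trans ?_, hy0⟩
    · calc ρ₀ y = ENNReal.ofReal (m n) * (ENNReal.ofReal ((m n)⁻¹) * ρ₀ y) := by
            rw [← mul_assoc, hcancel, one_mul]
        _ ≤ _ := by gcongr; exact le_self_add.trans hlt.le
    · calc ρ₁ z = ENNReal.ofReal ((m n)⁻¹) * (ENNReal.ofReal (m n) * ρ₁ z) := by
            rw [← mul_assoc, mul_comm (ENNReal.ofReal ((m n)⁻¹)), hcancel, one_mul]
        _ ≤ _ := by gcongr; exact le_add_self.trans hlt.le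
  choose y z hxyz hy hz hy0 using hdec
  have hylim : Tendsto (fun j => ρ₁ (y j)) atTop (𝓝 0) := by
    refine h₀₁.2 y ⟨(m n).toNNReal * 2, fun j => hy j⟩ ?_
    refine tendsto_of_tendsto_of_tendsto_of_le_of_le tendsto_const_nhds
      (L0.tendsto_measure_support hx.2) (fun _ => zero_le) fun j => measure_mono_ae ?_
    filter_upwards [hy0 j] with t h1 h2 h3
    exact h2 (h1 h3)
  obtain ⟨M, hM⟩ := eventually_atTop.1 (hylim.eventually_le_const hε2)
  refine ⟨M, fun j hj => ?_⟩
  rw [hxyz]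
  exact (h₁.add_le _ _).trans ((add_le_add (hM j hj) ((hz j).trans hn)).trans_eq
    (ENNReal.add_halves ε))

/-- Profiles are coordinatewise null by `k_n(x j) ≤ m_n ρ₁(x j)`. The upper estimate is
subadditivity of the K-functional; the lower one is its monotonicity, since a disjoint sum dominates
each of its terms. -/
theorem exists_equiv_block_of_isNormalizedDisjoint_lionsPeetre [CompleteSpace E]
    (h₀ : IsBanachFunctionNorm ρ₀)
    (h₁ : IsBanachFunctionNorm ρ₁) (h₀₁ : StrictlyEmbedded ρ₀ ρ₁) (h : IsOneUnconditional e)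
    (he : ∀ n, ‖e n‖ = 1) (hm : IsAdmissibleWeight m) {x : ℕ → L0}
    (hx : IsNormalizedDisjoint (lionsPeetre ρ₀ ρ₁ e (fun n => (m n)⁻¹) m) x) :
    ∃ φ : ℕ → ℕ, StrictMono φ ∧ ∃ u : ℕ → E, IsNormalizedBlockBasis e u ∧
      EquivSeq (lionsPeetre ρ₀ ρ₁ e (fun n => (m n)⁻¹) m) (x ∘ φ) (fun y : E => ‖y‖ₑ) u := by
  have hlim := tendsto_of_isNormalizedDisjoint_lionsPeetre h₀ h₁ h₀₁ h he hm hx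
  have hae := L0.ae_disjoint_of_forall hx.2
  choose s hs0 hs hsn using fun j => exists_of_lionsPeetre_lt_top
    (x := x j) (N₀ := ρ₀) (N₁ := ρ₁) (e := e) (α := fun n => (m n)⁻¹) (β := m)
    (by rw [hx.1 j]; exact ENNReal.one_lt_top)
  refine h.exists_equiv_block (s := s) (fun j => ?_) (fun n => ?_) ?_ ?_
  · have := hsn j
    rw [hx.1 j] at this
    rw [← toReal_enorm, ← this]; simp
  · have h1 : Tendsto (fun j => ENNReal.ofReal (e.coord n (s j))) atTop (𝓝 0) := by
      have h2 := ENNReal.Tendsto.const_mul hlim (Or.inr ENNReal.ofReal_ne_top)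
        (a := ENNReal.ofReal (m n))
      rw [mul_zero] at h2
      refine tendsto_of_tendsto_of_tendsto_of_le_of_le tendsto_const_nhds h2 (fun _ => zero_le)
        fun j => ?_
      change ENNReal.ofReal (e.coord n (s j)) ≤ _
      rw [← hs]
      exact peetreK_le_right h₀ _
    have h2 := (ENNReal.tendsto_toReal ENNReal.zero_ne_top).comp h1
    rw [ENNReal.toReal_zero] at h2
    exact h2.congr fun j => ENNReal.toReal_ofReal (hs0 j n)
  · intro φ hφ F a
    refine h.lionsPeetre_le fun n => (peetreK_sum_smul_le h₀ h₁ F a fun i => x (φ i)).trans ?_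
    rw [map_sum, ENNReal.ofReal_sum_of_nonneg fun i _ => by
      rw [map_smul, smul_eq_mul]; exact mul_nonneg (abs_nonneg _) (hs0 _ _)]
    refine Finset.sum_le_sum fun i _ => le_of_eq ?_
    rw [hs, map_smul, smul_eq_mul, ENNReal.ofReal_mul (abs_nonneg _), Real.enorm_eq_ofReal_abs]
  · intro φ hφ F a g hg
    refine h.le_lionsPeetre fun n => ?_
    rcases hg n with h1 | ⟨i, hi, hle⟩
    · rw [h1, abs_zero, ENNReal.ofReal_zero]; exact zero_le
    · have h2 : ∀ᵐ t ∂unitVolume, ∀ i j, i ≠ j → x (φ i) t = 0 ∨ x (φ j) t = 0 := by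
        filter_upwards [hae] with t ht i j hij
        exact ht _ _ (hφ.injective.ne hij)
      refine (ENNReal.ofReal_le_ofReal hle).trans ?_
      rw [ENNReal.ofReal_mul (abs_nonneg _), ← Real.enorm_eq_ofReal_abs, abs_of_nonneg (hs0 _ _),
        ← hs, ← peetreK_smul h₀ h₁]
      exact peetreK_mono h₀ h₁ (L0.abs_smul_le_abs_sum h2 a hi)

end

/-! ### Copies of block bases in the Lions-Peetre space -/

/-- At almost every point of `A` one of the two summands has modulus at least `l/2`, so one of them
does so on at least half of `A` and dominates `l/2` times the indicator of that half. -/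
theorem le_peetreK_smul_ind {ρ₀ ρ₁ : L0 → ℝ≥0∞} (h₀ : IsBanachFunctionNorm ρ₀)
    (h₁ : IsBanachFunctionNorm ρ₁) {α β l : ℝ} (hl : 0 < l) {A : Set ℝ} (hA : MeasurableSet A)
    {c : ℝ≥0∞}
    (hc : ∀ (B : Set ℝ) (hB : MeasurableSet B), unitVolume A ≤ 2 * unitVolume B →
      c ≤ ENNReal.ofReal α * (ENNReal.ofReal (l / 2) * ρ₀ (L0.ind B hB)) ∧
      c ≤ ENNReal.ofReal β * (ENNReal.ofReal (l / 2) * ρ₁ (L0.ind B hB))) :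
    c ≤ peetreK ρ₀ ρ₁ α β (l • L0.ind A hA) := by
  refine le_peetreK fun y z hyz => ?_
  have hsum : ∀ᵐ t ∂unitVolume, t ∈ A → l ≤ |y t| + |z t| := by
    filter_upwards [L0.coeFn_ind A hA, AEEqFun.coeFn_smul l (L0.ind A hA),
      AEEqFun.coeFn_add y z] with t h1 h2 h3 ht
    have h4 : y t + z t = l := by
      rw [← Pi.add_apply, ← h3, ← hyz, h2, Pi.smul_apply, h1, Set.indicator_of_mem ht, smul_eq_mul,
        mul_one]
    rw [← h4]
    exact add_le_add (le_abs_self _) (le_abs_self _)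
  have hbound : ∀ {ρ : L0 → ℝ≥0∞}, IsBanachFunctionNorm ρ → ∀ (B : Set ℝ) (hB : MeasurableSet B)
      (w : L0), (∀ᵐ t ∂unitVolume, t ∈ B → l / 2 ≤ |w t|) →
      ENNReal.ofReal (l / 2) * ρ (L0.ind B hB) ≤ ρ w := by
    intro ρ h B hB w hw
    have h1 : ENNReal.ofReal (l / 2) * ρ (L0.ind B hB) = ρ ((l / 2) • L0.ind B hB) := by
      rw [h.smul, ← ofReal_norm, Real.norm_of_nonneg (by positivity)]
    rw [h1]
    apply h.mono
    filter_upwards [hw, L0.coeFn_ind B hB, AEEqFun.coeFn_smul (l / 2) (L0.ind B hB)]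
      with t h2 h3 h4
    rw [h4, Pi.smul_apply, h3]
    by_cases ht : t ∈ B
    · rw [Set.indicator_of_mem ht, smul_eq_mul, mul_one, abs_of_pos (by positivity)]
      exact h2 ht
    · rw [Set.indicator_of_notMem ht, smul_zero, abs_zero]; exact abs_nonneg _
  have hD : MeasurableSet {t | l / 2 ≤ |y t|} := measurableSet_le measurable_const y.measurable.abs
  have hsplit : unitVolume A ≤ unitVolume (A ∩ {t | l / 2 ≤ |y t|})
      + unitVolume (A \ {t | l / 2 ≤ |y t|}) := (measure_inter_add_sdiff A hD).ge
  rcases le_total (unitVolume (A \ {t | l / 2 ≤ |y t|})) (unitVolume (A ∩ {t | l / 2 ≤ |y t|}))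
    with hle | hle
  · refine ((hc _ (hA.inter hD) (hsplit.trans ?_)).1.trans ?_).trans le_self_add
    · rw [two_mul]; gcongr
    · gcongr
      exact hbound h₀ _ _ _ (Eventually.of_forall fun t ht => ht.2)
  · refine ((hc _ (hA.diff hD) (hsplit.trans ?_)).2.trans ?_).trans le_add_self
    · rw [two_mul]; gcongr
    · gcongr
      refine hbound h₁ _ _ _ ?_
      filter_upwards [hsum] with t h1 ht
      have h2 := h1 ht.1
      have h3 : |y t| < l / 2 := not_le.1 ht.2
      linarith

/-- Take the first `k` at which `f₀/f₁` reaches `M`; it is not `0` by `hM`. One step at most doubles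
the ratio, so there is no overshoot beyond `2M`. The bound on `2^{-k}` combines `f₀ k ≤ f₀ 0` with
`f₁ k ≥ 2^{-k} f₁ 0`. -/
theorem exists_dyadic_ratio {f₀ f₁ : ℕ → ℝ} (hf₁ : ∀ k, 0 < f₁ k)
    (hanti : ∀ k, f₀ (k + 1) ≤ f₀ k) (hhalf : ∀ k, f₁ k ≤ 2 * f₁ (k + 1))
    (hpow : ∀ k, f₁ 0 ≤ 2 ^ k * f₁ k) {M : ℝ} (hM : f₀ 0 / f₁ 0 < M) (hM0 : 0 < M)
    (hex : ∃ k, M * f₁ k ≤ f₀ k) :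
    ∃ k, M * f₁ k ≤ f₀ k ∧ f₀ k ≤ 2 * M * f₁ k ∧ (1 / 2 : ℝ) ^ k ≤ f₀ 0 / f₁ 0 * M⁻¹ := by
  classical
  have hle0 : ∀ k, f₀ k ≤ f₀ 0 := fun k => antitone_nat_of_succ_le hanti (Nat.zero_le k)
  have hspec := Nat.find_spec hex
  set k := Nat.find hex with hk
  refine ⟨k, hspec, ?_, ?_⟩
  · have hk0 : k ≠ 0 := by
      intro h0
      rw [h0] at hspec
      rw [div_lt_iff₀ (hf₁ 0)] at hM
      linarith
    obtain ⟨j, hj⟩ := Nat.exists_eq_succ_of_ne_zero hk0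
    have hmin := Nat.find_min hex (show j < Nat.find hex by rw [← hk, hj]; exact Nat.lt_succ_self j)
    rw [hj]
    have h1 := hanti j
    have h2 := mul_le_mul_of_nonneg_left (hhalf j) hM0.le
    simp only [Nat.succ_eq_add_one]
    linarith [not_le.1 hmin]
  · have h1 := hpow k
    have h2 := hle0 k
    have h3 : ((1 : ℝ) / 2) ^ k = (2 ^ k)⁻¹ := by simp
    have h4 : (0 : ℝ) < 2 ^ k := by positivity
    have hf0 := hf₁ 0
    rw [h3, ← div_eq_mul_inv, div_div, inv_eq_one_div, div_le_div_iff₀ h4 (by positivity), one_mul]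
    nlinarith [mul_le_mul_of_nonneg_left h1 hM0.le, mul_le_mul_of_nonneg_left hspec h4.le,
      mul_le_mul_of_nonneg_left h2 h4.le]

namespace IsRISpace

/-- The fundamental function at dyadic points. -/
theorem dyadic_properties {ρ : L0 → ℝ≥0∞} (h : IsRISpace ρ) :
    ∃ f : ℕ → ℝ, (∀ k, 0 < f k) ∧ (∀ k, f (k + 1) ≤ f k) ∧ (∀ k, f k ≤ 2 * f (k + 1)) ∧
      (∀ k, f 0 ≤ 2 ^ k * f k) ∧
      (∀ (k : ℕ) (A : Set ℝ) (hA : MeasurableSet A),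
        ENNReal.ofReal ((1 / 2 : ℝ) ^ k) ≤ unitVolume A →
        ENNReal.ofReal (f k) ≤ ρ (L0.ind A hA)) ∧
      (∀ (k : ℕ) (A : Set ℝ) (hA : MeasurableSet A),
        unitVolume A = ENNReal.ofReal ((1 / 2 : ℝ) ^ k) →
        ρ (L0.ind A hA) = ENNReal.ofReal (f k)) := by
  set f : ℕ → ℝ := fun k => (ρ (L0.ind (Set.Ico 0 ((1 / 2 : ℝ) ^ k)) measurableSet_Ico)).toReal
    with hf
  have hvol : ∀ k : ℕ, unitVolume (Set.Ico 0 ((1 / 2 : ℝ) ^ k))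
      = ENNReal.ofReal ((1 / 2 : ℝ) ^ k) := fun k => by
    rw [unitVolume_Ico le_rfl (pow_le_one₀ (by norm_num) (by norm_num)), sub_zero]
  have hof : ∀ k, ENNReal.ofReal (f k)
      = ρ (L0.ind (Set.Ico 0 ((1 / 2 : ℝ) ^ k)) measurableSet_Ico) := fun k =>
    ENNReal.ofReal_toReal (h.ind_lt_top _).ne
  have hpos : ∀ k, 0 < f k := fun k => by
    refine ENNReal.toReal_pos (h.ind_pos _ ?_).ne' (h.ind_lt_top _).ne
    rw [hvol]; simp
  refine ⟨f, hpos, fun k => ?_, fun k => ?_, fun k => ?_, fun k A hA hle => ?_, fun k A hA heq => ?_⟩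
  · rw [← ENNReal.ofReal_le_ofReal_iff (hpos k).le, hof, hof]
    apply h.ind_le_ind
    rw [hvol, hvol]
    exact ENNReal.ofReal_le_ofReal
      (pow_le_pow_of_le_one (by norm_num) (by norm_num) (Nat.le_succ k))
  · rw [← ENNReal.ofReal_le_ofReal_iff (by have := hpos (k + 1); positivity),
      ENNReal.ofReal_mul (by norm_num), hof, hof]
    have h1 : (2 : ℝ) * (1 / 2) ^ (k + 1) = (1 / 2) ^ k := by rw [pow_succ]; ring
    have := h.ind_Ico_le_two_mul (t := (1 / 2 : ℝ) ^ (k + 1)) (by positivity)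
      (by rw [h1]; exact pow_le_one₀ (by norm_num) (by norm_num))
    simpa only [h1, ENNReal.ofReal_ofNat] using this
  · rw [← ENNReal.ofReal_le_ofReal_iff (by have := hpos k; positivity),
      ENNReal.ofReal_mul (by positivity), hof, hof, ENNReal.ofReal_pow (by norm_num),
      ENNReal.ofReal_ofNat]
    simpa using h.ind_Ico_one_le k
  · rw [hof]
    apply h.ind_le_ind
    rwa [hvol]
  · rw [hof]
    apply le_antisymm <;> apply h.ind_le_ind <;> rw [hvol, heq]

end IsRISpace

/-- With `φ₀`, `φ₁` the fundamental functions, choose dyadic `t_n` with `φ₀(t_n)/φ₁(t_n)` between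
`m_n²` and `2 m_n²`, and let `w n` be `m_n/φ₀(t_n)` times the indicator of an interval of length
`t_n`. In `1/8`, one factor `1/2` comes from halving the height, one from halving the set, and one
from the overshoot of the ratio. -/
theorem exists_disjoint_peetreK {ρ₀ ρ₁ : L0 → ℝ≥0∞} (h₀ : IsRISpace ρ₀) (h₁ : IsRISpace ρ₁)
    (h₀₁ : StrictlyEmbedded ρ₀ ρ₁) {m : ℕ → ℝ} (hm : IsAdmissibleWeight m) :
    ∃ (n₀ : ℕ) (w : ℕ → L0), (∀ i j, i ≠ j → |w i| ⊓ |w j| = 0) ∧ ∀ n, n₀ ≤ n →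
      ρ₀ (w n) ≤ ENNReal.ofReal (m n) ∧ ρ₁ (w n) ≤ ENNReal.ofReal ((m n)⁻¹) ∧
      ENNReal.ofReal (1 / 8) ≤ peetreK ρ₀ ρ₁ ((m n)⁻¹) (m n) (w n) := by
  obtain ⟨f₀, hf₀, hanti₀, hhalf₀, -, hlow₀, heq₀⟩ := h₀.dyadic_properties
  obtain ⟨f₁, hf₁, -, hhalf₁, hpow₁, hlow₁, heq₁⟩ := h₁.dyadic_properties
  set c := f₀ 0 / f₁ 0 with hc
  have hc0 : 0 < c := div_pos (hf₀ 0) (hf₁ 0)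
  have hvol : ∀ k : ℕ, unitVolume (Set.Ico 0 ((1 / 2 : ℝ) ^ k))
      = ENNReal.ofReal ((1 / 2 : ℝ) ^ k) := fun k => by
    rw [unitVolume_Ico le_rfl (pow_le_one₀ (by norm_num) (by norm_num)), sub_zero]
  -- Strictness, applied to dyadic indicators normalized in `X₀`, makes `f₁ k / f₀ k` arbitrarily
  -- small.
  have hex : ∀ M : ℝ, 0 < M → ∃ k, M * f₁ k ≤ f₀ k := by
    intro M hM
    obtain ⟨k, hk⟩ := h₀₁.exists_measure_le 1 (ε := ENNReal.ofReal M⁻¹) (by simpa using hM)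
    refine ⟨k, ?_⟩
    have hnorm : ‖(f₀ k)⁻¹‖ₑ = ENNReal.ofReal (f₀ k)⁻¹ := by
      rw [← ofReal_norm, Real.norm_of_nonneg (inv_nonneg.2 (hf₀ k).le)]
    have h1 := hk ((f₀ k)⁻¹ • L0.ind (Set.Ico 0 ((1 / 2 : ℝ) ^ k)) measurableSet_Ico) (by
      rw [h₀.isBanachFunctionNorm.smul, heq₀ k _ _ (hvol k), hnorm,
        ← ENNReal.ofReal_mul (inv_nonneg.2 (hf₀ k).le), inv_mul_cancel₀ (hf₀ k).ne']
      simp) (by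
      rw [← hvol k]
      apply measure_mono_ae
      filter_upwards [L0.coeFn_ind (Set.Ico 0 ((1 / 2 : ℝ) ^ k)) measurableSet_Ico,
        AEEqFun.coeFn_smul (f₀ k)⁻¹ (L0.ind (Set.Ico 0 ((1 / 2 : ℝ) ^ k)) measurableSet_Ico)]
        with t h2 h3 h4
      by_contra h5
      refine h4 ?_
      rw [h3, Pi.smul_apply, h2, Set.indicator_of_notMem (show t ∉ Set.Ico _ _ from h5), smul_zero])
    rw [h₁.isBanachFunctionNorm.smul, heq₁ k _ _ (hvol k), hnorm,
      ← ENNReal.ofReal_mul (inv_nonneg.2 (hf₀ k).le),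
      ENNReal.ofReal_le_ofReal_iff (inv_nonneg.2 hM.le), inv_mul_le_iff₀ (hf₀ k),
      ← div_eq_mul_inv, le_div_iff₀ hM] at h1
    linarith
  have hinv_sq : ∀ n, ((m n) ^ 2)⁻¹ ≤ (m n)⁻¹ := fun n => by
    have := hm.two_le_apply n
    exact inv_anti₀ (hm.pos n) (by nlinarith)
  have hsummable : Summable fun n => c * ((m n) ^ 2)⁻¹ :=
    (Summable.of_nonneg_of_le (fun n => by positivity) hinv_sq hm.summable).mul_left c
  -- From `n₀` on, the target ratio `m_n²` exceeds the ratio `c` at `t = 1`, and the intervals, of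
  -- lengths at most `c/m_n²`, fit together into `[0, 1]`.
  obtain ⟨n₀, hn₀, hn₀'⟩ : ∃ n₀, (∀ n, n₀ ≤ n → c < (m n) ^ 2) ∧
      ∑' i, c * ((m (i + n₀)) ^ 2)⁻¹ ≤ 1 := by
    have h1 := (tendsto_sum_nat_add fun n => c * ((m n) ^ 2)⁻¹).eventually_le_const zero_lt_one
    have h2 : ∀ᶠ n₀ in atTop, ∀ n, n₀ ≤ n → c < (m n) ^ 2 := by
      obtain ⟨N, hN⟩ := eventually_atTop.1
        (hsummable.tendsto_atTop_zero.eventually_lt_const zero_lt_one)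
      filter_upwards [eventually_ge_atTop N] with n₀ h3 n h4
      have h5 := hN n (h3.trans h4)
      have := hm.pos n
      rwa [← div_eq_mul_inv, div_lt_one (by positivity)] at h5
    obtain ⟨n₀, h3, h4⟩ := (h1.and h2).exists
    exact ⟨n₀, h4, h3⟩
  have hkex : ∀ n, ∃ k, n₀ ≤ n → (m n) ^ 2 * f₁ k ≤ f₀ k ∧ f₀ k ≤ 2 * (m n) ^ 2 * f₁ k ∧
      (1 / 2 : ℝ) ^ k ≤ c * ((m n) ^ 2)⁻¹ := by
    intro n
    by_cases hn : n₀ ≤ n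
    · have hmn := hm.pos n
      obtain ⟨k, hk⟩ := exists_dyadic_ratio hf₁ hanti₀ hhalf₁ hpow₁ (hn₀ n hn) (by positivity)
        (hex _ (by positivity))
      exact ⟨k, fun _ => hk⟩
    · exact ⟨0, fun h => absurd h hn⟩
  choose k hk using hkex
  set T : ℕ → ℝ := fun n => ∑ i ∈ Finset.Ico n₀ n, (1 / 2 : ℝ) ^ k i with hT
  have hT0 : ∀ n, 0 ≤ T n := fun n => Finset.sum_nonneg fun _ _ => by positivity
  have hT1 : ∀ n, T n ≤ 1 := fun n => by
    refine le_trans ?_ hn₀'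
    calc T n ≤ ∑ i ∈ Finset.Ico n₀ n, c * ((m i) ^ 2)⁻¹ :=
          Finset.sum_le_sum fun i hi => (hk i (Finset.mem_Ico.1 hi).1).2.2
      _ = ∑ i ∈ Finset.range (n - n₀), c * ((m (i + n₀)) ^ 2)⁻¹ := by
          rw [Finset.sum_Ico_eq_sum_range]
          simp only [add_comm]
      _ ≤ _ := ((summable_nat_add_iff n₀).2 hsummable).sum_le_tsum _ fun i _ => by positivity
  have hTmono : Monotone T := by
    intro i j hij
    exact Finset.sum_le_sum_of_subset_of_nonneg (Finset.Ico_subset_Ico_right hij)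
      fun _ _ _ => by positivity
  have hTsucc : ∀ n, n₀ ≤ n → T (n + 1) - T n = (1 / 2 : ℝ) ^ k n := fun n hn => by
    simp only [hT, Finset.sum_Ico_succ_top hn]; ring
  -- Consecutive intervals; for `n < n₀` they are empty since `T` vanishes up to `n₀`, so
  -- disjointness holds for all indices.
  set A : ℕ → Set ℝ := fun n => Set.Ico (T n) (T (n + 1)) with hA
  have hAm : ∀ n, MeasurableSet (A n) := fun n => measurableSet_Ico
  have hAvol : ∀ n, n₀ ≤ n → unitVolume (A n) = ENNReal.ofReal ((1 / 2 : ℝ) ^ k n) := fun n hn => by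
    rw [hA]
    simp only
    rw [unitVolume_Ico (hT0 n) (hT1 _), hTsucc n hn]
  have hcoe : ∀ n, ∀ᵐ t ∂unitVolume, t ∉ A n →
      ((m n / f₀ (k n)) • L0.ind (A n) (hAm n)) t = 0 := fun n => by
    filter_upwards [L0.coeFn_ind (A n) (hAm n),
      AEEqFun.coeFn_smul (m n / f₀ (k n)) (L0.ind (A n) (hAm n))] with t h1 h2 h3
    rw [h2, Pi.smul_apply, h1, Set.indicator_of_notMem h3, smul_zero]
  refine ⟨n₀, fun n => (m n / f₀ (k n)) • L0.ind (A n) (hAm n), fun i j hij => ?_, fun n hn => ?_⟩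
  · rw [L0.abs_inf_abs_eq_zero_iff]
    have hdis := hTmono.pairwise_disjoint_on_Ico_succ hij
    filter_upwards [hcoe i, hcoe j] with t h1 h2
    by_cases hti : t ∈ A i
    · exact Or.inr (h2 fun htj => Set.disjoint_left.1 hdis hti htj)
    · exact Or.inl (h1 hti)
  · obtain ⟨hk1, hk2, -⟩ := hk n hn
    have hmn := hm.pos n
    have hf0 := hf₀ (k n)
    have hf1 := hf₁ (k n)
    have hl : 0 < m n / f₀ (k n) := div_pos hmn hf0
    have hnorm : ‖m n / f₀ (k n)‖ₑ = ENNReal.ofReal (m n / f₀ (k n)) := by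
      rw [← ofReal_norm, Real.norm_of_nonneg hl.le]
    refine ⟨?_, ?_, ?_⟩
    · rw [h₀.isBanachFunctionNorm.smul, heq₀ _ _ _ (hAvol n hn), hnorm, ← ENNReal.ofReal_mul hl.le,
        div_mul_cancel₀ _ hf0.ne']
    · rw [h₁.isBanachFunctionNorm.smul, heq₁ _ _ _ (hAvol n hn), hnorm, ← ENNReal.ofReal_mul hl.le]
      apply ENNReal.ofReal_le_ofReal
      rw [div_mul_eq_mul_div, div_le_iff₀ hf0, inv_mul_eq_div, le_div_iff₀ hmn]
      linarith
    · refine le_peetreK_smul_ind h₀.isBanachFunctionNorm h₁.isBanachFunctionNorm hl (hAm n)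
        fun B hB hAB => ?_
      have hBvol : ENNReal.ofReal ((1 / 2 : ℝ) ^ (k n + 1)) ≤ unitVolume B := by
        rw [hAvol n hn] at hAB
        have h2 : ENNReal.ofReal ((1 / 2 : ℝ) ^ k n)
            = 2 * ENNReal.ofReal ((1 / 2 : ℝ) ^ (k n + 1)) := by
          rw [← ENNReal.ofReal_ofNat, ← ENNReal.ofReal_mul (by norm_num), pow_succ]
          congr 1; ring
        rw [h2] at hAB
        exact (ENNReal.mul_le_mul_iff_right (by norm_num) (by norm_num)).1 hAB
      have hl2 : 0 ≤ m n / f₀ (k n) / 2 := by positivity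
      constructor
      · refine le_trans ?_ (mul_le_mul_right (mul_le_mul_right (hlow₀ _ B hB hBvol) _) _)
        rw [← ENNReal.ofReal_mul hl2, ← ENNReal.ofReal_mul (by positivity)]
        apply ENNReal.ofReal_le_ofReal
        have h3 := hhalf₀ (k n)
        have h4 : (m n)⁻¹ * (m n / f₀ (k n) / 2 * f₀ (k n + 1)) = f₀ (k n + 1) / (2 * f₀ (k n)) := by
          field_simp
        rw [h4, le_div_iff₀ (by positivity)]
        linarith
      · refine le_trans ?_ (mul_le_mul_right (mul_le_mul_right (hlow₁ _ B hB hBvol) _) _)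
        rw [← ENNReal.ofReal_mul hl2, ← ENNReal.ofReal_mul hmn.le]
        apply ENNReal.ofReal_le_ofReal
        have h3 := mul_le_mul_of_nonneg_left (hhalf₁ (k n)) (by positivity : 0 ≤ 2 * (m n) ^ 2)
        have h4 : m n * (m n / f₀ (k n) / 2 * f₁ (k n + 1))
            = (m n) ^ 2 * f₁ (k n + 1) / (2 * f₀ (k n)) := by
          field_simp
        rw [h4, le_div_iff₀ (by positivity)]
        linarith

/-- The summand is the bound for `k_n(w_i)`, from the `X₀`-norm if `i < n` and from the `X₁`-norm if
`i > n`. The weight condition thus controls the off-diagonal part of each row. -/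
theorem IsAdmissibleWeight.sum_le {m : ℕ → ℝ} (hm : IsAdmissibleWeight m) (S : Finset ℕ) (n : ℕ) :
    ∑ i ∈ S.erase n, (if i < n then (m n)⁻¹ * m i else m n * (m i)⁻¹) ≤ (1 / 2 : ℝ) ^ (n + 2) := by
  have hpos := hm.pos
  set κ : ℕ → ℝ := fun i => if i < n then (m n)⁻¹ * m i else m n * (m i)⁻¹ with hκ
  have hκ0 : ∀ i, 0 ≤ κ i := fun i => by
    have h1 := hpos i
    have h2 := hpos n
    simp only [hκ]; split_ifs <;> positivity
  set N := S.sup id + 1 with hN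
  have hsub : S.erase n ⊆ Finset.range n ∪ Finset.Ico (n + 1) N := by
    intro i hi
    rw [Finset.mem_erase] at hi
    have : i ≤ S.sup id := Finset.le_sup (f := id) hi.2
    rw [Finset.mem_union, Finset.mem_range, Finset.mem_Ico]
    omega
  have hdis : Disjoint (Finset.range n) (Finset.Ico (n + 1) N) := by
    rw [Finset.disjoint_left]
    intro i h1 h2
    rw [Finset.mem_range] at h1
    rw [Finset.mem_Ico] at h2
    omega
  have hsum : Summable fun i => (m (n + 1 + i))⁻¹ := by
    simp only [add_comm (n + 1)]
    exact (summable_nat_add_iff (n + 1)).2 hm.summable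
  calc _ ≤ ∑ i ∈ Finset.range n ∪ Finset.Ico (n + 1) N, κ i :=
        Finset.sum_le_sum_of_subset_of_nonneg hsub fun i _ _ => hκ0 i
    _ = ∑ i ∈ Finset.range n, (m n)⁻¹ * m i + ∑ i ∈ Finset.Ico (n + 1) N, m n * (m i)⁻¹ := by
        rw [Finset.sum_union hdis]
        congr 1
        · exact Finset.sum_congr rfl fun i hi => if_pos (Finset.mem_range.1 hi)
        · exact Finset.sum_congr rfl fun i hi => if_neg (by have := (Finset.mem_Ico.1 hi).1; omega)
    _ = (m n)⁻¹ * ∑ i ∈ Finset.range n, m i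
          + m n * ∑ i ∈ Finset.range (N - (n + 1)), (m (n + 1 + i))⁻¹ := by
        rw [← Finset.mul_sum, ← Finset.mul_sum, Finset.sum_Ico_eq_sum_range]
    _ ≤ (m n)⁻¹ * ∑ i ∈ Finset.range n, m i + m n * ∑' i, (m (n + 1 + i))⁻¹ := by
        have := hpos n
        gcongr
        exact hsum.sum_le_tsum _ fun i _ => inv_nonneg.2 (hpos _).le
    _ ≤ _ := (hm.lt n).le

/-! ### Block bases of `E` inside the Lions-Peetre space -/

section

variable {ρ₀ ρ₁ : L0 → ℝ≥0∞} {E : Type*} [NormedAddCommGroup E] [NormedSpace ℝ E]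
  {e : UnconditionalSchauderBasis ℕ ℝ E} {m : ℕ → ℝ}

/-- Only the diagonal matters: by disjointness the `n`-th K-functional of the sum is at least `|d n|
k_n(w n) ≥ |d n|/8`. -/
theorem enorm_sum_le_lionsPeetre (h₀ : IsBanachFunctionNorm ρ₀)
    (h₁ : IsBanachFunctionNorm ρ₁) (h : IsOneUnconditional e) {α β : ℕ → ℝ} {w : ℕ → L0}
    (hw : ∀ i j, i ≠ j → |w i| ⊓ |w j| = 0) {S : Finset ℕ}
    (hK : ∀ n ∈ S, ENNReal.ofReal (1 / 8) ≤ peetreK ρ₀ ρ₁ (α n) (β n) (w n)) (d : ℕ → ℝ) :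
    ‖∑ n ∈ S, d n • e n‖ₑ ≤ 8 * lionsPeetre ρ₀ ρ₁ e α β (∑ n ∈ S, d n • w n) := by
  have hae := L0.ae_disjoint_of_forall hw
  have h1 : ‖(1 / 8 : ℝ) • ∑ n ∈ S, d n • e n‖ₑ
      ≤ lionsPeetre ρ₀ ρ₁ e α β (∑ n ∈ S, d n • w n) := by
    refine h.le_lionsPeetre fun n => ?_
    rw [map_smul, UnconditionalSchauderBasis.coord_sum]
    split_ifs with hn
    · rw [smul_eq_mul, abs_mul, abs_of_pos (by norm_num), mul_comm,
        ENNReal.ofReal_mul (abs_nonneg _), ← Real.enorm_eq_ofReal_abs]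
      calc _ ≤ ‖d n‖ₑ * peetreK ρ₀ ρ₁ (α n) (β n) (w n) := by gcongr; exact hK n hn
        _ = peetreK ρ₀ ρ₁ (α n) (β n) (d n • w n) := (peetreK_smul h₀ h₁ _ _).symm
        _ ≤ _ := peetreK_mono h₀ h₁ (L0.abs_smul_le_abs_sum hae d hn)
    · simp
  have h2 : ∑ n ∈ S, d n • e n = (8 : ℝ) • (1 / 8 : ℝ) • ∑ n ∈ S, d n • e n := by
    rw [smul_smul]; norm_num
  rw [h2, enorm_smul]
  have h3 : ‖(8 : ℝ)‖ₑ = 8 := by rw [Real.enorm_eq_ofReal (by norm_num)]; simp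
  rw [h3]
  gcongr

theorem lionsPeetre_sum_le [CompleteSpace E] (h₀ : IsBanachFunctionNorm ρ₀)
    (h₁ : IsBanachFunctionNorm ρ₁) (h : IsOneUnconditional e) (he : ∀ n, ‖e n‖ = 1)
    (hm : IsAdmissibleWeight m) {w : ℕ → L0} {S : Finset ℕ}
    (hw : ∀ n ∈ S, ρ₀ (w n) ≤ ENNReal.ofReal (m n) ∧ ρ₁ (w n) ≤ ENNReal.ofReal ((m n)⁻¹))
    (d : ℕ → ℝ) :
    lionsPeetre ρ₀ ρ₁ e (fun n => (m n)⁻¹) m (∑ n ∈ S, d n • w n)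
      ≤ 2 * ‖∑ n ∈ S, d n • e n‖ₑ := by
  have hpos := hm.pos
  set D := ‖∑ n ∈ S, d n • e n‖ with hD
  have hdD : ∀ n ∈ S, |d n| ≤ D := fun n hn => by
    have := h.abs_coord_le he n (∑ n ∈ S, d n • e n)
    rwa [UnconditionalSchauderBasis.coord_sum, if_pos hn] at this
  have hgeo : HasSum (fun n : ℕ => (1 / 2 : ℝ) ^ (n + 2)) (1 / 2) := by
    have h1 := hasSum_geometric_two.mul_left (1 / 4 : ℝ)
    have h2 : (fun n : ℕ => (1 / 2 : ℝ) ^ (n + 2)) = fun n => 1 / 4 * (1 / 2) ^ n := by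
      funext n; rw [pow_add]; ring
    rw [h2]
    exact (show (1 : ℝ) / 4 * 2 = 1 / 2 by norm_num) ▸ h1
  have hsum : Summable fun n : ℕ => ((1 / 2 : ℝ) ^ (n + 2)) • e n := by
    refine Summable.of_norm ?_
    simp only [norm_smul, he, mul_one]
    exact hgeo.summable.norm
  -- The off-diagonal terms contribute at most `D * 2^{-(n+2)}` to the `n`-th coordinate, as every
  -- `|d i| ≤ D`. The profile is therefore dominated by `∑ |d n| • e n + D • z`, of norm at most
  -- `3D/2`.
  set z := ∑' n : ℕ, ((1 / 2 : ℝ) ^ (n + 2)) • e n with hz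
  have hznorm : ‖z‖ ≤ 1 / 2 := by
    refine tsum_of_norm_bounded hgeo fun n => ?_
    rw [norm_smul, he, mul_one, Real.norm_of_nonneg (by positivity)]
  set κ : ℕ → ℕ → ℝ := fun n i => if i < n then (m n)⁻¹ * m i else m n * (m i)⁻¹ with hκ
  have hκ0 : ∀ n i, 0 ≤ κ n i := fun n i => by
    have h1 := hpos i
    have h2 := hpos n
    simp only [hκ]; split_ifs <;> positivity
  have hKκ : ∀ n, ∀ i ∈ S, peetreK ρ₀ ρ₁ ((m n)⁻¹) (m n) (w i) ≤ ENNReal.ofReal (κ n i) := by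
    intro n i hi
    simp only [hκ]
    split_ifs with hlt
    · rw [ENNReal.ofReal_mul (inv_nonneg.2 (hpos n).le)]
      exact (peetreK_le_left h₁ _).trans (by gcongr; exact (hw i hi).1)
    · rw [ENNReal.ofReal_mul (hpos n).le]
      exact (peetreK_le_right h₀ _).trans (by gcongr; exact (hw i hi).2)
  have hbound : lionsPeetre ρ₀ ρ₁ e (fun n => (m n)⁻¹) m (∑ n ∈ S, d n • w n)
      ≤ ‖∑ n ∈ S, |d n| • e n + D • z‖ₑ := by
    refine h.lionsPeetre_le fun n => ?_
    rw [map_add, map_smul, UnconditionalSchauderBasis.coord_sum,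
      UnconditionalSchauderBasis.coord_of_hasSum e hsum.hasSum, smul_eq_mul]
    calc peetreK ρ₀ ρ₁ ((m n)⁻¹) (m n) (∑ n ∈ S, d n • w n)
        ≤ ∑ i ∈ S, ‖d i‖ₑ * peetreK ρ₀ ρ₁ ((m n)⁻¹) (m n) (w i) := peetreK_sum_smul_le h₀ h₁ S d w
      _ ≤ ∑ i ∈ S, ENNReal.ofReal (|d i| * κ n i) := by
          refine Finset.sum_le_sum fun i hi => ?_
          rw [ENNReal.ofReal_mul (abs_nonneg _), Real.enorm_eq_ofReal_abs]
          gcongr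
          exact hKκ n i hi
      _ = ENNReal.ofReal (∑ i ∈ S, |d i| * κ n i) :=
          (ENNReal.ofReal_sum_of_nonneg fun i _ => mul_nonneg (abs_nonneg _) (hκ0 n i)).symm
      _ ≤ _ := by
          apply ENNReal.ofReal_le_ofReal
          have hrest : ∑ i ∈ S.erase n, |d i| * κ n i ≤ D * (1 / 2 : ℝ) ^ (n + 2) := by
            calc _ ≤ ∑ i ∈ S.erase n, D * κ n i := Finset.sum_le_sum fun i hi =>
                  mul_le_mul_of_nonneg_right (hdD i (Finset.mem_of_mem_erase hi)) (hκ0 n i)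
              _ = D * ∑ i ∈ S.erase n, κ n i := (Finset.mul_sum _ _ _).symm
              _ ≤ _ := mul_le_mul_of_nonneg_left (hm.sum_le S n) (norm_nonneg _)
          split_ifs with hn
          · rw [← Finset.add_sum_erase S _ hn]
            have : κ n n = 1 := by simp [hκ, (hpos n).ne']
            rw [this, mul_one]
            linarith
          · rw [Finset.erase_eq_of_notMem hn] at hrest
            linarith
  refine hbound.trans ?_
  have hD2 : ‖∑ n ∈ S, |d n| • e n + D • z‖ ≤ 2 * D := by
    have h2 : ‖∑ n ∈ S, |d n| • e n‖ ≤ D := h.norm_sum_smul_le S fun n _ => by rw [abs_abs]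
    have h3 : ‖D • z‖ ≤ D * (1 / 2) := by
      rw [norm_smul, Real.norm_of_nonneg (norm_nonneg _)]
      exact mul_le_mul_of_nonneg_left hznorm (norm_nonneg _)
    linarith [norm_add_le (∑ n ∈ S, |d n| • e n) (D • z), norm_nonneg (∑ n ∈ S, d n • e n)]
  rw [← ofReal_norm, ← ofReal_norm]
  refine (ENNReal.ofReal_le_ofReal hD2).trans (le_of_eq ?_)
  rw [ENNReal.ofReal_mul (by norm_num), ENNReal.ofReal_ofNat]

theorem StrictMono.sum_smul_sum_Ico {V : Type*} [AddCommGroup V] [Module ℝ V] {q : ℕ → ℕ}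
    (hq : StrictMono q) (F : Finset ℕ) {b a d : ℕ → ℝ} (f : ℕ → V)
    (hd : ∀ j, ∀ n ∈ Finset.Ico (q j) (q (j + 1)), d n = b j * a n) :
    ∑ j ∈ F, b j • ∑ n ∈ Finset.Ico (q j) (q (j + 1)), a n • f n
      = ∑ n ∈ F.biUnion fun j => Finset.Ico (q j) (q (j + 1)), d n • f n := by
  rw [Finset.sum_biUnion]
  · refine Finset.sum_congr rfl fun j _ => ?_
    rw [Finset.smul_sum]
    exact Finset.sum_congr rfl fun n hn => by rw [hd j n hn, smul_smul]
  · intro i _ j _ hij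
    simp only [Function.onFun]
    rw [Finset.disjoint_left]
    exact fun n hi hj => hij (hq.eq_of_mem_Ico hi hj)

/-- Each `e n` in a block is replaced by `w n`, and the resulting vectors, of norms between `1/8`
and `2`, are normalized. -/
theorem exists_disjoint_lionsPeetre_equiv [CompleteSpace E] (h₀ : IsRISpace ρ₀)
    (h₁ : IsRISpace ρ₁) (h₀₁ : StrictlyEmbedded ρ₀ ρ₁) (h : IsOneUnconditional e)
    (he : ∀ n, ‖e n‖ = 1) (hm : IsAdmissibleWeight m) {u : ℕ → E}
    (hu : IsNormalizedBlockBasis e u) :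
    ∃ (φ : ℕ → ℕ) (x : ℕ → L0), StrictMono φ ∧
      IsNormalizedDisjoint (lionsPeetre ρ₀ ρ₁ e (fun n => (m n)⁻¹) m) x ∧
      EquivSeq (lionsPeetre ρ₀ ρ₁ e (fun n => (m n)⁻¹) m) x (fun y : E => ‖y‖ₑ) (u ∘ φ) := by
  have hB₀ := h₀.isBanachFunctionNorm
  have hB₁ := h₁.isBanachFunctionNorm
  have hW := isBanachFunctionNorm_lionsPeetre hB₀ hB₁ h₀₁ h he hm
  set W := lionsPeetre ρ₀ ρ₁ e (fun n => (m n)⁻¹) m with hWdef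
  obtain ⟨n₀, w, hdis, hw⟩ := exists_disjoint_peetreK h₀ h₁ h₀₁ hm
  obtain ⟨hu1, q', a, hq', hqa'⟩ := hu
  -- The first `n₀` blocks are dropped: since `q' (j + n₀) ≥ j + n₀`, the remaining ones only
  -- involve indices where `w` has its estimates.
  set q : ℕ → ℕ := fun j => q' (j + n₀) with hqdef
  have hq : StrictMono q := fun i j hij => hq' (by omega)
  have hqa : ∀ j, u (j + n₀) = ∑ n ∈ Finset.Ico (q j) (q (j + 1)), a n • e n := fun j => by
    rw [hqa', hqdef]; simp only [add_right_comm]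
  have hge : ∀ j, ∀ n ∈ Finset.Ico (q j) (q (j + 1)), n₀ ≤ n := fun j n hn => by
    have h1 : j + n₀ ≤ q j := hq'.id_le (j + n₀)
    have := (Finset.mem_Ico.1 hn).1
    omega
  set y : ℕ → L0 := fun j => ∑ n ∈ Finset.Ico (q j) (q (j + 1)), a n • w n with hy
  have hlow : ∀ j, 1 ≤ 8 * W (y j) := fun j => by
    have h2 := enorm_sum_le_lionsPeetre hB₀ hB₁ h hdis (α := fun n => (m n)⁻¹) (β := m)
      (fun n hn => (hw n (hge j n hn)).2.2) a
    rwa [← hqa, ← ofReal_norm, hu1, ENNReal.ofReal_one] at h2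
  have hup : ∀ j, W (y j) ≤ 2 := fun j => by
    have h2 := lionsPeetre_sum_le hB₀ hB₁ h he hm
      (fun n hn => ⟨(hw n (hge j n hn)).1, (hw n (hge j n hn)).2.1⟩) a
    rwa [← hqa, ← ofReal_norm, hu1, ENNReal.ofReal_one, mul_one] at h2
  have hfin : ∀ j, W (y j) ≠ ∞ := fun j => ((hup j).trans_lt (by norm_num)).ne
  set c : ℕ → ℝ := fun j => (W (y j)).toReal with hc
  have hcW : ∀ j, ENNReal.ofReal (c j) = W (y j) := fun j => ENNReal.ofReal_toReal (hfin j)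
  have hc2 : ∀ j, c j ≤ 2 := fun j => ENNReal.toReal_le_of_le_ofReal (by norm_num)
    (by simpa using hup j)
  have hc8 : ∀ j, 1 ≤ 8 * c j := fun j => by
    have h2 := ENNReal.toReal_mono (ENNReal.mul_ne_top (by norm_num) (hfin j)) (hlow j)
    simpa using h2
  have hc0 : ∀ j, 0 < c j := fun j => by linarith [hc8 j]
  have hequiv : ∀ (F : Finset ℕ) (b : ℕ → ℝ),
      W (∑ j ∈ F, b j • y j) ≤ 2 * ‖∑ j ∈ F, b j • u (j + n₀)‖ₑ ∧
      ‖∑ j ∈ F, b j • u (j + n₀)‖ₑ ≤ 8 * W (∑ j ∈ F, b j • y j) := by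
    intro F b
    obtain ⟨d, hd⟩ := hq.exists_eq_on_Ico fun j n => b j * a n
    simp only [hqa, hy]
    rw [hq.sum_smul_sum_Ico F e hd, hq.sum_smul_sum_Ico F w hd]
    have hS : ∀ n ∈ F.biUnion fun j => Finset.Ico (q j) (q (j + 1)), n₀ ≤ n := fun n hn => by
      obtain ⟨j, -, hj⟩ := Finset.mem_biUnion.1 hn
      exact hge j n hj
    exact ⟨lionsPeetre_sum_le hB₀ hB₁ h he hm
        (fun n hn => ⟨(hw n (hS n hn)).1, (hw n (hS n hn)).2.1⟩) d,
      enorm_sum_le_lionsPeetre hB₀ hB₁ h hdis (fun n hn => (hw n (hS n hn)).2.2) d⟩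
  have hzero : ∀ j, ∀ᵐ t ∂unitVolume,
      (∀ n ∈ Finset.Ico (q j) (q (j + 1)), w n t = 0) → ((c j)⁻¹ • y j) t = 0 := by
    intro j
    have hsmul : ∀ᵐ t ∂unitVolume, ∀ n, (a n • w n) t = a n * w n t := ae_all_iff.2 fun n => by
      filter_upwards [AEEqFun.coeFn_smul (a n) (w n)] with t ht
      rw [ht, Pi.smul_apply, smul_eq_mul]
    filter_upwards [AEEqFun.coeFn_smul (c j)⁻¹ (y j), hsmul,
      L0.coeFn_sum (Finset.Ico (q j) (q (j + 1))) fun n => a n • w n] with t h1 h2 h3 h4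
    rw [h1, Pi.smul_apply, hy]
    simp only
    rw [h3, Finset.sum_eq_zero fun n hn => by rw [h2, h4 n hn, mul_zero], smul_zero]
  -- The constant `16` is `2 * 8` in both directions: the comparison of block sums costs `2` or `8`,
  -- and the normalization, with `(c j)⁻¹` between `1/2` and `8`, costs `8` or `2`.
  refine ⟨fun j => j + n₀, fun j => (c j)⁻¹ • y j, fun i j hij => by simpa using hij,
    ⟨fun j => ?_, fun i j hij => ?_⟩, 16, fun F b => ?_⟩
  · rw [hW.smul, ← hcW, ← ofReal_norm, Real.norm_of_nonneg (inv_nonneg.2 (hc0 j).le),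
      ← ENNReal.ofReal_mul (inv_nonneg.2 (hc0 j).le), inv_mul_cancel₀ (hc0 j).ne',
      ENNReal.ofReal_one]
  · rw [L0.abs_inf_abs_eq_zero_iff]
    filter_upwards [L0.ae_disjoint_of_forall hdis, hzero i, hzero j] with t h1 h2 h3
    by_cases hi : ∀ n ∈ Finset.Ico (q i) (q (i + 1)), w n t = 0
    · exact Or.inl (h2 hi)
    · push Not at hi
      obtain ⟨n, hn, hne⟩ := hi
      refine Or.inr (h3 fun k hk => (h1 n k ?_).resolve_left hne)
      rintro rfl
      exact hij (hq.eq_of_mem_Ico hn hk)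
  · have h2 := hequiv F fun j => b j * (c j)⁻¹
    simp only [← smul_smul] at h2
    have hcmp : ∀ {a' b' : ℕ → ℝ} {C : ℝ} (_ : 0 ≤ C), (∀ j, |a' j| ≤ C * |b' j|) →
        ‖∑ j ∈ F, a' j • u (j + n₀)‖ₑ ≤ ENNReal.ofReal C * ‖∑ j ∈ F, b' j • u (j + n₀)‖ₑ := by
      intro a' b' C hC hab
      have h3 := h.norm_sum_blocks_le hq hqa F (a := a') (b := fun j => C * b' j) fun j _ => by
        rw [abs_mul, abs_of_nonneg hC]; exact hab j
      simp only [← smul_smul, ← Finset.smul_sum] at h3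
      rw [norm_smul, Real.norm_of_nonneg hC] at h3
      rw [← ofReal_norm, ← ofReal_norm, ← ENNReal.ofReal_mul hC]
      exact ENNReal.ofReal_le_ofReal h3
    constructor
    · refine h2.1.trans ?_
      have h3 := hcmp (a' := fun j => b j * (c j)⁻¹) (b' := b) (C := 8) (by norm_num) fun j => by
        have : (c j)⁻¹ ≤ 8 := inv_le_of_inv_le₀ (by norm_num) (by linarith [hc8 j])
        rw [abs_mul, abs_of_pos (inv_pos.2 (hc0 j)), mul_comm]
        exact mul_le_mul_of_nonneg_right this (abs_nonneg _)
      simp only [← smul_smul] at h3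
      calc _ ≤ 2 * (ENNReal.ofReal 8 * ‖∑ j ∈ F, b j • u (j + n₀)‖ₑ) := by gcongr
        _ = _ := by
          rw [← mul_assoc, ENNReal.ofReal_ofNat]
          norm_num
    · have h3 := hcmp (a' := b) (b' := fun j => b j * (c j)⁻¹) (C := 2) (by norm_num) fun j => by
        have : 1 ≤ 2 * (c j)⁻¹ := by
          rw [← div_eq_mul_inv, le_div_iff₀ (hc0 j)]; linarith [hc2 j]
        rw [abs_mul, abs_of_pos (inv_pos.2 (hc0 j))]
        nlinarith [abs_nonneg (b j)]
      simp only [← smul_smul] at h3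
      calc _ ≤ _ := h3
        _ ≤ ENNReal.ofReal 2 * (8 * W (∑ j ∈ F, b j • (c j)⁻¹ • y j)) := by gcongr; exact h2.2
        _ = _ := by
          rw [← mul_assoc, ENNReal.ofReal_ofNat]
          norm_num

end

/-! ### Transfer of homogeneity -/

section Transfer

variable {V V' : Type*} [AddCommGroup V] [Module ℝ V] [AddCommGroup V'] [Module ℝ V']
  {N : V → ℝ≥0∞} {N' : V' → ℝ≥0∞}

theorem EquivSeq.haveEquivSubseq {x y : ℕ → V} {u v : ℕ → V'} {φ ψ : ℕ → ℕ}
    (hφ : StrictMono φ) (hψ : StrictMono ψ)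
    (hx : EquivSeq N (x ∘ φ) N' u) (hy : EquivSeq N (y ∘ ψ) N' v)
    (huv : HaveEquivSubseq N' u v) : HaveEquivSubseq N x y := by
  obtain ⟨σ, τ, hσ, hτ, hστ⟩ := huv
  exact ⟨φ ∘ σ, ψ ∘ τ, hφ.comp hσ, hψ.comp hτ,
    ((hx.comp hσ).trans hστ).trans (hy.comp hτ).symm⟩

theorem EquivSeq.hasLpSubseq {p : ℝ≥0∞} [Fact (1 ≤ p)] {x : ℕ → V} {u : ℕ → V'} {φ : ℕ → ℕ}
    (hφ : StrictMono φ) (hx : EquivSeq N (x ∘ φ) N' u) (hu : HasLpSubseq N' p u) :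
    HasLpSubseq N p x := by
  obtain ⟨σ, hσ, hστ⟩ := hu
  exact ⟨φ ∘ σ, hφ.comp hσ, (hx.comp hσ).trans hστ⟩

end Transfer

theorem theorem1
    -- rearrangement invariant spaces `X₀ ⊂ X₁` (given by their norms) with strict embedding
    (ρ₀ ρ₁ : L0 → ℝ≥0∞) (h₀ : IsRISpace ρ₀) (h₁ : IsRISpace ρ₁) (h₀₁ : StrictlyEmbedded ρ₀ ρ₁)
    -- a Banach space with a normalized 1-unconditional basis, ordered by that basis
    {E : Type*} [NormedAddCommGroup E] [NormedSpace ℝ E] [CompleteSpace E] [Lattice E]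
    (e : UnconditionalSchauderBasis ℕ ℝ E) (he : ∀ n, ‖e n‖ = 1) (hunc : IsOneUnconditional e)
    (hord : ∀ x y : E, x ≤ y ↔ ∀ n, e.coord n x ≤ e.coord n y)
    -- the fixed sequence of weights
    (m : ℕ → ℝ) (hm : IsAdmissibleWeight m) :
    [ IsDH (fun x : E => ‖x‖ₑ),
      ∀ u v : ℕ → E, IsNormalizedBlockBasis e u → IsNormalizedBlockBasis e v →
        HaveEquivSubseq (fun x : E => ‖x‖ₑ) u v,
      IsRISpace (lionsPeetre ρ₀ ρ₁ e (fun n => (m n)⁻¹) m) ∧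
        IsDH (lionsPeetre ρ₀ ρ₁ e (fun n => (m n)⁻¹) m) ].TFAE ∧
    ∀ (p : ℝ≥0∞) [Fact (1 ≤ p)],
    [ IsPDH (fun x : E => ‖x‖ₑ) p,
      ∀ u : ℕ → E, IsNormalizedBlockBasis e u → HasLpSubseq (fun x : E => ‖x‖ₑ) p u,
      IsRISpace (lionsPeetre ρ₀ ρ₁ e (fun n => (m n)⁻¹) m) ∧
        IsPDH (lionsPeetre ρ₀ ρ₁ e (fun n => (m n)⁻¹) m) p ].TFAE := by
  have hRI := isRISpace_lionsPeetre h₀ h₁ h₀₁ hunc he hm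
  -- Three passages suffice: disjoint sequences in `E`, and those in `W`, have subsequences
  -- equivalent to block bases, and every block basis has a subsequence equivalent to a disjoint
  -- sequence in `W`.
  have hEW := fun {x : ℕ → E} hx => hunc.exists_equiv_block_of_disjoint hord (x := x) hx
  have hWE := fun {x : ℕ → L0} hx => exists_equiv_block_of_isNormalizedDisjoint_lionsPeetre
    h₀.isBanachFunctionNorm h₁.isBanachFunctionNorm h₀₁ hunc he hm (x := x) hx
  have hblock := fun {u : ℕ → E} hu =>
    exists_disjoint_lionsPeetre_equiv h₀ h₁ h₀₁ hunc he hm (u := u) hu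
  refine ⟨?_, fun p _ => ?_⟩
  · tfae_have 1 → 2 := fun h u v hu hv =>
      h u v (hu.isNormalizedDisjoint hunc hord) (hv.isNormalizedDisjoint hunc hord)
    tfae_have 2 → 1 := by
      intro h x y hx hy
      obtain ⟨φ, hφ, u, hu, hxu⟩ := hEW hx
      obtain ⟨ψ, hψ, v, hv, hyv⟩ := hEW hy
      exact EquivSeq.haveEquivSubseq hφ hψ hxu hyv (h u v hu hv)
    tfae_have 2 → 3 := by
      refine fun h => ⟨hRI, fun x y hx hy => ?_⟩
      obtain ⟨φ, hφ, u, hu, hxu⟩ := hWE hx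
      obtain ⟨ψ, hψ, v, hv, hyv⟩ := hWE hy
      exact EquivSeq.haveEquivSubseq hφ hψ hxu hyv (h u v hu hv)
    tfae_have 3 → 2 := by
      intro h u v hu hv
      obtain ⟨φ, x, hφ, hx, hxu⟩ := hblock hu
      obtain ⟨ψ, y, hψ, hy, hyv⟩ := hblock hv
      exact EquivSeq.haveEquivSubseq hφ hψ hxu.symm hyv.symm
        (h.2 x y hx hy)
    tfae_finish
  · tfae_have 1 → 2 := fun h u hu => h u (hu.isNormalizedDisjoint hunc hord)
    tfae_have 2 → 1 := by
      intro h x hx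
      obtain ⟨φ, hφ, u, hu, hxu⟩ := hEW hx
      exact hxu.hasLpSubseq hφ (h u hu)
    tfae_have 2 → 3 := by
      refine fun h => ⟨hRI, fun x hx => ?_⟩
      obtain ⟨φ, hφ, u, hu, hxu⟩ := hWE hx
      exact hxu.hasLpSubseq hφ (h u hu)
    tfae_have 3 → 2 := by
      intro h u hu
      obtain ⟨φ, x, hφ, hx, hxu⟩ := hblock hu
      exact hxu.symm.hasLpSubseq hφ (h.2 x hx)
    tfae_finish
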